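/- **Definitions.** Let $\mathcal D$ be a category with finite coproducts and a final object $*$; write $\Delta^{\circ}\mathcal D$ for its simplicial objects and $A\times\Delta$ for the constant simplicial object at $A$. For $X\in\Delta^\circ\mathcal D$ let $X\boxtimes\Delta[1]$ be given by $(X\boxtimes\Delta[1])_n=\coprod_{\Delta[1]_n}X_n$. For $Y\xleftarrow{F}X\xrightarrow{G}Z$ in $\Delta^\circ\mathcal D$ let $Cyl(F,G)$ be the pushout of $F\sqcup G:X\sqcup X\to Y\sqcup Z$ along $d^0\sqcup d^1:X\sqcup X\to X\boxtimes\Delta[1]$, with canonical map $I:Y\to Cyl(F,G)$. Put $C(F)=Cyl(F,X\to *)$ and $\Lambda X=C(X\to *)$, and let $P:C(F)\to\Lambda X$ be induced by $Y\to *$. A *simplicial descent category* is such a $\mathcal D$ with data $(\mathrm E,\mathbf s,\mu,\lambda)$, where: (a) $\mathrm E$ is a class of morphisms (equivalences) which is saturated ($f\in\mathrm E$ iff $f$ is invertible in $Ho\mathcal D=\mathcal D[\mathrm E^{-1}]$) and satisfies $\mathrm E\sqcup\mathrm E\subseteq\mathrm E$; an object $A$ is acyclic if $A\to *$ is in $\mathrm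 E$; (b) $\mathbf s:\Delta^\circ\mathcal D\to\mathcal D$ is a functor such that the canonical maps $\mathbf sX\sqcup\mathbf sY\to\mathbf s(X\sqcup Y)$ are in $\mathrm E$; (c) $\mu$ is an isomorphism $\mathbf s\mathrm D\to\mathbf s\mathbf s$ in $Fun(\Delta^\circ\Delta^\circ\mathcal D,\mathcal D)[\mathrm E^{-1}]$ (localization at the objectwise equivalences), where $\mathbf s\mathrm DZ$ is the simple of the diagonal of $Z$ and $\mathbf s\mathbf sZ=\mathbf s(n\mapsto\mathbf s(m\mapsto Z_{n,m}))$; (d) $\lambda:\mathrm R:=\mathbf s(-\times\Delta)\to Id$ is a natural transformation with all $\lambda_A\in\mathrm E$, which has a natural section $\rho:Id\to\mathrm R$, $\lambda\circ\rho=Id$; (e) if all $f_n\in\mathrm E$, then $\mathbf s f\in\mathrm E$; (f) a morphism $f$ of $\mathcal D$ is in $\mathrm E$ iff $\mathbf sC(f\times\Delta)$ is acyclic; (g) $\mathbf s\Upsilon f\in\mathrm E$ iff $\mathbf sf\in\mathrm E$, where $\Upsilon$ reverses the order of faces and degeneracies; (h) the compositions $\mathbf sX\xrightarrow{\mu_{\Delta\times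 X}}\mathrm R\mathbf sX\xrightarrow{\lambda_{\mathbf sX}}\mathbf sX$ and $\mathbf sX\xrightarrow{\mu_{X\times\Delta}}\mathbf s(\mathrm RX)\xrightarrow{\mathbf s(\lambda_X)}\mathbf sX$ are the identity in $Fun(\Delta^\circ\mathcal D,\mathcal D)[\mathrm E^{-1}]$, where $(\Delta\times X)_{n,m}=X_m$ and $(X\times\Delta)_{n,m}=X_n$. For $f:A\to B$ in $\mathcal D$ put $c(f)=\mathbf sC(f\times\Delta)$, $\Sigma A=\mathbf s\Lambda(A\times\Delta)=c(A\to *)$, $i=\mathbf s(I)\rho_B:B\to c(f)$ and $p=\mathbf s(P):c(f)\to\Sigma A$. The functor $\Sigma$ preserves equivalences and so induces $\Sigma:Ho\mathcal D\to Ho\mathcal D$. A *cofiber sequence* is a triangle $A\to B\to C\to\Sigma A$ in $Ho\mathcal D$ isomorphic (by isomorphisms $a,b,c$, with $\Sigma a$ on the last term) to $A_0\xrightarrow{f}B_0\xrightarrow{i}c(f)\xrightarrow{p}\Sigma A_0$ for some morphism $f$ of $\mathcal D$. For $B$ in $\mathcal D$ let $CB=C(Id_{B\times\Delta})$, let $I_B:B\times\Delta\to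 CB$ be the canonical map and $\Lambda^1_2B=C(I_B)$. Let $P_1:\Lambda^1_2B\to\Lambda(B\times\Delta)$ send $CB$ to $*$ (that is, $P_1=P$), and let $P_2:\Lambda^1_2B\to\Lambda(B\times\Delta)$ be $P$ on $CB$ and send the outer cone on $B$ to the base point $*\to\Lambda(B\times\Delta)$. Put $p_i=\mathbf s(P_i)$. A *descent functor* $\psi:\mathcal D\to\mathcal D'$ is a functor with $\psi(\mathrm E)\subseteq\mathrm E'$, such that $\psi A\sqcup\psi B\to\psi(A\sqcup B)$ and $\psi(*)\to *'$ are in $\mathrm E'$, together with an isomorphism $\Theta:\psi\mathbf s\to\mathbf s'\psi$ of $Fun(\Delta^\circ\mathcal D,\mathcal D')[\mathrm E'^{-1}]$ such that in $Ho\mathcal D'$, for all $A\in\mathcal D$ and $Z\in\Delta^\circ\Delta^\circ\mathcal D$, $\lambda'_{\psi A}\circ\Theta_{A\times\Delta}=\psi(\lambda_A)$ and $\mathbf s'(\Theta_Z)\circ\Theta_{\mathbf sZ}\circ\psi(\mu_Z)=\mu'_{\psi Z}\circ\Theta_{\mathrm DZ}$ (here $\mathbf sZ$ is $n\mapsto\mathbf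 s(Z_n)$, and $\mathbf s'(\Theta_Z)$ is $\mathbf s'$ applied to $n\mapsto\Theta_{Z_n}$). **Theorem.** Let $\mathcal D$ be a simplicial descent category. The cofiber sequences of $Ho\mathcal D$ have the following properties. * **TR1.** (i) For every $A$ there is a cofiber sequence $A\xrightarrow{Id}A\to *\to\Sigma A$. (ii) Every triangle isomorphic to a cofiber sequence is a cofiber sequence. (iii) Every morphism $u:A\to B$ of $Ho\mathcal D$ is part of a cofiber sequence $A\xrightarrow{u}B\to C\to\Sigma A$. * **Non-stable TR2.** Each $p_1:\mathbf s\Lambda^1_2B\to\Sigma B$ is in $\mathrm E$. The maps $m_B=p_2p_1^{-1}:\Sigma B\to\Sigma B$ form a natural transformation $m:\Sigma\to\Sigma$ of functors on $Ho\mathcal D$ with $m^2=Id$. If $A\xrightarrow{u}B\xrightarrow{v}C\xrightarrow{w}\Sigma A$ is a cofiber sequence, then so is $B\xrightarrow{v}C\xrightarrow{w}\Sigma A\xrightarrow{m_B\circ\Sigma u}\Sigma B$. * **TR3.** Given cofiber sequences $(u,v,w)$ on $A,B,C$ and $(u',v',w')$ on $A',B',C'$ and morphisms $a:A\to A'$,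 $b:B\to B'$ of $Ho\mathcal D$ with $bu=u'a$, there is $c:C\to C'$ with $cv=v'b$ and $w'c=(\Sigma a)w$. * **TR4 (octahedron).** Given cofiber sequences $A\xrightarrow{u}B\xrightarrow{i}C'\xrightarrow{p}\Sigma A$, $B\xrightarrow{v}C\xrightarrow{j}A'\xrightarrow{q}\Sigma B$ and $A\xrightarrow{vu}C\xrightarrow{k}B'\xrightarrow{r}\Sigma A$, there are $\alpha:C'\to B'$ and $\beta:B'\to A'$ with $\alpha i=kv$, $r\alpha=p$, $\beta k=j$, $q\beta=(\Sigma u)r$, such that $C'\xrightarrow{\alpha}B'\xrightarrow{\beta}A'\xrightarrow{(\Sigma i)q}\Sigma C'$ is a cofiber sequence. * **Descent functors.** If $\psi:\mathcal D\to\mathcal D'$ is a descent functor, there is a natural isomorphism $\eta:\psi\Sigma\cong\Sigma'\psi$ of functors $Ho\mathcal D\to Ho\mathcal D'$ such that for every cofiber sequence $(u,v,w)$ on $A,B,C$ the triangle $\psi A\xrightarrow{\psi u}\psi B\xrightarrow{\psi v}\psi C\xrightarrow{\eta_A\circ\psi w}\Sigma'\psi A$ is a cofiber sequence of $Ho\mathcal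 D'$. Moreover $\eta$ is the canonical isomorphism: writing $t:A\times\Delta\to *$, the canonical map $\kappa_A:Cyl(\psi t,\psi t)\to\psi\Lambda(A\times\Delta)$ and the map $\pi_A:Cyl(\psi t,\psi t)\to\Lambda(\psi A\times\Delta)$ induced by $\psi(*)\to *'$ have simples in $\mathrm E'$, and $\eta_A\circ\Theta^{-1}_{\Lambda(A\times\Delta)}\circ\mathbf s'(\kappa_A)=\mathbf s'(\pi_A)$ in $Ho\mathcal D'$. -/

import Mathlib

open CategoryTheory CategoryTheory.Limits Opposite Simplicial

set_option linter.unusedSectionVars false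

universe v u v' u'

namespace SimplicialDescent

section Cylinder

variable {D : Type u} [Category.{v} D] [HasFiniteCoproducts D]

/-- The cylinder `X ⊠ Δ[1]` of a simplicial object: in degree `n` it is the coproduct of copies
of `X_n` indexed by the `n`-simplices `θ : [n] ⟶ [1]` of `Δ[1]`. -/
noncomputable def cylinder (X : SimplicialObject D) : SimplicialObject D where
  obj n := ∐ fun _ : (n.unop ⟶ ⦋1⦌) => X.obj n
  map {n m} α := Sigma.desc fun θ : (n.unop ⟶ ⦋1⦌) =>
    X.map α ≫ Sigma.ι (fun _ : (m.unop ⟶ ⦋1⦌) => X.obj m) (α.unop ≫ θ)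
  map_id n := by
    refine Sigma.hom_ext _ _ fun θ => ?_
    simp
  map_comp α β := by
    refine Sigma.hom_ext _ _ fun θ => ?_
    simp

/-- The inclusion of `X_n` into the summand of `(X ⊠ Δ[1])_n` indexed by `θ`. -/
noncomputable def cylinderι (X : SimplicialObject D) {n : SimplexCategoryᵒᵖ}
    (θ : n.unop ⟶ ⦋1⦌) : X.obj n ⟶ (cylinder X).obj n :=
  Sigma.ι (fun _ : (n.unop ⟶ ⦋1⦌) => X.obj n) θ

@[simp]
lemma cylinderι_map (X : SimplicialObject D) {n m : SimplexCategoryᵒᵖ} (α : n ⟶ m)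
    (θ : n.unop ⟶ ⦋1⦌) :
    cylinderι X θ ≫ (cylinder X).map α = X.map α ≫ cylinderι X (α.unop ≫ θ) := by
  simp [cylinderι, cylinder]

@[simp]
lemma cylinderι_map_assoc (X : SimplicialObject D) {n m : SimplexCategoryᵒᵖ} (α : n ⟶ m)
    (θ : n.unop ⟶ ⦋1⦌) {T : D} (h : (cylinder X).obj m ⟶ T) :
    cylinderι X θ ≫ (cylinder X).map α ≫ h = X.map α ≫ cylinderι X (α.unop ≫ θ) ≫ h := by
  rw [← Category.assoc, cylinderι_map, Category.assoc]

lemma cylinder_hom_ext {X : SimplicialObject D} {n : SimplexCategoryᵒᵖ} {T : D}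
    {p q : (cylinder X).obj n ⟶ T} (h : ∀ θ, cylinderι X θ ≫ p = cylinderι X θ ≫ q) : p = q :=
  Sigma.hom_ext _ _ h

/-- The morphism out of `(X ⊠ Δ[1])_n` with given components. -/
noncomputable def cylinderDesc {X : SimplicialObject D} {n : SimplexCategoryᵒᵖ} {T : D}
    (k : (n.unop ⟶ ⦋1⦌) → (X.obj n ⟶ T)) : (cylinder X).obj n ⟶ T :=
  Sigma.desc k

@[simp]
lemma cylinderι_desc {X : SimplicialObject D} {n : SimplexCategoryᵒᵖ} {T : D}
    (k : (n.unop ⟶ ⦋1⦌) → (X.obj n ⟶ T)) (θ : n.unop ⟶ ⦋1⦌) :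
    cylinderι X θ ≫ cylinderDesc k = k θ := by
  exact Sigma.ι_desc _ _

@[simp]
lemma cylinderι_desc_assoc {X : SimplicialObject D} {n : SimplexCategoryᵒᵖ} {T T' : D}
    (k : (n.unop ⟶ ⦋1⦌) → (X.obj n ⟶ T)) (θ : n.unop ⟶ ⦋1⦌) (h : T ⟶ T') :
    cylinderι X θ ≫ cylinderDesc k ≫ h = k θ ≫ h := by
  rw [← Category.assoc, cylinderι_desc]

/-- The `n`-simplex of `Δ[1]` which is constant at the vertex `d^i : [0] ⟶ [1]`. -/
def vertex (n : SimplexCategory) (i : Fin 2) : n ⟶ ⦋1⦌ :=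
  SimplexCategory.const n ⦋0⦌ 0 ≫ SimplexCategory.δ i

@[simp]
lemma comp_vertex {n m : SimplexCategory} (α : n ⟶ m) (i : Fin 2) :
    α ≫ vertex m i = vertex n i := rfl

lemma vertex_ne (n : SimplexCategory) : vertex n 0 ≠ vertex n 1 := by
  intro h
  have h' := congrArg (fun φ : n ⟶ ⦋1⦌ => φ.toOrderHom 0) h
  revert h'
  change (1 : Fin 2) = 0 → False
  decide

/-- The face maps `d^0, d^1 : X ⟶ X ⊠ Δ[1]`. -/
noncomputable def cylinderFace (i : Fin 2) (X : SimplicialObject D) : X ⟶ cylinder X where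
  app n := cylinderι X (vertex n.unop i)
  naturality n m α := by simp

/-- The degeneracy `s^0 : X ⊠ Δ[1] ⟶ X`. -/
noncomputable def cylinderProj (X : SimplicialObject D) : cylinder X ⟶ X where
  app n := cylinderDesc fun _ => 𝟙 (X.obj n)
  naturality n m α := cylinder_hom_ext fun θ => by simp

@[simp]
lemma cylinderFace_proj (i : Fin 2) (X : SimplicialObject D) :
    cylinderFace i X ≫ cylinderProj X = 𝟙 X := by
  ext n
  simp [cylinderFace, cylinderProj]

/-- Functoriality of the cylinder. -/
noncomputable def cylinderMap {X X' : SimplicialObject D} (h : X ⟶ X') :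
    cylinder X ⟶ cylinder X' where
  app n := cylinderDesc fun θ => h.app n ≫ cylinderι X' θ
  naturality n m α := cylinder_hom_ext fun θ => by simp

@[simp]
lemma cylinderMap_id (X : SimplicialObject D) : cylinderMap (𝟙 X) = 𝟙 (cylinder X) := by
  ext n
  exact cylinder_hom_ext fun θ => by simp [cylinderMap]

lemma cylinderMap_comp {X X' X'' : SimplicialObject D} (h : X ⟶ X') (h' : X' ⟶ X'') :
    cylinderMap (h ≫ h') = cylinderMap h ≫ cylinderMap h' := by
  ext n
  exact cylinder_hom_ext fun θ => by simp [cylinderMap]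

@[simp]
lemma cylinderFace_map (i : Fin 2) {X X' : SimplicialObject D} (h : X ⟶ X') :
    cylinderFace i X ≫ cylinderMap h = h ≫ cylinderFace i X' := by
  ext n
  simp [cylinderFace, cylinderMap]

@[simp]
lemma cylinderMap_proj {X X' : SimplicialObject D} (h : X ⟶ X') :
    cylinderMap h ≫ cylinderProj X' = cylinderProj X ≫ h := by
  ext n
  exact cylinder_hom_ext fun θ => by simp [cylinderProj, cylinderMap]

/-- A pushout of a coproduct of copies of `X` along two of its summands. -/
lemma isPushout_aux {T : Type} [Finite T] {a b : T} (hab : a ≠ b) {X Y Z XX YZ : D}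
    {i₁ i₂ : X ⟶ XX} (hX : IsColimit (BinaryCofan.mk i₁ i₂))
    {j₁ : Y ⟶ YZ} {j₂ : Z ⟶ YZ} (f : X ⟶ Y) (g : X ⟶ Z)
    (φ : XX ⟶ ∐ fun _ : T => X) (ψ : XX ⟶ YZ)
    (h₁ : i₁ ≫ φ = Sigma.ι (fun _ : T => X) a) (h₂ : i₂ ≫ φ = Sigma.ι (fun _ : T => X) b)
    (k₁ : i₁ ≫ ψ = f ≫ j₁) (k₂ : i₂ ≫ ψ = g ≫ j₂) :
    ∃ inl : (∐ fun _ : T => X) ⟶ YZ ⨿ ∐ fun _ : {t : T // t ≠ a ∧ t ≠ b} => X,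
      (∀ t : {t : T // t ≠ a ∧ t ≠ b}, Sigma.ι (fun _ : T => X) t.1 ≫ inl =
        Sigma.ι (fun _ : {t : T // t ≠ a ∧ t ≠ b} => X) t ≫ coprod.inr) ∧
      IsPushout φ ψ inl coprod.inl := by
  classical
  let inl : (∐ fun _ : T => X) ⟶ YZ ⨿ ∐ fun _ : {t : T // t ≠ a ∧ t ≠ b} => X :=
    Sigma.desc fun t => if h : t ≠ a ∧ t ≠ b then
      Sigma.ι (fun _ : {t : T // t ≠ a ∧ t ≠ b} => X) ⟨t, h⟩ ≫ coprod.inr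
      else if t = a then f ≫ j₁ ≫ coprod.inl else g ≫ j₂ ≫ coprod.inl
  have ea : Sigma.ι (fun _ : T => X) a ≫ inl = f ≫ j₁ ≫ coprod.inl := by
    simp [inl]
  have eb : Sigma.ι (fun _ : T => X) b ≫ inl = g ≫ j₂ ≫ coprod.inl := by
    simp [inl, hab.symm]
  have et : ∀ t : {t : T // t ≠ a ∧ t ≠ b}, Sigma.ι (fun _ : T => X) t.1 ≫ inl =
      Sigma.ι (fun _ : {t : T // t ≠ a ∧ t ≠ b} => X) t ≫ coprod.inr := by
    intro t
    simp [inl, t.2.1, t.2.2]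
  have w : φ ≫ inl = ψ ≫ coprod.inl := by
    refine BinaryCofan.IsColimit.hom_ext hX ?_ ?_
    · change i₁ ≫ φ ≫ inl = i₁ ≫ ψ ≫ _
      rw [reassoc_of% h₁, reassoc_of% k₁, ea]
    · change i₂ ≫ φ ≫ inl = i₂ ≫ ψ ≫ _
      rw [reassoc_of% h₂, reassoc_of% k₂, eb]
  refine ⟨inl, et, ⟨⟨w⟩, ⟨PushoutCocone.IsColimit.mk w
    (fun s => coprod.desc s.inr (Sigma.desc fun t => Sigma.ι (fun _ : T => X) t.1 ≫ s.inl))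
    (fun s => ?_) (fun s => coprod.inl_desc _ _) (fun s m hl hr => ?_)⟩⟩⟩
  · refine Sigma.hom_ext _ _ fun t => ?_
    by_cases ha : t = a
    · subst ha
      rw [reassoc_of% ea, coprod.inl_desc, ← h₁, Category.assoc, s.condition, reassoc_of% k₁]
    by_cases hb : t = b
    · subst hb
      rw [reassoc_of% eb, coprod.inl_desc, ← h₂, Category.assoc, s.condition, reassoc_of% k₂]
    have := et ⟨t, ha, hb⟩
    dsimp only at this
    rw [reassoc_of% this, coprod.inr_desc]
    exact Sigma.ι_desc (fun t : {t : T // t ≠ a ∧ t ≠ b} => Sigma.ι (fun _ : T => X) t.1 ≫ s.inl)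
      ⟨t, ha, hb⟩
  · refine coprod.hom_ext ?_ (Sigma.hom_ext _ _ fun t => ?_)
    · rw [coprod.inl_desc, hr]
    · rw [← reassoc_of% et t, hl, coprod.inr_desc]
      exact (Sigma.ι_desc (fun t : {t : T // t ≠ a ∧ t ≠ b} =>
        Sigma.ι (fun _ : T => X) t.1 ≫ s.inl) t).symm

/-- The map `d^0 ⊔ d^1 : X ⊔ X ⟶ X ⊠ Δ[1]`. -/
noncomputable abbrev cylinderFaces (X : SimplicialObject D) : X ⨿ X ⟶ cylinder X :=
  coprod.desc (cylinderFace 0 X) (cylinderFace 1 X)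

lemma isPushout_app {X Y Z : SimplicialObject D} (f : X ⟶ Y) (g : X ⟶ Z)
    (n : SimplexCategoryᵒᵖ) :
    ∃ inl : (cylinder X).obj n ⟶ (Y ⨿ Z).obj n ⨿
        ∐ fun _ : {t : n.unop ⟶ ⦋1⦌ // t ≠ vertex n.unop 0 ∧ t ≠ vertex n.unop 1} => X.obj n,
      (∀ t : {t : n.unop ⟶ ⦋1⦌ // t ≠ vertex n.unop 0 ∧ t ≠ vertex n.unop 1},
        cylinderι X t.1 ≫ inl = Sigma.ι (fun _ : {t : n.unop ⟶ ⦋1⦌ //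
          t ≠ vertex n.unop 0 ∧ t ≠ vertex n.unop 1} => X.obj n) t ≫ coprod.inr) ∧
      IsPushout ((cylinderFaces X).app n) ((coprod.map f g).app n) inl coprod.inl :=
  isPushout_aux (vertex_ne n.unop)
    (isColimitOfHasBinaryCoproductOfPreservesColimit
      ((evaluation SimplexCategoryᵒᵖ D).obj n) X X)
    (j₁ := (coprod.inl : Y ⟶ Y ⨿ Z).app n) (j₂ := (coprod.inr : Z ⟶ Y ⨿ Z).app n)
    (f.app n) (g.app n) _ _
    (by
      change (coprod.inl : X ⟶ X ⨿ X).app n ≫ (cylinderFaces X).app n = _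
      rw [← NatTrans.comp_app, coprod.inl_desc]; rfl)
    (by
      change (coprod.inr : X ⟶ X ⨿ X).app n ≫ (cylinderFaces X).app n = _
      rw [← NatTrans.comp_app, coprod.inr_desc]; rfl)
    (by
      change (coprod.inl : X ⟶ X ⨿ X).app n ≫ _ = _
      rw [← NatTrans.comp_app, coprod.inl_map, NatTrans.comp_app])
    (by
      change (coprod.inr : X ⟶ X ⨿ X).app n ≫ _ = _
      rw [← NatTrans.comp_app, coprod.inr_map, NatTrans.comp_app])

instance hasColimit_flip {X Y Z : SimplicialObject D} (f : X ⟶ Y) (g : X ⟶ Z)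
    (n : SimplexCategoryᵒᵖ) :
    HasColimit ((span (cylinderFaces X) (coprod.map f g)).flip.obj n) := by
  obtain ⟨_, _, h⟩ := isPushout_app f g n
  have h' : HasColimit (span ((cylinderFaces X).app n) ((coprod.map f g).app n)) := h.hasPushout
  have e : (span (cylinderFaces X) (coprod.map f g)).flip.obj n ≅
      span ((cylinderFaces X).app n) ((coprod.map f g).app n) := diagramIsoSpan _
  exact hasColimit_of_iso e

instance hasPushout_cyl {X Y Z : SimplicialObject D} (f : X ⟶ Y) (g : X ⟶ Z) :
    HasPushout (cylinderFaces X) (coprod.map f g) :=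
  functorCategoryHasColimit _

/-- The double mapping cylinder `Cyl(f, g)` of `Y ⟵ X ⟶ Z` in simplicial objects: the pushout of
`f ⊔ g : X ⊔ X ⟶ Y ⊔ Z` along `d^0 ⊔ d^1 : X ⊔ X ⟶ X ⊠ Δ[1]`. -/
noncomputable abbrev Cyl {X Y Z : SimplicialObject D} (f : X ⟶ Y) (g : X ⟶ Z) :
    SimplicialObject D :=
  pushout (cylinderFaces X) (coprod.map f g)

namespace Cyl

variable {X Y Z : SimplicialObject D} (f : X ⟶ Y) (g : X ⟶ Z)

/-- The canonical map `X ⊠ Δ[1] ⟶ Cyl(f, g)`. -/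
noncomputable def inX : cylinder X ⟶ Cyl f g := pushout.inl _ _

/-- The canonical map `I : Y ⟶ Cyl(f, g)`. -/
noncomputable def inY : Y ⟶ Cyl f g := coprod.inl ≫ pushout.inr _ _

/-- The canonical map `J : Z ⟶ Cyl(f, g)`. -/
noncomputable def inZ : Z ⟶ Cyl f g := coprod.inr ≫ pushout.inr _ _

lemma face_zero : cylinderFace 0 X ≫ inX f g = f ≫ inY f g := by
  have h := (coprod.inl : X ⟶ X ⨿ X) ≫=
    (pushout.condition (f := cylinderFaces X) (g := coprod.map f g))
  rw [← Category.assoc, ← Category.assoc, coprod.inl_desc, coprod.inl_map, Category.assoc] at h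
  exact h

lemma face_one : cylinderFace 1 X ≫ inX f g = g ≫ inZ f g := by
  have h := (coprod.inr : X ⟶ X ⨿ X) ≫=
    (pushout.condition (f := cylinderFaces X) (g := coprod.map f g))
  rw [← Category.assoc, ← Category.assoc, coprod.inr_desc, coprod.inr_map, Category.assoc] at h
  exact h

variable {f g}

/-- The universal property of `Cyl(f, g)`. -/
noncomputable def desc {T : SimplicialObject D} (h : cylinder X ⟶ T) (p : Y ⟶ T) (q : Z ⟶ T)
    (hp : cylinderFace 0 X ≫ h = f ≫ p) (hq : cylinderFace 1 X ≫ h = g ≫ q) :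
    Cyl f g ⟶ T :=
  pushout.desc h (coprod.desc p q) (by
    refine coprod.hom_ext ?_ ?_
    · rw [← Category.assoc, ← Category.assoc, coprod.inl_desc, coprod.inl_map, Category.assoc,
        coprod.inl_desc, hp]
    · rw [← Category.assoc, ← Category.assoc, coprod.inr_desc, coprod.inr_map, Category.assoc,
        coprod.inr_desc, hq])

section

variable {T : SimplicialObject D} (h : cylinder X ⟶ T) (p : Y ⟶ T) (q : Z ⟶ T)
    (hp : cylinderFace 0 X ≫ h = f ≫ p) (hq : cylinderFace 1 X ≫ h = g ≫ q)

@[simp]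
lemma inX_desc : inX f g ≫ desc h p q hp hq = h := pushout.inl_desc _ _ _

@[simp]
lemma inY_desc : inY f g ≫ desc h p q hp hq = p := by
  refine (Category.assoc _ _ _).trans ?_
  refine (congrArg (fun k => coprod.inl ≫ k) (pushout.inr_desc _ _ _)).trans ?_
  exact coprod.inl_desc _ _

@[simp]
lemma inZ_desc : inZ f g ≫ desc h p q hp hq = q := by
  refine (Category.assoc _ _ _).trans ?_
  refine (congrArg (fun k => coprod.inr ≫ k) (pushout.inr_desc _ _ _)).trans ?_
  exact coprod.inr_desc _ _

end

lemma hom_ext {T : SimplicialObject D} {k l : Cyl f g ⟶ T} (hX : inX f g ≫ k = inX f g ≫ l)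
    (hY : inY f g ≫ k = inY f g ≫ l) (hZ : inZ f g ≫ k = inZ f g ≫ l) : k = l := by
  refine pushout.hom_ext hX (coprod.hom_ext ?_ ?_)
  · exact (Category.assoc _ _ _).symm.trans (hY.trans (Category.assoc _ _ _))
  · exact (Category.assoc _ _ _).symm.trans (hZ.trans (Category.assoc _ _ _))

section

variable {X' Y' Z' : SimplicialObject D} {f' : X' ⟶ Y'} {g' : X' ⟶ Z'}

/-- Functoriality of `Cyl`. -/
noncomputable def map (a : X ⟶ X') (b : Y ⟶ Y') (c : Z ⟶ Z') (hf : f ≫ b = a ≫ f')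
    (hg : g ≫ c = a ≫ g') : Cyl f g ⟶ Cyl f' g' :=
  desc (cylinderMap a ≫ inX f' g') (b ≫ inY f' g') (c ≫ inZ f' g')
    (by rw [← Category.assoc, cylinderFace_map, Category.assoc, face_zero, ← Category.assoc, ← hf,
      Category.assoc])
    (by rw [← Category.assoc, cylinderFace_map, Category.assoc, face_one, ← Category.assoc, ← hg,
      Category.assoc])

variable (a : X ⟶ X') (b : Y ⟶ Y') (c : Z ⟶ Z') (hf : f ≫ b = a ≫ f') (hg : g ≫ c = a ≫ g')

@[simp]
lemma inX_map : inX f g ≫ map a b c hf hg = cylinderMap a ≫ inX f' g' := inX_desc _ _ _ _ _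

@[simp]
lemma inY_map : inY f g ≫ map a b c hf hg = b ≫ inY f' g' := inY_desc _ _ _ _ _

@[simp]
lemma inZ_map : inZ f g ≫ map a b c hf hg = c ≫ inZ f' g' := inZ_desc _ _ _ _ _

end

end Cyl

section Preservation

variable {W : MorphismProperty D}

lemma sigmaMap_mem [W.RespectsIso]
    (hW : ∀ ⦃A B A' B' : D⦄ (f : A ⟶ B) (g : A' ⟶ B'), W f → W g → W (coprod.map f g))
    (hid : ∀ A : D, W (𝟙 A)) (T : Type) [hT : Finite T] :
    ∀ (F G : T → D) (f : ∀ t, F t ⟶ G t), (∀ t, W (f t)) → W (Limits.Sigma.map f) := by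
  revert hT
  refine Finite.induction_empty_option (P := fun T => ∀ [Finite T] (F G : T → D)
    (f : ∀ t, F t ⟶ G t), (∀ t, W (f t)) → W (Limits.Sigma.map f)) ?_ ?_ ?_ T
  · intro T T' e ih hT' F G f hf
    have hT : Finite T := Finite.of_equiv T' e.symm
    have := ih (fun t => F (e t)) (fun t => G (e t)) (fun t => f (e t)) (fun t => hf _)
    refine (W.arrow_mk_iso_iff (Arrow.isoMk (Sigma.reindex e F) (Sigma.reindex e G) ?_)).1 this
    refine Sigma.hom_ext _ _ fun t => ?_
    dsimp
    erw [Sigma.ι_reindex_hom_assoc, Sigma.ι_map, Sigma.ι_map_assoc, Sigma.ι_reindex_hom]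
  · intro _ F G f hf
    have : IsIso (Limits.Sigma.map f) :=
      ⟨Limits.Sigma.map (fun t => t.elim), Sigma.hom_ext _ _ (fun t => t.elim),
        Sigma.hom_ext _ _ (fun t => t.elim)⟩
    exact (W.arrow_mk_iso_iff (Arrow.isoMk (Iso.refl (∐ F)) (asIso (Limits.Sigma.map f))
      rfl : Arrow.mk (𝟙 (∐ F)) ≅ Arrow.mk (Limits.Sigma.map f))).1 (hid (∐ F))
  · intro T _ ih _ F G f hf
    let p : ∀ H : Option T → D, H none ⨿ (∐ fun t => H (some t)) ⟶ ∐ H := fun H =>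
      coprod.desc (Sigma.ι H none) (Sigma.desc fun t => Sigma.ι H (some t))
    have p₁ : ∀ H : Option T → D, coprod.inl ≫ p H = Sigma.ι H none := fun H =>
      coprod.inl_desc _ _
    have p₂ : ∀ (H : Option T → D) (t : T),
        Sigma.ι (fun t => H (some t)) t ≫ coprod.inr ≫ p H = Sigma.ι H (some t) := by
      intro H t
      rw [coprod.inr_desc]
      exact Sigma.ι_desc (fun t => Sigma.ι H (some t)) t
    have hp : ∀ H, IsIso (p H) := by
      intro H
      let q : ∐ H ⟶ H none ⨿ (∐ fun t => H (some t)) := Sigma.desc fun t => match t with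
          | none => coprod.inl
          | some t => Sigma.ι (fun t => H (some t)) t ≫ coprod.inr
      have q₁ : Sigma.ι H none ≫ q = coprod.inl := Sigma.ι_desc _ _
      have q₂ : ∀ t, Sigma.ι H (some t) ≫ q = Sigma.ι (fun t => H (some t)) t ≫ coprod.inr :=
        fun t => Sigma.ι_desc _ _
      refine ⟨q, ?_, ?_⟩
      · refine coprod.hom_ext ?_ (Sigma.hom_ext _ _ fun t => ?_)
        · rw [reassoc_of% p₁, q₁, Category.comp_id]
        · rw [reassoc_of% p₂, q₂, Category.comp_id]
      · refine Sigma.hom_ext _ _ fun t => ?_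
        rw [Category.comp_id]
        cases t
        · rw [reassoc_of% q₁, p₁]
        · rw [reassoc_of% q₂, p₂]
    refine (W.arrow_mk_iso_iff (Arrow.isoMk (asIso (p F)) (asIso (p G)) ?_ :
      Arrow.mk (coprod.map (f none) (Limits.Sigma.map fun t => f (some t))) ≅
        Arrow.mk (Limits.Sigma.map f))).1
      (hW _ _ (hf none) (ih (fun t => F (some t)) (fun t => G (some t)) (fun t => f (some t))
        fun t => hf _))
    change p F ≫ Limits.Sigma.map f =
      coprod.map (f none) (Limits.Sigma.map fun t => f (some t)) ≫ p G
    refine coprod.hom_ext ?_ (Sigma.hom_ext _ _ fun t => ?_)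
    · rw [reassoc_of% p₁, coprod.inl_map_assoc, p₁]
      exact Sigma.ι_map _ _
    · rw [reassoc_of% p₂, coprod.inr_map_assoc]
      refine (Sigma.ι_map _ _).trans ?_
      have h := Sigma.ι_map (f := fun t => F (some t)) (g := fun t => G (some t))
        (fun t => f (some t)) t
      rw [reassoc_of% h, p₂]

/-- A morphism of double mapping cylinders which is in `W` on all three corners in degree `n`
is in `W` in degree `n`. -/
lemma cylMap_app_mem [W.RespectsIso]
    (hW : ∀ ⦃A B A' B' : D⦄ (f : A ⟶ B) (g : A' ⟶ B'), W f → W g → W (coprod.map f g))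
    (hid : ∀ A : D, W (𝟙 A)) {X Y Z X' Y' Z' : SimplicialObject D} {f : X ⟶ Y} {g : X ⟶ Z}
    {f' : X' ⟶ Y'} {g' : X' ⟶ Z'} (a : X ⟶ X') (b : Y ⟶ Y') (c : Z ⟶ Z')
    (hf : f ≫ b = a ≫ f') (hg : g ≫ c = a ≫ g') (n : SimplexCategoryᵒᵖ)
    (ha : W (a.app n)) (hb : W (b.app n)) (hc : W (c.app n)) :
    W ((Cyl.map a b c hf hg).app n) := by
  let ev := (evaluation SimplexCategoryᵒᵖ D).obj n
  obtain ⟨l, hl, sq⟩ := isPushout_app f g n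
  obtain ⟨l', hl', sq'⟩ := isPushout_app f' g' n
  have po := (IsPushout.of_hasPushout (cylinderFaces X) (coprod.map f g)).map ev
  have po' := (IsPushout.of_hasPushout (cylinderFaces X') (coprod.map f' g')).map ev
  let S := {t : n.unop ⟶ ⦋1⦌ // t ≠ vertex n.unop 0 ∧ t ≠ vertex n.unop 1}
  let e : _ ≅ (Cyl f g).obj n := sq.isoIsPushout _ _ po
  let e' : _ ≅ (Cyl f' g').obj n := sq'.isoIsPushout _ _ po'
  have hS : W (Limits.Sigma.map fun _ : S => a.app n) := sigmaMap_mem hW hid S _ _ _ fun _ => ha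
  have hbc : W ((coprod.map b c).app n) := by
    refine (W.arrow_mk_iso_iff (Arrow.isoMk (PreservesColimitPair.iso ev Y Z)
      (PreservesColimitPair.iso ev Y' Z') ?_ :
      Arrow.mk (coprod.map (b.app n) (c.app n)) ≅ Arrow.mk ((coprod.map b c).app n))).1
      (hW _ _ hb hc)
    change (PreservesColimitPair.iso ev Y Z).hom ≫ ev.map (coprod.map b c) =
      coprod.map (ev.map b) (ev.map c) ≫ (PreservesColimitPair.iso ev Y' Z').hom
    rw [PreservesColimitPair.iso_hom, PreservesColimitPair.iso_hom, coprodComparison_natural]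
  refine (W.arrow_mk_iso_iff (Arrow.isoMk e e' ?_ :
      Arrow.mk (coprod.map ((coprod.map b c).app n) (Limits.Sigma.map fun _ : S => a.app n)) ≅
        Arrow.mk ((Cyl.map a b c hf hg).app n))).1 (hW _ _ hbc hS)
  have e₁ : l ≫ e.hom = (Cyl.inX f g).app n := IsPushout.inl_isoIsPushout_hom _ _ _ _
  have e₂ : coprod.inl ≫ e.hom = (pushout.inr (cylinderFaces X) (coprod.map f g)).app n :=
    IsPushout.inr_isoIsPushout_hom _ _ _ _
  have e₁' : l' ≫ e'.hom = (Cyl.inX f' g').app n := IsPushout.inl_isoIsPushout_hom _ _ _ _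
  have e₂' : coprod.inl ≫ e'.hom = (pushout.inr (cylinderFaces X') (coprod.map f' g')).app n :=
    IsPushout.inr_isoIsPushout_hom _ _ _ _
  have key : pushout.inr (cylinderFaces X) (coprod.map f g) ≫ Cyl.map a b c hf hg =
      coprod.map b c ≫ pushout.inr (cylinderFaces X') (coprod.map f' g') := by
    refine coprod.hom_ext ?_ ?_
    · refine ((Category.assoc _ _ _).symm.trans (Cyl.inY_map a b c hf hg)).trans ?_
      rw [coprod.inl_map_assoc]
      rfl
    · refine ((Category.assoc _ _ _).symm.trans (Cyl.inZ_map a b c hf hg)).trans ?_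
      rw [coprod.inr_map_assoc]
      rfl
  refine coprod.hom_ext ?_ (Sigma.hom_ext _ _ fun t => ?_)
  · change coprod.inl ≫ e.hom ≫ (Cyl.map a b c hf hg).app n = coprod.inl ≫ coprod.map _ _ ≫ e'.hom
    rw [reassoc_of% e₂, coprod.inl_map_assoc, e₂']
    exact congrArg (fun k => k.app n) key
  · change Sigma.ι (fun _ : S => X.obj n) t ≫ coprod.inr ≫ e.hom ≫ (Cyl.map a b c hf hg).app n =
      Sigma.ι (fun _ : S => X.obj n) t ≫ coprod.inr ≫ coprod.map _ _ ≫ e'.hom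
    have h₁ : Sigma.ι (fun _ : S => X.obj n) t ≫ Limits.Sigma.map (fun _ : S => a.app n) =
      a.app n ≫ Sigma.ι (fun _ : S => X'.obj n) t := Sigma.ι_map _ _
    have h₂ := congrArg (fun k => k.app n) (Cyl.inX_map a b c hf hg)
    rw [NatTrans.comp_app, NatTrans.comp_app] at h₂
    rw [← reassoc_of% hl t, reassoc_of% e₁, coprod.inr_map_assoc, reassoc_of% h₁,
      ← reassoc_of% hl' t, e₁', h₂]
    simp [cylinderMap]

end Preservation

section Cone

variable [HasTerminal D]

/-- The final object `∗` of simplicial objects. -/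
noncomputable abbrev point (D : Type u) [Category.{v} D] [HasTerminal D] : SimplicialObject D :=
  (SimplicialObject.const D).obj (⊤_ D)

/-- The trivial map `X ⟶ ∗`. -/
noncomputable def toPoint (X : SimplicialObject D) : X ⟶ point D where
  app n := terminal.from (X.obj n)

lemma point_hom_ext {X : SimplicialObject D} (f g : X ⟶ point D) : f = g := by
  ext n
  exact Subsingleton.elim (α := X.obj n ⟶ ⊤_ D) _ _

/-- The simplicial cone `C(F) = Cyl(F, X ⟶ ∗)` of a map `F : X ⟶ Y`. -/
noncomputable abbrev simplicialCone {X Y : SimplicialObject D} (F : X ⟶ Y) :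
    SimplicialObject D :=
  Cyl F (toPoint X)

/-- The map of cones `C(F) ⟶ C(F')` induced by a commutative square. -/
noncomputable abbrev simplicialConeMap {X Y X' Y' : SimplicialObject D} {F : X ⟶ Y}
    {F' : X' ⟶ Y'} (a : X ⟶ X') (b : Y ⟶ Y') (h : F ≫ b = a ≫ F') :
    simplicialCone F ⟶ simplicialCone F' :=
  Cyl.map a b (𝟙 _) h (point_hom_ext _ _)

/-- The simplicial suspension `ΛX = C(X ⟶ ∗)`. -/
noncomputable abbrev simplicialSuspension (X : SimplicialObject D) : SimplicialObject D :=
  simplicialCone (toPoint X)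

/-- The simplicial suspension as a functor. -/
noncomputable def simplicialSuspensionFunctor (D : Type u) [Category.{v} D]
    [HasFiniteCoproducts D] [HasTerminal D] : SimplicialObject D ⥤ SimplicialObject D where
  obj X := simplicialSuspension X
  map a := simplicialConeMap a (𝟙 _) (point_hom_ext _ _)
  map_id X := by
    refine Cyl.hom_ext ?_ ?_ ?_
    · rw [Cyl.inX_map, cylinderMap_id, Category.id_comp, Category.comp_id]
    · rw [Cyl.inY_map, Category.id_comp, Category.comp_id]
    · rw [Cyl.inZ_map, Category.id_comp, Category.comp_id]
  map_comp a b := by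
    refine Cyl.hom_ext ?_ ?_ ?_
    · rw [Cyl.inX_map, ← Category.assoc, Cyl.inX_map, Category.assoc, Cyl.inX_map,
        cylinderMap_comp, Category.assoc]
    · rw [Cyl.inY_map, ← Category.assoc, Cyl.inY_map, Category.assoc, Cyl.inY_map,
        Category.id_comp, Category.id_comp]
    · rw [Cyl.inZ_map, ← Category.assoc, Cyl.inZ_map, Category.assoc, Cyl.inZ_map,
        Category.id_comp, Category.id_comp]

/-- The map `P : C(F) ⟶ ΛX`, which is the cone of the square from `F : X ⟶ Y` to `X ⟶ ∗`. -/
noncomputable def simplicialConeProj {X Y : SimplicialObject D} (F : X ⟶ Y) :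
    simplicialCone F ⟶ simplicialSuspension X :=
  simplicialConeMap (𝟙 X) (toPoint Y) (point_hom_ext _ _)

/-- The inclusion `I_B : B × Δ ⟶ CB` of `B` into the cone of its identity. -/
noncomputable abbrev inclCone (X : SimplicialObject D) : X ⟶ simplicialCone (𝟙 X) :=
  Cyl.inY (𝟙 X) (toPoint X)

/-- `Λ¹₂ X = C(I_X)`: two cones on `X` glued along `X`. -/
noncomputable abbrev doubleCone (X : SimplicialObject D) : SimplicialObject D :=
  simplicialCone (inclCone X)

/-- The map `P₁ : Λ¹₂ X ⟶ ΛX` sending `CX` to `∗`. -/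
noncomputable def doubleConeFst (X : SimplicialObject D) :
    doubleCone X ⟶ simplicialSuspension X :=
  simplicialConeProj (inclCone X)

/-- The map `P₂ : Λ¹₂ X ⟶ ΛX` which is the projection `CX ⟶ ΛX` on the first cone and sends the
second cone to the base point `∗ ⟶ ΛX`. -/
noncomputable def doubleConeSnd (X : SimplicialObject D) :
    doubleCone X ⟶ simplicialSuspension X :=
  Cyl.desc (cylinderProj X ≫ toPoint X ≫ Cyl.inY (toPoint X) (toPoint X))
    (simplicialConeProj (𝟙 X)) (Cyl.inY (toPoint X) (toPoint X))
    (by rw [← Category.assoc, cylinderFace_proj, Category.id_comp, simplicialConeProj,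
      Cyl.inY_map])
    (by rw [← Category.assoc, cylinderFace_proj, Category.id_comp])

end Cone

end Cylinder

section Bisimplicial

/-- The diagonal `n ↦ Z_{n,n}` of a bisimplicial object. -/
def diagonal (D : Type u) [Category.{v} D] :
    SimplicialObject (SimplicialObject D) ⥤ SimplicialObject D where
  obj Z :=
    { obj n := (Z.obj n).obj n
      map {n m} α := (Z.map α).app n ≫ (Z.obj m).map α
      map_id n := by simp
      map_comp α β := by simp }
  map φ :=
    { app n := (φ.app n).app n
      naturality n m α := by
        have h := congrArg (fun k => k.app n) (φ.naturality α)
        simp only [NatTrans.comp_app] at h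
        simp [reassoc_of% h] }

variable {D : Type u} [Category.{v} D] (s : SimplicialObject D ⥤ D)

/-- The iterated simple `Z ↦ s(n ↦ s(m ↦ Z_{n,m}))`. -/
def iteratedSimple : SimplicialObject (SimplicialObject D) ⥤ D :=
  (SimplicialObject.whiskering (SimplicialObject D) D).obj s ⋙ s

/-- `X ↦ Δ × X`, where `(Δ × X)_{n,m} = X_m`. -/
def constLeft (D : Type u) [Category.{v} D] :
    SimplicialObject D ⥤ SimplicialObject (SimplicialObject D) :=
  SimplicialObject.const (SimplicialObject D)

/-- `X ↦ X × Δ`, where `(X × Δ)_{n,m} = X_n`. -/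
def constRight (D : Type u) [Category.{v} D] :
    SimplicialObject D ⥤ SimplicialObject (SimplicialObject D) :=
  (SimplicialObject.whiskering D (SimplicialObject D)).obj (SimplicialObject.const D)

/-- The identification of `s(X)` with the simple of the diagonal of `Δ × X`. -/
def toDiagonalLeft : s ⟶ constLeft D ⋙ diagonal D ⋙ s where
  app X := s.map
    { app n := 𝟙 (X.obj n)
      naturality n m α := by simp [diagonal, constLeft] }
  naturality X Y f := by
    dsimp
    rw [← s.map_comp, ← s.map_comp]
    congr 1
    ext n
    simp [diagonal, constLeft]

/-- The identification of `s(X)` with the simple of the diagonal of `X × Δ`. -/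
def toDiagonalRight : s ⟶ constRight D ⋙ diagonal D ⋙ s where
  app X := s.map
    { app n := 𝟙 (X.obj n)
      naturality n m α := by
        refine (Category.comp_id (X.map α)).trans ?_
        refine Eq.trans ?_ (Category.id_comp _).symm
        exact (Category.comp_id (X.map α)).symm }
  naturality X Y f := by
    dsimp
    rw [← s.map_comp, ← s.map_comp]
    congr 1
    ext n
    exact (Category.comp_id (f.app n)).trans (Category.id_comp (f.app n)).symm

variable {s} (lam : SimplicialObject.const D ⋙ s ⟶ 𝟭 D)

/-- The natural map `s s(Δ × X) = R(s(X)) ⟶ s(X)` given by `λ_{s(X)}`. -/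
def lamLeft : constLeft D ⋙ iteratedSimple s ⟶ s where
  app X := s.map ((Functor.constComp _ X s).hom) ≫ lam.app (s.obj X)
  naturality X Y f := by
    have h : s.map ((SimplicialObject.const D).map (s.map f)) ≫ lam.app (s.obj Y) =
        lam.app (s.obj X) ≫ s.map f := lam.naturality (s.map f)
    have e : (constLeft D ⋙ iteratedSimple s).map f ≫ s.map ((Functor.constComp _ Y s).hom) =
        s.map ((Functor.constComp _ X s).hom) ≫
          s.map ((SimplicialObject.const D).map (s.map f)) := by
      refine (s.map_comp _ _).symm.trans (Eq.trans ?_ (s.map_comp _ _))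
      congr 1
      ext n
      exact (Category.comp_id (s.map f)).trans (Category.id_comp (s.map f)).symm
    exact ((Category.assoc _ _ _).symm.trans (congrArg (fun k => k ≫ lam.app (s.obj Y)) e)).trans
      ((Category.assoc _ _ _).trans ((congrArg (fun k => _ ≫ k) h).trans
        (Category.assoc _ _ _).symm))

/-- The natural map `s s(X × Δ) = s(R(X)) ⟶ s(X)` given by `s(λ_X)`. -/
def lamRight : constRight D ⋙ iteratedSimple s ⟶ s where
  app X := s.map
    { app n := lam.app (X.obj n)
      naturality n m α := lam.naturality (X.map α) }
  naturality X Y f := by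
    refine (s.map_comp _ _).symm.trans (Eq.trans ?_ (s.map_comp _ _))
    congr 1
    ext n
    exact lam.naturality (f.app n)

end Bisimplicial

section Localization

variable {C : Type u} [Category.{v} C] {C' : Type u'} [Category.{v'} C']

/-- The functor induced on localizations by a functor which preserves the classes of morphisms
to be inverted. -/
noncomputable def localizedMap {W : MorphismProperty C} {W' : MorphismProperty C'} (F : C ⥤ C')
    (h : ∀ ⦃A B : C⦄ (f : A ⟶ B), W f → W' (F.map f)) : W.Localization ⥤ W'.Localization :=
  Localization.Construction.lift (F ⋙ W'.Q) fun _ _ f hf => W'.Q_inverts _ (h f hf)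

lemma localizedMap_map_Q {W : MorphismProperty C} {W' : MorphismProperty C'} (F : C ⥤ C')
    (h : ∀ ⦃A B : C⦄ (f : A ⟶ B), W f → W' (F.map f)) {A B : C} (f : A ⟶ B) :
    (localizedMap F h).map (W.Q.map f) = W'.Q.map (F.map f) := by
  have e := Functor.congr_hom (Localization.Construction.fac (F ⋙ W'.Q)
    fun _ _ f hf => W'.Q_inverts _ (h f hf)) f
  exact e.trans ((Category.id_comp _).trans (Category.comp_id _))

variable {J : Type*} [Category J] {J' : Type*} [Category J']

/-- The functor `Fun(J, C)[W⁻¹] ⥤ Fun(J', C)[W⁻¹]` given by precomposition with `G : J' ⥤ J`. -/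
noncomputable def precomp (W : MorphismProperty C) (G : J' ⥤ J) :
    (W.functorCategory J).Localization ⥤ (W.functorCategory J').Localization :=
  localizedMap ((Functor.whiskeringLeft J' J C).obj G) fun _ _ _ hf j => hf (G.obj j)

/-- The evaluation functor `Fun(J, C)[W⁻¹] ⥤ C[W⁻¹]` at an object `j`. -/
noncomputable def evalAt (J : Type*) [Category J] (W : MorphismProperty C) (j : J) :
    (W.functorCategory J).Localization ⥤ W.Localization :=
  localizedMap ((evaluation J C).obj j) fun _ _ _ hf => hf j

end Localization

end SimplicialDescent

open SimplicialDescent in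
/-- A simplicial descent structure `(E, s, μ, λ)` on a category `D` with finite coproducts and a
final object. -/
structure SimplicialDescentStructure (D : Type u) [Category.{v} D] [HasFiniteCoproducts D]
    [HasTerminal D] where
  /-- the class of equivalences -/
  E : MorphismProperty D
  /-- `E` is saturated: it contains every morphism that becomes invertible in `D[E⁻¹]` -/
  saturated : ∀ ⦃A B : D⦄ (f : A ⟶ B), IsIso (E.Q.map f) → E f
  /-- `E ⊔ E ⊆ E` -/
  coprod_mem : ∀ ⦃A B A' B' : D⦄ (f : A ⟶ B) (g : A' ⟶ B'), E f → E g → E (coprod.map f g)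
  /-- the simple functor -/
  s : SimplicialObject D ⥤ D
  /-- the simple functor commutes with coproducts up to equivalence -/
  s_coprod : ∀ X Y : SimplicialObject D, E (coprodComparison s X Y)
  /-- the isomorphism `μ : s D ⟶ s s` of functors on bisimplicial objects, in the localization
  of the functor category by the objectwise equivalences -/
  μ : (E.functorCategory (SimplicialObject (SimplicialObject D))).Q.obj (diagonal D ⋙ s) ≅
    (E.functorCategory (SimplicialObject (SimplicialObject D))).Q.obj (iteratedSimple s)
  /-- the natural transformation `λ : R = s(- × Δ) ⟶ Id` -/
  lam : SimplicialObject.const D ⋙ s ⟶ 𝟭 D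
  lam_mem : ∀ A : D, E (lam.app A)
  /-- a section `ρ : Id ⟶ R` of `λ` -/
  rho : 𝟭 D ⟶ SimplicialObject.const D ⋙ s
  rho_lam : rho ≫ lam = 𝟙 (𝟭 D)
  /-- exactness: the simple of a degreewise equivalence is an equivalence -/
  s_mem : ∀ ⦃X Y : SimplicialObject D⦄ (f : X ⟶ Y), (∀ n, E (f.app n)) → E (s.map f)
  /-- acyclicity: `f` is an equivalence if and only if the simple of its simplicial cone is
  acyclic -/
  mem_iff_cone : ∀ ⦃A B : D⦄ (f : A ⟶ B),
    E f ↔ E (terminal.from (s.obj (simplicialCone ((SimplicialObject.const D).map f))))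
  /-- compatibility with the functor reversing the order -/
  op_mem_iff : ∀ ⦃X Y : SimplicialObject D⦄ (f : X ⟶ Y),
    E (s.map (SimplicialObject.opFunctor.map f)) ↔ E (s.map f)
  /-- the composition `s(X) ⟶ R(s(X)) ⟶ s(X)` of `μ` at `Δ × X` and of `λ` at `s(X)` is the
  identity in the localized functor category -/
  mu_lam_left :
    (E.functorCategory (SimplicialObject D)).Q.map (toDiagonalLeft s) ≫
      (precomp E (constLeft D)).map μ.hom ≫
        (E.functorCategory (SimplicialObject D)).Q.map (lamLeft lam) = 𝟙 _
  /-- the composition `s(X) ⟶ s(R(X)) ⟶ s(X)` of `μ` at `X × Δ` and of `s(λ_X)` is the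
  identity in the localized functor category -/
  mu_lam_right :
    (E.functorCategory (SimplicialObject D)).Q.map (toDiagonalRight s) ≫
      (precomp E (constRight D)).map μ.hom ≫
        (E.functorCategory (SimplicialObject D)).Q.map (lamRight lam) = 𝟙 _

namespace SimplicialDescentStructure

open SimplicialDescent

variable {D : Type u} [Category.{v} D] [HasFiniteCoproducts D] [HasTerminal D]
  (S : SimplicialDescentStructure D)

lemma mem_iff_isIso {A B : D} (f : A ⟶ B) : S.E f ↔ IsIso (S.E.Q.map f) :=
  ⟨fun h => S.E.Q_inverts f h, S.saturated f⟩

lemma id_mem (A : D) : S.E (𝟙 A) := (S.mem_iff_isIso _).2 inferInstance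

instance : S.E.RespectsIso := by
  have : S.E = (MorphismProperty.isomorphisms _).inverseImage S.E.Q := by
    ext A B f
    exact S.mem_iff_isIso f
  rw [this]
  infer_instance

/-- The homotopy category `Ho D = D[E⁻¹]`. -/
abbrev Ho : Type u := S.E.Localization

/-- The cone functor `c(f) = s C(f × Δ)` on objects. -/
noncomputable abbrev cone {A B : D} (f : A ⟶ B) : D :=
  S.s.obj (simplicialCone ((SimplicialObject.const D).map f))

/-- The canonical map `i : B ⟶ c(f)`, the composition of `ρ_B` and `s(I_B)`. -/
noncomputable def coneIncl {A B : D} (f : A ⟶ B) : B ⟶ S.cone f :=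
  S.rho.app B ≫ S.s.map (Cyl.inY ((SimplicialObject.const D).map f) (toPoint _))

/-- The suspension functor `Σ : D ⥤ D`, with `ΣA = s Λ(A × Δ) = c(A ⟶ ∗)`. -/
noncomputable def suspension : D ⥤ D :=
  SimplicialObject.const D ⋙ simplicialSuspensionFunctor D ⋙ S.s

/-- The canonical map `p : c(f) ⟶ ΣA`. -/
noncomputable def coneProj {A B : D} (f : A ⟶ B) : S.cone f ⟶ S.suspension.obj A :=
  S.s.map (simplicialConeProj ((SimplicialObject.const D).map f))

lemma suspension_mem {A B : D} (f : A ⟶ B) (hf : S.E f) : S.E (S.suspension.map f) :=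
  S.s_mem _ fun n => cylMap_app_mem S.coprod_mem S.id_mem _ _ _
    (point_hom_ext _ _) (point_hom_ext _ _) n hf
    (S.id_mem _) (S.id_mem _)

/-- The suspension functor `Σ : Ho D ⥤ Ho D`. -/
noncomputable def suspensionHo : S.Ho ⥤ S.Ho :=
  localizedMap S.suspension fun _ _ f hf => S.suspension_mem f hf

/-- The image `c(f) ⟶ ΣA` of `p` in `Ho D`. -/
noncomputable def coneProjHo {A B : D} (f : A ⟶ B) :
    S.E.Q.obj (S.cone f) ⟶ S.suspensionHo.obj (S.E.Q.obj A) :=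
  S.E.Q.map (S.coneProj f)

/-- The triangle `A ⟶ B ⟶ C ⟶ ΣA` of `Ho D` is a cofiber sequence: it is isomorphic to a
triangle `A₀ ⟶ B₀ ⟶ c(f) ⟶ ΣA₀` for some morphism `f : A₀ ⟶ B₀` of `D`. -/
def IsCofiberSequence {A B C : S.Ho} (u : A ⟶ B) (v : B ⟶ C)
    (w : C ⟶ S.suspensionHo.obj A) : Prop :=
  ∃ (A₀ B₀ : D) (f : A₀ ⟶ B₀) (a : A ≅ S.E.Q.obj A₀) (b : B ≅ S.E.Q.obj B₀)
    (c : C ≅ S.E.Q.obj (S.cone f)),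
    u ≫ b.hom = a.hom ≫ S.E.Q.map f ∧
    v ≫ c.hom = b.hom ≫ S.E.Q.map (S.coneIncl f) ∧
    w ≫ S.suspensionHo.map a.hom = c.hom ≫ S.coneProjHo f

/-- `Σ¹₂ B = s Λ¹₂ (B × Δ)`. -/
noncomputable def doubleSuspension (B : D) : D :=
  S.s.obj (doubleCone ((SimplicialObject.const D).obj B))

/-- The map `p₁ = s(P₁) : Σ¹₂ B ⟶ ΣB`. -/
noncomputable def doubleSuspensionFst (B : D) : S.doubleSuspension B ⟶ S.suspension.obj B :=
  S.s.map (doubleConeFst ((SimplicialObject.const D).obj B))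

/-- The map `p₂ = s(P₂) : Σ¹₂ B ⟶ ΣB`. -/
noncomputable def doubleSuspensionSnd (B : D) : S.doubleSuspension B ⟶ S.suspension.obj B :=
  S.s.map (doubleConeSnd ((SimplicialObject.const D).obj B))

end SimplicialDescentStructure

section DescentFunctor

open SimplicialDescent

variable {D : Type u} [Category.{v} D] [HasFiniteCoproducts D] [HasTerminal D]
  {D' : Type u'} [Category.{v'} D'] [HasFiniteCoproducts D'] [HasTerminal D']

/-- The degreewise extension `Δᵒᵖψ` of a functor to simplicial objects. -/
abbrev simplicialExt (ψ : D ⥤ D') : SimplicialObject D ⥤ SimplicialObject D' :=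
  (SimplicialObject.whiskering D D').obj ψ

/-- The functor `Fun(Δᵒᵖ D, D')[E'⁻¹] ⥤ Fun(Δᵒᵖ Δᵒᵖ D, D')[E'⁻¹]` which sends `G` to
`Z ↦ s'(n ↦ G(Z_n))`. -/
noncomputable def SimplicialDescentStructure.simpleLevelwise
    (S' : SimplicialDescentStructure D') (D : Type u) [Category.{v} D] :
    (S'.E.functorCategory (SimplicialObject D)).Localization ⥤
      (S'.E.functorCategory (SimplicialObject (SimplicialObject D))).Localization :=
  localizedMap
    (SimplicialObject.whiskering (SimplicialObject D) D' ⋙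
      (Functor.whiskeringRight _ _ _).obj S'.s)
    fun _ _ _ hf Z => S'.s_mem _ fun n => hf (Z.obj n)

/-- The identification of `ψ(diag Z)` with `diag (ψ Z)` for a bisimplicial object `Z`. -/
def diagonalExt (ψ : D ⥤ D') (Z : SimplicialObject (SimplicialObject D)) :
    (simplicialExt ψ).obj ((diagonal D).obj Z) ⟶
      (diagonal D').obj ((simplicialExt (simplicialExt ψ)).obj Z) where
  app n := 𝟙 (ψ.obj ((Z.obj n).obj n))
  naturality n m α := by
    refine (Category.comp_id _).trans (Eq.trans ?_ (Category.id_comp _).symm)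
    exact ψ.map_comp _ _

/-- A descent functor between simplicial descent categories. -/
structure DescentFunctor (S : SimplicialDescentStructure D)
    (S' : SimplicialDescentStructure D') (ψ : D ⥤ D') where
  /-- `ψ` preserves equivalences -/
  map_mem : ∀ ⦃A B : D⦄ (f : A ⟶ B), S.E f → S'.E (ψ.map f)
  /-- `ψ` commutes with coproducts up to equivalence -/
  coprod_mem : ∀ A B : D, S'.E (coprodComparison ψ A B)
  /-- `ψ` preserves the final object up to equivalence -/
  terminal_mem : S'.E (terminal.from (ψ.obj (⊤_ D)))
  /-- the isomorphism `Θ : ψ s ⟶ s' ψ` in the localized functor category -/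
  Θ : (S'.E.functorCategory (SimplicialObject D)).Q.obj (S.s ⋙ ψ) ≅
    (S'.E.functorCategory (SimplicialObject D)).Q.obj (simplicialExt ψ ⋙ S'.s)
  /-- compatibility of `Θ` with `λ` and `λ'` -/
  Θ_lam : ∀ A : D,
    (evalAt _ S'.E ((SimplicialObject.const D).obj A)).map Θ.hom ≫
      S'.E.Q.map (S'.s.map ((Functor.constComp _ A ψ).hom) ≫ S'.lam.app (ψ.obj A)) =
    S'.E.Q.map (ψ.map (S.lam.app A))
  /-- compatibility of `Θ` with `μ` and `μ'` -/
  Θ_mu : ∀ Z : SimplicialObject (SimplicialObject D),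
    (localizedMap ψ map_mem).map ((evalAt _ S.E Z).map S.μ.hom) ≫
      (evalAt _ S'.E ((simplicialExt S.s).obj Z)).map Θ.hom ≫
        (evalAt _ S'.E Z).map ((S'.simpleLevelwise D).map Θ.hom) =
    (evalAt _ S'.E ((diagonal D).obj Z)).map Θ.hom ≫
      S'.E.Q.map (S'.s.map (diagonalExt ψ Z)) ≫
        (evalAt _ S'.E ((simplicialExt (simplicialExt ψ)).obj Z)).map S'.μ.hom

/-- The canonical map `(ψX) ⊠ Δ[1] ⟶ ψ(X ⊠ Δ[1])`. -/
noncomputable def cylinderComparison (ψ : D ⥤ D') (X : SimplicialObject D) :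
    cylinder ((simplicialExt ψ).obj X) ⟶ (simplicialExt ψ).obj (cylinder X) where
  app n := cylinderDesc (X := (simplicialExt ψ).obj X) fun θ => ψ.map (cylinderι X θ)
  naturality n m α := cylinder_hom_ext fun θ => by
    refine (cylinderι_map_assoc _ _ _ _).trans ((congrArg (fun k => _ ≫ k)
      (cylinderι_desc _ _)).trans (Eq.trans ?_ (cylinderι_desc_assoc _ _ _).symm))
    change ψ.map (X.map α) ≫ ψ.map _ = ψ.map _ ≫ ψ.map _
    rw [← ψ.map_comp, ← ψ.map_comp, cylinderι_map]

lemma cylinderFace_comparison (ψ : D ⥤ D') (i : Fin 2) (X : SimplicialObject D) :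
    cylinderFace i ((simplicialExt ψ).obj X) ≫ cylinderComparison ψ X =
      (simplicialExt ψ).map (cylinderFace i X) := by
  ext n
  exact cylinderι_desc _ _

/-- The canonical map `Cyl(ψf, ψg) ⟶ ψ Cyl(f, g)`. -/
noncomputable def cylComparison (ψ : D ⥤ D') {X Y Z : SimplicialObject D} (f : X ⟶ Y)
    (g : X ⟶ Z) :
    Cyl ((simplicialExt ψ).map f) ((simplicialExt ψ).map g) ⟶
      (simplicialExt ψ).obj (Cyl f g) :=
  Cyl.desc (cylinderComparison ψ X ≫ (simplicialExt ψ).map (Cyl.inX f g))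
    ((simplicialExt ψ).map (Cyl.inY f g)) ((simplicialExt ψ).map (Cyl.inZ f g))
    (by rw [← Category.assoc, cylinderFace_comparison, ← Functor.map_comp, ← Functor.map_comp,
      Cyl.face_zero])
    (by rw [← Category.assoc, cylinderFace_comparison, ← Functor.map_comp, ← Functor.map_comp,
      Cyl.face_one])

/-- The map `Cyl(ψ(A × Δ) ⟶ ψ(∗), ψ(A × Δ) ⟶ ψ(∗)) ⟶ Λ(ψ(A) × Δ)` induced by `ψ(∗) ⟶ ∗`. -/
noncomputable def cylToSuspension (ψ : D ⥤ D') (A : D) :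
    Cyl ((simplicialExt ψ).map (toPoint ((SimplicialObject.const D).obj A)))
      ((simplicialExt ψ).map (toPoint ((SimplicialObject.const D).obj A))) ⟶
    simplicialSuspension ((SimplicialObject.const D').obj (ψ.obj A)) :=
  Cyl.map (Functor.constComp _ A ψ).hom (toPoint _) (toPoint _) (point_hom_ext _ _)
    (point_hom_ext _ _)

namespace DescentFunctor

variable {S : SimplicialDescentStructure D} {S' : SimplicialDescentStructure D'} {ψ : D ⥤ D'}

/-- The functor `Ho D ⥤ Ho D'` induced by a descent functor. -/
noncomputable def mapHo (F : DescentFunctor S S' ψ) : S.Ho ⥤ S'.Ho :=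
  localizedMap ψ F.map_mem

/-- An isomorphism `ψ Σ ≅ Σ' ψ` of functors on `Ho D` is the canonical one if at every object `A`
of `D` it is the isomorphism determined by `Θ` and by the canonical maps
`ψ Λ(A × Δ) ⟵ Cyl(ψ(A × Δ) ⟶ ψ(∗), ψ(A × Δ) ⟶ ψ(∗)) ⟶ Λ(ψ(A) × Δ)`, whose simples are
equivalences. -/
def IsCanonical (F : DescentFunctor S S' ψ)
    (η : S.suspensionHo ⋙ F.mapHo ≅ F.mapHo ⋙ S'.suspensionHo) : Prop :=
  ∀ A : D,
    S'.E (S'.s.map (cylComparison ψ (toPoint ((SimplicialObject.const D).obj A))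
      (toPoint ((SimplicialObject.const D).obj A)))) ∧
    S'.E (S'.s.map (cylToSuspension ψ A)) ∧
    S'.E.Q.map (S'.s.map (cylComparison ψ (toPoint ((SimplicialObject.const D).obj A))
        (toPoint ((SimplicialObject.const D).obj A)))) ≫
      (evalAt _ S'.E (simplicialSuspension ((SimplicialObject.const D).obj A))).map F.Θ.inv ≫
        η.hom.app (S.E.Q.obj A) =
    S'.E.Q.map (S'.s.map (cylToSuspension ψ A))

end DescentFunctor

end DescentFunctor

/-! The axioms make `s` behave like a homotopy colimit, and `μ` lets it commute with the one
construction needed here, the double mapping cylinder. In degree n, Cyl(F, G) is the coproduct of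
Y_n, Z_n and one copy of X_n for each non-constant n-simplex of Δ[1] (`Cyl.isCopower`). So a functor
which commutes with coproducts up to equivalence also commutes with these cylinders up to degreewise
equivalence (`Cyl.app_mem`). Moreover Cyl(F, G) is the diagonal of the bisimplicial object `biCyl F
G`, whose rows are such coproducts. Applying `μ` gives `simpleCylIso`: in Ho D, the simple of Cyl(F,
G) is that of the cylinder of the constant objects at sF and sG. Hence the simple of a cylinder is
invariant under maps whose simples are equivalences on the three corners (`simple_cylMap_mem`), the
simple of a simplicial map is an equivalence exactly when its cone has acyclic simple
(`simple_mem_iff_acyclic`), and every simplicial map gives a cofiber sequence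
(`isCofiberSequence_simple`).

For morphisms f, g of D, the object `cyl f g` is a homotopy pushout: it preserves equivalences under
base change, and its square commutes in Ho D. It follows that every morphism of Ho D is a single
left fraction (`exists_fraction`). The usual calculus of fractions is not available, since the
square does not commute strictly. To see when two morphisms x, y of D become equal, one extends to
Ho D the functor sending T to the connected components of the left fractions from A to T
(`fractionFunctor`); the outcome is that x and y are linked by a zigzag of strict morphisms of
fractions (`eqvGen_of_map_eq`). Cones can be transported along such a zigzag, so each commutative
square of Ho D extends to a morphism of standard triangles, invertible if the square is
(`exists_fill`). This is TR3, and it also allows any cofiber sequence to be computed with any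
representative of its first map (`IsCofiberSequence.exists_iso`).

The rest is geometry of cones. For TR2, the cone of I : Y ⟶ C(F) is C(F) with a cone on Y attached;
collapsing that cone gives ΛX. The map F sends this object to the double cone of Y, where P₁ induces
the connecting map and P₂ induces the collapse followed by ΛF; thus the two differ by m. Exchanging
the two cones exchanges P₁ and P₂, so m is an involution. For TR4, the inclusions of Y and Z induce
a map from C(G) to the cone of C(F) ⟶ C(GF). In each degree C(F) ⟶ C(GF) has the form g ⊔ 1, and the
cone of g ⊔ 1 is the cone of g with a contractible cone attached at the vertex, so the map is an
equivalence (`simple_octahedronMap_mem`). An explicit retraction, built from the minimum on Δ[1],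
identifies the maps of the triangle (`exists_octahedron_retraction`).

A descent functor carries the standard triangle of f to that of ψf: `Θ` moves ψ inside the simple,
the comparison from Cyl(ψF, ψG) to ψCyl(F, G) is a degreewise equivalence because ψ preserves finite
coproducts up to equivalence, and ψ(∗) ⟶ ∗' repairs the vertex of the cone. -/

namespace SimplicialDescent

/-! ### Finite copowers and functors preserving them up to a class of morphisms -/

section Coproducts

variable {C : Type u} [Category.{v} C] {C' : Type u'} [Category.{v'} C']

/-- `P` is the coproduct of `W` and of copies of `X` indexed by `T`. -/
def IsCopower {T : Type} {W X P : C} (a : W ⟶ P) (b : T → (X ⟶ P)) : Prop :=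
  ∀ ⦃Q : C⦄ (a' : W ⟶ Q) (b' : T → (X ⟶ Q)), ∃! h : P ⟶ Q, a ≫ h = a' ∧ ∀ t, b t ≫ h = b' t

lemma IsCopower.reindex {T T' : Type} (e : T ≃ T') {W X P : C} {a : W ⟶ P} {b : T' → (X ⟶ P)}
    (h : IsCopower a b) : IsCopower a fun t => b (e t) := by
  intro Q a' b'
  obtain ⟨k, ⟨hk, hk'⟩, hu⟩ := h a' fun t => b' (e.symm t)
  refine ⟨k, ⟨hk, fun t => by simpa using hk' (e t)⟩, fun l hl => hu l ⟨hl.1, fun t => ?_⟩⟩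
  simpa using hl.2 (e.symm t)

lemma IsCopower.isIso {T : Type} [IsEmpty T] {W X P : C} {a : W ⟶ P} {b : T → (X ⟶ P)}
    (h : IsCopower a b) : IsIso a := by
  obtain ⟨k, ⟨hk, _⟩, _⟩ := h (𝟙 W) isEmptyElim
  obtain ⟨l, _, hl⟩ := h a b
  refine ⟨k, hk, ?_⟩
  rw [hl (k ≫ a) ⟨by rw [reassoc_of% hk], isEmptyElim⟩, hl (𝟙 P) ⟨by simp, isEmptyElim⟩]

/-- Absorbing one copy of `X` into `W` preserves the shape of the data, so an induction on the index
set only needs binary coproducts. -/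
lemma IsCopower.of_option {T : Type} {W X P : C} [HasBinaryCoproduct W X] {a : W ⟶ P}
    {b : Option T → (X ⟶ P)} (h : IsCopower a b) :
    IsCopower (coprod.desc a (b none)) fun t => b (some t) := by
  intro Q a' b'
  obtain ⟨k, ⟨hk, hk'⟩, hu⟩ := h (coprod.inl ≫ a') fun t => t.elim (coprod.inr ≫ a') b'
  refine ⟨k, ⟨coprod.hom_ext ?_ ?_, fun t => hk' (some t)⟩, fun l hl => hu l ⟨?_, ?_⟩⟩
  · rw [coprod.inl_desc_assoc, hk]
  · rw [coprod.inr_desc_assoc]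
    exact hk' none
  · rw [← hl.1, coprod.inl_desc_assoc]
  · rintro (_ | t)
    · exact (coprod.inr_desc_assoc _ _ _).symm.trans (congrArg (fun k => coprod.inr ≫ k) hl.1)
    · exact hl.2 t

variable {E : MorphismProperty C'} [E.RespectsIso] [E.IsStableUnderComposition]
  [HasFiniteCoproducts C] [HasFiniteCoproducts C']

/-- A functor which commutes with binary coproducts up to `E` commutes with nonempty finite
coproducts up to `E`. -/
lemma copower_comparison_mem (hid : ∀ A : C', E (𝟙 A))
    (hE : ∀ ⦃A B A' B' : C'⦄ (f : A ⟶ B) (g : A' ⟶ B'), E f → E g → E (coprod.map f g))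
    (ψ : C ⥤ C') (hψ : ∀ A B, E (coprodComparison ψ A B)) (T : Type) [hT : Finite T] :
    ∀ {W X P : C} {W' X' P' : C'} {a : W ⟶ P} {b : T → (X ⟶ P)} {a' : W' ⟶ P'}
      {b' : T → (X' ⟶ P')} (_ : IsCopower a b) (_ : IsCopower a' b') (w : W' ⟶ ψ.obj W)
      (x : X' ⟶ ψ.obj X) (_ : E w) (_ : E x) (m : P' ⟶ ψ.obj P) (_ : a' ≫ m = w ≫ ψ.map a)
      (_ : ∀ t, b' t ≫ m = x ≫ ψ.map (b t)), E m := by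
  have hiso : ∀ {A B : C'} (f : A ⟶ B) [IsIso f], E f := fun f _ =>
    (E.arrow_mk_iso_iff (Arrow.isoMk (Iso.refl _) (asIso f) (by simp) :
      Arrow.mk (𝟙 _) ≅ Arrow.mk f)).1 (hid _)
  revert hT
  refine Finite.induction_empty_option (P := fun T => ∀ [Finite T] {W X P : C} {W' X' P' : C'}
      {a : W ⟶ P} {b : T → (X ⟶ P)} {a' : W' ⟶ P'}
      {b' : T → (X' ⟶ P')} (_ : IsCopower a b) (_ : IsCopower a' b') (w : W' ⟶ ψ.obj W)
      (x : X' ⟶ ψ.obj X) (_ : E w) (_ : E x) (m : P' ⟶ ψ.obj P) (_ : a' ≫ m = w ≫ ψ.map a)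
      (_ : ∀ t, b' t ≫ m = x ≫ ψ.map (b t)), E m) ?_ ?_ ?_ T
  · intro T T' e ih hT' W X P W' X' P' a b a' b' h h' w x hw hx m ha hb
    have hT : Finite T := Finite.of_equiv T' e.symm
    exact ih (h.reindex e) (h'.reindex e) w x hw hx m ha fun t => hb _
  -- Over the empty index set `a` and `a'` are isomorphisms, so `m` is `w` up to isomorphism;
  -- nothing about initial objects is required of `ψ`.
  · intro _ W X P W' X' P' a b a' b' h h' w x hw hx m ha _
    have := h.isIso
    have := h'.isIso
    have : m = inv a' ≫ w ≫ ψ.map a := by rw [← ha]; simp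
    rw [this]
    exact E.comp_mem _ _ (hiso _) (E.comp_mem _ _ hw (hiso _))
  · intro T _ ih _ W X P W' X' P' a b a' b' h h' w x hw hx m ha hb
    -- The corner becomes `W ⨿ X`, and this is the only place where the hypothesis on binary
    -- coproducts enters.
    refine ih h.of_option h'.of_option (coprod.map w x ≫ coprodComparison ψ W X) x
      (E.comp_mem _ _ (hE _ _ hw hx) (hψ _ _)) hx m (coprod.hom_ext ?_ ?_) fun t => hb _
    · rw [coprod.inl_desc_assoc, Category.assoc, coprod.inl_map_assoc, reassoc_of% coprodComparison_inl,
        ← ψ.map_comp, coprod.inl_desc, ha]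
    · rw [coprod.inr_desc_assoc, Category.assoc, coprod.inr_map_assoc, reassoc_of% coprodComparison_inr,
        ← ψ.map_comp, coprod.inr_desc, hb]

end Coproducts

/-! ### Double mapping cylinders in a single degree -/

section Levelwise

variable {D : Type u} [Category.{v} D] [HasFiniteCoproducts D]
  {X Y Z : SimplicialObject D} {f : X ⟶ Y} {g : X ⟶ Z}

namespace Cyl

/-- Evaluation in degree `n` preserves the pushout which defines `Cyl`, so `T` needs no simplicial
structure. -/
lemma app_hom_ext {n : SimplexCategoryᵒᵖ} {T : D} {p q : (Cyl f g).obj n ⟶ T}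
    (hX : ∀ θ, cylinderι X θ ≫ (inX f g).app n ≫ p = cylinderι X θ ≫ (inX f g).app n ≫ q)
    (hY : (inY f g).app n ≫ p = (inY f g).app n ≫ q)
    (hZ : (inZ f g).app n ≫ p = (inZ f g).app n ≫ q) : p = q := by
  let ev := (evaluation SimplexCategoryᵒᵖ D).obj n
  have po := (IsPushout.of_hasPushout (cylinderFaces X) (coprod.map f g)).map ev
  refine po.hom_ext (cylinder_hom_ext hX) ?_
  refine BinaryCofan.IsColimit.hom_ext
    (isColimitOfHasBinaryCoproductOfPreservesColimit ev Y Z) ?_ ?_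
  · exact (Category.assoc _ _ _).symm.trans (hY.trans (Category.assoc _ _ _))
  · exact (Category.assoc _ _ _).symm.trans (hZ.trans (Category.assoc _ _ _))

/-- In one fixed degree the only gluing conditions are at the two constant simplices. Degreewise
inverses are later built with this, without checking compatibility with faces and degeneracies. -/
lemma exists_appDesc {n : SimplexCategoryᵒᵖ} {T : D} (k : (n.unop ⟶ ⦋1⦌) → (X.obj n ⟶ T))
    (y : Y.obj n ⟶ T) (z : Z.obj n ⟶ T) (h₀ : k (vertex n.unop 0) = f.app n ≫ y)
    (h₁ : k (vertex n.unop 1) = g.app n ≫ z) :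
    ∃ h : (Cyl f g).obj n ⟶ T, (∀ θ, cylinderι X θ ≫ (inX f g).app n ≫ h = k θ) ∧
      (inY f g).app n ≫ h = y ∧ (inZ f g).app n ≫ h = z := by
  let ev := (evaluation SimplexCategoryᵒᵖ D).obj n
  have po := (IsPushout.of_hasPushout (cylinderFaces X) (coprod.map f g)).map ev
  let hX := isColimitOfHasBinaryCoproductOfPreservesColimit ev X X
  let hc := isColimitOfHasBinaryCoproductOfPreservesColimit ev Y Z
  obtain ⟨l, hl, hl'⟩ := BinaryCofan.IsColimit.desc' hc y z
  have w : ev.map (cylinderFaces X) ≫ cylinderDesc k = ev.map (coprod.map f g) ≫ l := by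
    refine BinaryCofan.IsColimit.hom_ext hX ?_ ?_
    · have h₁ : ev.map coprod.inl ≫ ev.map (cylinderFaces X) = cylinderι X (vertex n.unop 0) := by
        rw [← ev.map_comp, coprod.inl_desc]
        rfl
      have h₂ : ev.map coprod.inl ≫ ev.map (coprod.map f g) = f.app n ≫ ev.map coprod.inl := by
        rw [← ev.map_comp, coprod.inl_map, ev.map_comp]
        rfl
      refine ((Category.assoc _ _ _).symm.trans (congrArg (fun m => m ≫ cylinderDesc k) h₁)).trans
        (Eq.trans ?_ ((congrArg (fun m => m ≫ l) h₂).symm.trans (Category.assoc _ _ _)))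
      refine (cylinderι_desc k _).trans (h₀.trans (Eq.trans ?_ (Category.assoc _ _ _).symm))
      exact congrArg (fun k => f.app n ≫ k) hl.symm
    · have h₁' : ev.map coprod.inr ≫ ev.map (cylinderFaces X) = cylinderι X (vertex n.unop 1) := by
        rw [← ev.map_comp, coprod.inr_desc]
        rfl
      have h₂ : ev.map coprod.inr ≫ ev.map (coprod.map f g) = g.app n ≫ ev.map coprod.inr := by
        rw [← ev.map_comp, coprod.inr_map, ev.map_comp]
        rfl
      refine ((Category.assoc _ _ _).symm.trans (congrArg (fun m => m ≫ cylinderDesc k) h₁')).trans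
        (Eq.trans ?_ ((congrArg (fun m => m ≫ l) h₂).symm.trans (Category.assoc _ _ _)))
      refine (cylinderι_desc k _).trans (h₁.trans (Eq.trans ?_ (Category.assoc _ _ _).symm))
      exact congrArg (fun k => g.app n ≫ k) hl'.symm
  have e₁ := po.inl_desc (cylinderDesc k) l w
  have e₂ := po.inr_desc (cylinderDesc k) l w
  refine ⟨po.desc (cylinderDesc k) l w, fun θ => ?_, ?_, ?_⟩
  · exact (congrArg (fun m => cylinderι X θ ≫ m) e₁).trans (cylinderι_desc _ _)
  · refine (Category.assoc _ _ _).trans ((congrArg (fun m => _ ≫ m) e₂).trans hl)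
  · refine (Category.assoc _ _ _).trans ((congrArg (fun m => _ ≫ m) e₂).trans hl')

lemma app_vertex_zero (n : SimplexCategoryᵒᵖ) :
    cylinderι X (vertex n.unop 0) ≫ (inX f g).app n = f.app n ≫ (inY f g).app n :=
  congrArg (fun k => k.app n) (face_zero f g)

lemma app_vertex_one (n : SimplexCategoryᵒᵖ) :
    cylinderι X (vertex n.unop 1) ≫ (inX f g).app n = g.app n ≫ (inZ f g).app n :=
  congrArg (fun k => k.app n) (face_one f g)

lemma inX_map_app {X' Y' Z' : SimplicialObject D} {f' : X' ⟶ Y'} {g' : X' ⟶ Z'} (a : X ⟶ X')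
    (b : Y ⟶ Y') (c : Z ⟶ Z') (hf : f ≫ b = a ≫ f') (hg : g ≫ c = a ≫ g')
    {n : SimplexCategoryᵒᵖ} (θ : n.unop ⟶ ⦋1⦌) :
    cylinderι X θ ≫ (inX f g).app n ≫ (map a b c hf hg).app n =
      a.app n ≫ cylinderι X' θ ≫ (inX f' g').app n := by
  have h := congrArg (fun k => k.app n) (inX_map a b c hf hg)
  refine (congrArg (fun k => cylinderι X θ ≫ k) h).trans ?_
  refine (cylinderι_desc_assoc _ _ _).trans (Category.assoc _ _ _)

lemma inY_map_app {X' Y' Z' : SimplicialObject D} {f' : X' ⟶ Y'} {g' : X' ⟶ Z'} (a : X ⟶ X')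
    (b : Y ⟶ Y') (c : Z ⟶ Z') (hf : f ≫ b = a ≫ f') (hg : g ≫ c = a ≫ g')
    (n : SimplexCategoryᵒᵖ) :
    (inY f g).app n ≫ (map a b c hf hg).app n = b.app n ≫ (inY f' g').app n :=
  congrArg (fun k => k.app n) (inY_map a b c hf hg)

lemma inZ_map_app {X' Y' Z' : SimplicialObject D} {f' : X' ⟶ Y'} {g' : X' ⟶ Z'} (a : X ⟶ X')
    (b : Y ⟶ Y') (c : Z ⟶ Z') (hf : f ≫ b = a ≫ f') (hg : g ≫ c = a ≫ g')
    (n : SimplexCategoryᵒᵖ) :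
    (inZ f g).app n ≫ (map a b c hf hg).app n = c.app n ≫ (inZ f' g').app n :=
  congrArg (fun k => k.app n) (inZ_map a b c hf hg)

/-- The non-constant `n`-simplices of `Δ[1]`. -/
abbrev Inner (n : SimplexCategoryᵒᵖ) : Type :=
  {t : n.unop ⟶ ⦋1⦌ // t ≠ vertex n.unop 0 ∧ t ≠ vertex n.unop 1}

/-- The copies of `X_n` at the two constant simplices are absorbed by `Y_n` and `Z_n`, and all other
copies are free. Every degree of `Cyl` is therefore a finite coproduct, which is why control of
coproducts suffices throughout. -/
lemma isCopower (f : X ⟶ Y) (g : X ⟶ Z) (n : SimplexCategoryᵒᵖ) :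
    IsCopower (T := Inner n) (coprod.desc ((inY f g).app n) ((inZ f g).app n))
      fun t => cylinderι X t.1 ≫ (inX f g).app n := by
  classical
  intro Q a b
  obtain ⟨h, hX, hY, hZ⟩ := exists_appDesc (f := f) (g := g) (n := n)
    (fun θ => if hθ : θ ≠ vertex n.unop 0 ∧ θ ≠ vertex n.unop 1 then b ⟨θ, hθ⟩ else
      if θ = vertex n.unop 0 then f.app n ≫ coprod.inl ≫ a else g.app n ≫ coprod.inr ≫ a)
    (coprod.inl ≫ a) (coprod.inr ≫ a) (by simp) (by simp [(vertex_ne n.unop).symm])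
  refine ⟨h, ⟨coprod.hom_ext ((coprod.inl_desc_assoc _ _ _).trans hY)
    ((coprod.inr_desc_assoc _ _ _).trans hZ), fun t => ?_⟩, fun l hl => ?_⟩
  · rw [Category.assoc, hX, dif_pos t.2]
  · have lY : (inY f g).app n ≫ l = coprod.inl ≫ a := by
      rw [← hl.1, coprod.inl_desc_assoc]
    have lZ : (inZ f g).app n ≫ l = coprod.inr ≫ a := by
      rw [← hl.1, coprod.inr_desc_assoc]
    refine app_hom_ext (fun θ => ?_) (lY.trans hY.symm) (lZ.trans hZ.symm)
    by_cases h0 : θ = vertex n.unop 0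
    · subst h0
      rw [← Category.assoc, ← Category.assoc, app_vertex_zero, Category.assoc, Category.assoc, lY,
        hY]
    by_cases h1 : θ = vertex n.unop 1
    · subst h1
      rw [← Category.assoc, ← Category.assoc, app_vertex_one, Category.assoc, Category.assoc, lZ,
        hZ]
    have := hl.2 ⟨θ, h0, h1⟩
    rw [Category.assoc] at this
    rw [this, hX, dif_pos ⟨h0, h1⟩]

variable {D' : Type u'} [Category.{v'} D'] [HasFiniteCoproducts D']

/-- A map in degree `n` between a double mapping cylinder and the image of another one under a
functor which commutes with coproducts up to `E` is in `E` if it is so on the three corners. -/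
lemma app_mem {E : MorphismProperty D'} [E.RespectsIso] [E.IsStableUnderComposition]
    (hid : ∀ A : D', E (𝟙 A))
    (hE : ∀ ⦃A B A' B' : D'⦄ (f : A ⟶ B) (g : A' ⟶ B'), E f → E g → E (coprod.map f g))
    (ψ : D ⥤ D') (hψ : ∀ A B, E (coprodComparison ψ A B)) {X' Y' Z' : SimplicialObject D'}
    {f' : X' ⟶ Y'} {g' : X' ⟶ Z'} (n : SimplexCategoryᵒᵖ) (x : X'.obj n ⟶ ψ.obj (X.obj n))
    (y : Y'.obj n ⟶ ψ.obj (Y.obj n)) (z : Z'.obj n ⟶ ψ.obj (Z.obj n)) (hx : E x) (hy : E y)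
    (hz : E z) (m : (Cyl f' g').obj n ⟶ ψ.obj ((Cyl f g).obj n))
    (hmX : ∀ θ, cylinderι X' θ ≫ (inX f' g').app n ≫ m =
      x ≫ ψ.map (cylinderι X θ ≫ (inX f g).app n))
    (hmY : (inY f' g').app n ≫ m = y ≫ ψ.map ((inY f g).app n))
    (hmZ : (inZ f' g').app n ≫ m = z ≫ ψ.map ((inZ f g).app n)) : E m := by
  have : Finite (n.unop ⟶ ⦋1⦌) := inferInstance
  refine copower_comparison_mem hid hE ψ hψ (Inner n) (isCopower f g n) (isCopower f' g' n)
    (coprod.map y z ≫ coprodComparison ψ _ _) x (E.comp_mem _ _ (hE _ _ hy hz) (hψ _ _)) hx m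
    (coprod.hom_ext ?_ ?_) fun t => ?_
  · rw [coprod.inl_desc_assoc, Category.assoc, coprod.inl_map_assoc,
      reassoc_of% coprodComparison_inl, ← ψ.map_comp, coprod.inl_desc, hmY]
  · rw [coprod.inr_desc_assoc, Category.assoc, coprod.inr_map_assoc,
      reassoc_of% coprodComparison_inr, ← ψ.map_comp, coprod.inr_desc, hmZ]
  · rw [Category.assoc, hmX]

end Cyl

section Comparison

variable {D' : Type u'} [Category.{v'} D'] [HasFiniteCoproducts D'] [HasTerminal D] [HasTerminal D']
variable (ψ : D ⥤ D')

lemma cylComparison_inX_app (f : X ⟶ Y) (g : X ⟶ Z) (n : SimplexCategoryᵒᵖ) (θ : n.unop ⟶ ⦋1⦌) :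
    cylinderι ((simplicialExt ψ).obj X) θ ≫ (Cyl.inX ((simplicialExt ψ).map f)
      ((simplicialExt ψ).map g)).app n ≫ (cylComparison ψ f g).app n =
      ψ.map (cylinderι X θ ≫ (Cyl.inX f g).app n) := by
  have h := congrArg (fun k => k.app n) (Cyl.inX_desc (f := (simplicialExt ψ).map f)
    (g := (simplicialExt ψ).map g)
    (cylinderComparison ψ X ≫ (simplicialExt ψ).map (Cyl.inX f g))
    ((simplicialExt ψ).map (Cyl.inY f g)) ((simplicialExt ψ).map (Cyl.inZ f g))
    (by rw [← Category.assoc, cylinderFace_comparison, ← Functor.map_comp, ← Functor.map_comp,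
      Cyl.face_zero])
    (by rw [← Category.assoc, cylinderFace_comparison, ← Functor.map_comp, ← Functor.map_comp,
      Cyl.face_one]))
  refine (congrArg (fun k => _ ≫ k) h).trans ?_
  refine (Category.assoc _ _ _).symm.trans ?_
  rw [ψ.map_comp]
  refine congrArg (fun k => k ≫ _) ?_
  exact cylinderι_desc _ _

lemma inY_cylComparison (f : X ⟶ Y) (g : X ⟶ Z) :
    Cyl.inY ((simplicialExt ψ).map f) ((simplicialExt ψ).map g) ≫ cylComparison ψ f g =
      (simplicialExt ψ).map (Cyl.inY f g) := Cyl.inY_desc _ _ _ _ _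

lemma inZ_cylComparison (f : X ⟶ Y) (g : X ⟶ Z) :
    Cyl.inZ ((simplicialExt ψ).map f) ((simplicialExt ψ).map g) ≫ cylComparison ψ f g =
      (simplicialExt ψ).map (Cyl.inZ f g) := Cyl.inZ_desc _ _ _ _ _

lemma cylComparison_naturality {X' Y' Z' : SimplicialObject D} {f : X ⟶ Y} {g : X ⟶ Z}
    {f' : X' ⟶ Y'} {g' : X' ⟶ Z'} (a : X ⟶ X') (b : Y ⟶ Y') (c : Z ⟶ Z') (hf : f ≫ b = a ≫ f')
    (hg : g ≫ c = a ≫ g') :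
    cylComparison ψ f g ≫ (simplicialExt ψ).map (Cyl.map a b c hf hg) =
      Cyl.map ((simplicialExt ψ).map a) ((simplicialExt ψ).map b) ((simplicialExt ψ).map c)
        (by rw [← Functor.map_comp, hf, Functor.map_comp])
        (by rw [← Functor.map_comp, hg, Functor.map_comp]) ≫ cylComparison ψ f' g' := by
  refine Cyl.hom_ext ?_ ?_ ?_
  · ext n
    refine cylinder_hom_ext fun θ => ?_
    have h₁ := congrArg (fun k => k ≫ ψ.map ((Cyl.map a b c hf hg).app n))
      (cylComparison_inX_app ψ f g n θ)
    have h₂ := Cyl.inX_map_app ((simplicialExt ψ).map a) ((simplicialExt ψ).map b)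
      ((simplicialExt ψ).map c) (f' := (simplicialExt ψ).map f') (g' := (simplicialExt ψ).map g')
      (by rw [← Functor.map_comp, hf, Functor.map_comp])
      (by rw [← Functor.map_comp, hg, Functor.map_comp]) θ
    have h₃ := cylComparison_inX_app ψ f' g' n θ
    refine (((Category.assoc _ _ _).trans (congrArg (fun k => _ ≫ k)
      (Category.assoc _ _ _))).symm.trans h₁).trans ((ψ.map_comp _ _).symm.trans ?_)
    rw [Category.assoc, Cyl.inX_map_app, ψ.map_comp, ← h₃]
    exact ((congrArg (fun k => k ≫ (cylComparison ψ f' g').app n) h₂).trans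
      (by simp only [Category.assoc]; rfl)).symm.trans (by simp only [Category.assoc]; rfl)
  · rw [← Category.assoc, inY_cylComparison, ← Category.assoc, Cyl.inY_map, Category.assoc,
      inY_cylComparison, ← Functor.map_comp, ← Functor.map_comp, Cyl.inY_map]
  · rw [← Category.assoc, inZ_cylComparison, ← Category.assoc, Cyl.inZ_map, Category.assoc,
      inZ_cylComparison, ← Functor.map_comp, ← Functor.map_comp, Cyl.inZ_map]

end Comparison

end Levelwise

end SimplicialDescent

namespace SimplicialDescent

/-! ### Calculus of maps of double mapping cylinders -/

section

variable {D : Type u} [Category.{v} D] [HasFiniteCoproducts D]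
  {X Y Z : SimplicialObject D} {f : X ⟶ Y} {g : X ⟶ Z}

namespace Cyl

lemma map_comp {X' Y' Z' X'' Y'' Z'' : SimplicialObject D} {f' : X' ⟶ Y'} {g' : X' ⟶ Z'}
    {f'' : X'' ⟶ Y''} {g'' : X'' ⟶ Z''} (a : X ⟶ X') (b : Y ⟶ Y') (c : Z ⟶ Z')
    (hf : f ≫ b = a ≫ f') (hg : g ≫ c = a ≫ g') (a' : X' ⟶ X'') (b' : Y' ⟶ Y'') (c' : Z' ⟶ Z'')
    (hf' : f' ≫ b' = a' ≫ f'') (hg' : g' ≫ c' = a' ≫ g'') :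
    map a b c hf hg ≫ map a' b' c' hf' hg' =
      map (a ≫ a') (b ≫ b') (c ≫ c') (by rw [reassoc_of% hf, hf', Category.assoc])
        (by rw [reassoc_of% hg, hg', Category.assoc]) := by
  refine hom_ext ?_ ?_ ?_
  · rw [← Category.assoc, inX_map, Category.assoc, inX_map, inX_map, cylinderMap_comp,
      Category.assoc]
  · rw [← Category.assoc, inY_map, Category.assoc, inY_map, inY_map, Category.assoc]
  · rw [← Category.assoc, inZ_map, Category.assoc, inZ_map, inZ_map, Category.assoc]

@[simp]
lemma inX_map_assoc {X' Y' Z' : SimplicialObject D} {f' : X' ⟶ Y'} {g' : X' ⟶ Z'} (a : X ⟶ X')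
    (b : Y ⟶ Y') (c : Z ⟶ Z') (hf : f ≫ b = a ≫ f') (hg : g ≫ c = a ≫ g')
    {T : SimplicialObject D} (h : Cyl f' g' ⟶ T) :
    inX f g ≫ map a b c hf hg ≫ h = cylinderMap a ≫ inX f' g' ≫ h := by
  rw [← Category.assoc, inX_map, Category.assoc]

@[simp]
lemma inY_map_assoc {X' Y' Z' : SimplicialObject D} {f' : X' ⟶ Y'} {g' : X' ⟶ Z'} (a : X ⟶ X')
    (b : Y ⟶ Y') (c : Z ⟶ Z') (hf : f ≫ b = a ≫ f') (hg : g ≫ c = a ≫ g')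
    {T : SimplicialObject D} (h : Cyl f' g' ⟶ T) :
    inY f g ≫ map a b c hf hg ≫ h = b ≫ inY f' g' ≫ h := by
  rw [← Category.assoc, inY_map, Category.assoc]

@[simp]
lemma inZ_map_assoc {X' Y' Z' : SimplicialObject D} {f' : X' ⟶ Y'} {g' : X' ⟶ Z'} (a : X ⟶ X')
    (b : Y ⟶ Y') (c : Z ⟶ Z') (hf : f ≫ b = a ≫ f') (hg : g ≫ c = a ≫ g')
    {T : SimplicialObject D} (h : Cyl f' g' ⟶ T) :
    inZ f g ≫ map a b c hf hg ≫ h = c ≫ inZ f' g' ≫ h := by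
  rw [← Category.assoc, inZ_map, Category.assoc]

@[simp]
lemma inX_desc_assoc {T : SimplicialObject D} (h : cylinder X ⟶ T) (p : Y ⟶ T) (q : Z ⟶ T)
    (hp : cylinderFace 0 X ≫ h = f ≫ p) (hq : cylinderFace 1 X ≫ h = g ≫ q)
    {T' : SimplicialObject D} (k : T ⟶ T') : inX f g ≫ desc h p q hp hq ≫ k = h ≫ k := by
  rw [← Category.assoc, inX_desc]

@[simp]
lemma inY_desc_assoc {T : SimplicialObject D} (h : cylinder X ⟶ T) (p : Y ⟶ T) (q : Z ⟶ T)
    (hp : cylinderFace 0 X ≫ h = f ≫ p) (hq : cylinderFace 1 X ≫ h = g ≫ q)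
    {T' : SimplicialObject D} (k : T ⟶ T') : inY f g ≫ desc h p q hp hq ≫ k = p ≫ k := by
  rw [← Category.assoc, inY_desc]

@[simp]
lemma inZ_desc_assoc {T : SimplicialObject D} (h : cylinder X ⟶ T) (p : Y ⟶ T) (q : Z ⟶ T)
    (hp : cylinderFace 0 X ≫ h = f ≫ p) (hq : cylinderFace 1 X ≫ h = g ≫ q)
    {T' : SimplicialObject D} (k : T ⟶ T') : inZ f g ≫ desc h p q hp hq ≫ k = q ≫ k := by
  rw [← Category.assoc, inZ_desc]

lemma face_zero_assoc {T : SimplicialObject D} (h : Cyl f g ⟶ T) :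
    cylinderFace 0 X ≫ inX f g ≫ h = f ≫ inY f g ≫ h := by
  rw [← Category.assoc, face_zero, Category.assoc]

lemma face_one_assoc {T : SimplicialObject D} (h : Cyl f g ⟶ T) :
    cylinderFace 1 X ≫ inX f g ≫ h = g ≫ inZ f g ≫ h := by
  rw [← Category.assoc, face_one, Category.assoc]

end Cyl

@[simp]
lemma cylinderFace_proj_assoc (i : Fin 2) (X : SimplicialObject D) {T : SimplicialObject D}
    (k : X ⟶ T) : cylinderFace i X ≫ cylinderProj X ≫ k = k := by
  rw [← Category.assoc, cylinderFace_proj, Category.id_comp]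

@[simp]
lemma cylinderFace_map_assoc (i : Fin 2) {X X' : SimplicialObject D} (h : X ⟶ X')
    {T : SimplicialObject D} (k : cylinder X' ⟶ T) :
    cylinderFace i X ≫ cylinderMap h ≫ k = h ≫ cylinderFace i X' ≫ k := by
  rw [← Category.assoc, cylinderFace_map, Category.assoc]

@[simp]
lemma cylinderMap_proj_assoc {X X' : SimplicialObject D} (h : X ⟶ X') {T : SimplicialObject D}
    (k : X' ⟶ T) : cylinderMap h ≫ cylinderProj X' ≫ k = cylinderProj X ≫ h ≫ k := by
  rw [← Category.assoc, cylinderMap_proj, Category.assoc]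

/-! ### Functors applied to double mapping cylinders of constant objects -/

section Const

variable {D' : Type u'} [Category.{v'} D'] [HasFiniteCoproducts D']
  [HasTerminal D] [HasTerminal D'] (ψ : D ⥤ D')

/-- The identification of the constant simplicial object at `ψ(A)` with the image of the constant
simplicial object at `A`. -/
def constExt (A : D) :
    (SimplicialObject.const D').obj (ψ.obj A) ⟶ (simplicialExt ψ).obj ((SimplicialObject.const D).obj A) where
  app _ := 𝟙 (ψ.obj A)
  naturality _ _ _ := (Category.comp_id _).trans ((Category.id_comp _).trans (ψ.map_id A)).symm

lemma constExt_naturality {A B : D} (f : A ⟶ B) :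
    (SimplicialObject.const D').map (ψ.map f) ≫ constExt ψ B =
      constExt ψ A ≫ (simplicialExt ψ).map ((SimplicialObject.const D).map f) := by
  ext n
  exact (Category.comp_id _).trans (Category.id_comp _).symm

/-- The comparison of the double mapping cylinder of the images of `f` and `g` under `ψ` with the
image of the one of `f` and `g`. -/
noncomputable def constCylComparison {A B C : D} (f : A ⟶ B) (g : A ⟶ C) :
    Cyl ((SimplicialObject.const D').map (ψ.map f)) ((SimplicialObject.const D').map (ψ.map g)) ⟶
      (simplicialExt ψ).obj
        (Cyl ((SimplicialObject.const D).map f) ((SimplicialObject.const D).map g)) :=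
  Cyl.map (constExt ψ A) (constExt ψ B) (constExt ψ C) (constExt_naturality ψ f)
    (constExt_naturality ψ g) ≫ cylComparison ψ _ _

lemma constCylComparison_inX_app {A B C : D} (f : A ⟶ B) (g : A ⟶ C) (n : SimplexCategoryᵒᵖ)
    (θ : n.unop ⟶ ⦋1⦌) :
    cylinderι ((SimplicialObject.const D').obj (ψ.obj A)) θ ≫
      (Cyl.inX ((SimplicialObject.const D').map (ψ.map f))
        ((SimplicialObject.const D').map (ψ.map g))).app n ≫ (constCylComparison ψ f g).app n =
      ψ.map (cylinderι ((SimplicialObject.const D).obj A) θ ≫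
        (Cyl.inX ((SimplicialObject.const D).map f) ((SimplicialObject.const D).map g)).app n) := by
  have h := Cyl.inX_map_app (constExt ψ A) (constExt ψ B) (constExt ψ C)
    (constExt_naturality ψ f) (constExt_naturality ψ g) θ
  refine Eq.trans ?_ (cylComparison_inX_app ψ ((SimplicialObject.const D).map f)
    ((SimplicialObject.const D).map g) n θ)
  have h' := congrArg (fun k => k ≫ (cylComparison ψ ((SimplicialObject.const D).map f)
    ((SimplicialObject.const D).map g)).app n) (h.trans (Category.id_comp _))
  refine Eq.trans ?_ (h'.trans (Category.assoc _ _ _))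
  simp only [Category.assoc]
  rfl

lemma constCylComparison_inY_app {A B C : D} (f : A ⟶ B) (g : A ⟶ C) (n : SimplexCategoryᵒᵖ) :
    (Cyl.inY ((SimplicialObject.const D').map (ψ.map f))
        ((SimplicialObject.const D').map (ψ.map g))).app n ≫ (constCylComparison ψ f g).app n =
      ψ.map ((Cyl.inY ((SimplicialObject.const D).map f)
        ((SimplicialObject.const D).map g)).app n) := by
  refine (congrArg (fun k => k.app n) (Cyl.inY_map_assoc (constExt ψ A) (constExt ψ B)
    (constExt ψ C) (constExt_naturality ψ f) (constExt_naturality ψ g)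
    (cylComparison ψ _ _))).trans ?_
  refine (Category.id_comp _).trans ?_
  exact congrArg (fun k => k.app n) (inY_cylComparison ψ ((SimplicialObject.const D).map f)
        ((SimplicialObject.const D).map g))

lemma constCylComparison_inZ_app {A B C : D} (f : A ⟶ B) (g : A ⟶ C) (n : SimplexCategoryᵒᵖ) :
    (Cyl.inZ ((SimplicialObject.const D').map (ψ.map f))
        ((SimplicialObject.const D').map (ψ.map g))).app n ≫ (constCylComparison ψ f g).app n =
      ψ.map ((Cyl.inZ ((SimplicialObject.const D).map f)
        ((SimplicialObject.const D).map g)).app n) := by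
  refine (congrArg (fun k => k.app n) (Cyl.inZ_map_assoc (constExt ψ A) (constExt ψ B)
    (constExt ψ C) (constExt_naturality ψ f) (constExt_naturality ψ g)
    (cylComparison ψ _ _))).trans ?_
  refine (Category.id_comp _).trans ?_
  exact congrArg (fun k => k.app n) (inZ_cylComparison ψ ((SimplicialObject.const D).map f)
        ((SimplicialObject.const D).map g))

/-- The comparison is induced by identities on all summands, so it only measures how far `ψ` is from
preserving finite coproducts. -/
lemma constCylComparison_app_mem {E : MorphismProperty D'} [E.RespectsIso]
    [E.IsStableUnderComposition] (hid : ∀ A : D', E (𝟙 A))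
    (hE : ∀ ⦃A B A' B' : D'⦄ (f : A ⟶ B) (g : A' ⟶ B'), E f → E g → E (coprod.map f g))
    (hψ : ∀ A B, E (coprodComparison ψ A B)) {A B C : D} (f : A ⟶ B) (g : A ⟶ C)
    (n : SimplexCategoryᵒᵖ) : E ((constCylComparison ψ f g).app n) :=
  Cyl.app_mem hid hE ψ hψ n (𝟙 _) (𝟙 _) (𝟙 _) (hid _) (hid _) (hid _) _
    (fun θ => (constCylComparison_inX_app ψ f g n θ).trans (Category.id_comp _).symm)
    ((constCylComparison_inY_app ψ f g n).trans (Category.id_comp _).symm)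
    ((constCylComparison_inZ_app ψ f g n).trans (Category.id_comp _).symm)

lemma cylComparison_app_mem {E : MorphismProperty D'} [E.RespectsIso]
    [E.IsStableUnderComposition] (hid : ∀ A : D', E (𝟙 A))
    (hE : ∀ ⦃A B A' B' : D'⦄ (f : A ⟶ B) (g : A' ⟶ B'), E f → E g → E (coprod.map f g))
    (hψ : ∀ A B, E (coprodComparison ψ A B)) (f : X ⟶ Y) (g : X ⟶ Z)
    (n : SimplexCategoryᵒᵖ) : E ((cylComparison ψ f g).app n) :=
  Cyl.app_mem hid hE ψ hψ n (𝟙 _) (𝟙 _) (𝟙 _) (hid _) (hid _) (hid _) _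
    (fun θ => (cylComparison_inX_app ψ f g n θ).trans (Category.id_comp _).symm)
    ((congrArg (fun k => k.app n) (inY_cylComparison ψ f g)).trans (Category.id_comp _).symm)
    ((congrArg (fun k => k.app n) (inZ_cylComparison ψ f g)).trans (Category.id_comp _).symm)

lemma constCylComparison_naturality {A B C A' B' C' : D} {f : A ⟶ B} {g : A ⟶ C} {f' : A' ⟶ B'}
    {g' : A' ⟶ C'} (a : A ⟶ A') (b : B ⟶ B') (c : C ⟶ C') (hf : f ≫ b = a ≫ f')
    (hg : g ≫ c = a ≫ g') :
    constCylComparison ψ f g ≫ (simplicialExt ψ).map (Cyl.map ((SimplicialObject.const D).map a)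
        ((SimplicialObject.const D).map b) ((SimplicialObject.const D).map c)
        (by rw [← Functor.map_comp, hf, Functor.map_comp])
        (by rw [← Functor.map_comp, hg, Functor.map_comp])) =
      Cyl.map ((SimplicialObject.const D').map (ψ.map a)) ((SimplicialObject.const D').map (ψ.map b))
        ((SimplicialObject.const D').map (ψ.map c))
        (by rw [← Functor.map_comp, ← Functor.map_comp, ← Functor.map_comp, ← Functor.map_comp, hf])
        (by rw [← Functor.map_comp, ← Functor.map_comp, ← Functor.map_comp, ← Functor.map_comp, hg])
        ≫ constCylComparison ψ f' g' := by
  refine (Category.assoc _ _ _).trans ?_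
  rw [cylComparison_naturality]
  refine (Category.assoc _ _ _).symm.trans (Eq.trans ?_ (Category.assoc _ _ _))
  refine congrArg (fun k => k ≫ cylComparison ψ _ _) ?_
  rw [Cyl.map_comp, Cyl.map_comp]
  congr 1
  · exact (constExt_naturality ψ a).symm
  · exact (constExt_naturality ψ b).symm
  · exact (constExt_naturality ψ c).symm

end Const

/-! ### Cones of the inclusions of the two ends -/

section Gluing

variable [HasTerminal D]

/-- The cone of `Z ⟶ Cyl(f, g)` is obtained from `Cyl(f, g)` by gluing a cone on `Z`. -/
noncomputable def coneInZIso (f : X ⟶ Y) (g : X ⟶ Z) :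
    Cyl f (g ≫ inclCone Z) ≅ simplicialCone (Cyl.inZ f g) where
  hom := Cyl.desc (Cyl.inX f g ≫ Cyl.inY _ _) (Cyl.inY f g ≫ Cyl.inY _ _)
    (simplicialConeMap (𝟙 Z) (Cyl.inZ f g) (by simp))
    (by rw [Cyl.face_zero_assoc]) (by rw [Cyl.face_one_assoc, Category.assoc, Cyl.inY_map])
  inv := Cyl.desc (Cyl.inX (𝟙 Z) (toPoint Z) ≫ Cyl.inZ _ _)
    (Cyl.map (𝟙 X) (𝟙 Y) (inclCone Z) (by simp) (by simp))
    (Cyl.inZ (𝟙 Z) (toPoint Z) ≫ Cyl.inZ _ _)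
    (by rw [Cyl.face_zero_assoc, Category.id_comp, Cyl.inZ_map])
    (by rw [Cyl.face_one_assoc])
  hom_inv_id := Cyl.hom_ext (by simp) (by simp)
    (by
      rw [Cyl.inZ_desc_assoc]
      exact Cyl.hom_ext (by simp) (by simp) (by simp))
  inv_hom_id := Cyl.hom_ext (by simp)
    (by
      rw [Cyl.inY_desc_assoc]
      exact Cyl.hom_ext (by simp) (by simp) (by simp))
    (by simp)

/-- The cone of `Y ⟶ Cyl(f, g)` is obtained from `Cyl(f, g)` by gluing a cone on `Y`. -/
noncomputable def coneInYIso (f : X ⟶ Y) (g : X ⟶ Z) :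
    Cyl (f ≫ inclCone Y) g ≅ simplicialCone (Cyl.inY f g) where
  hom := Cyl.desc (Cyl.inX f g ≫ Cyl.inY _ _) (simplicialConeMap (𝟙 Y) (Cyl.inY f g) (by simp))
    (Cyl.inZ f g ≫ Cyl.inY _ _)
    (by rw [Cyl.face_zero_assoc, Category.assoc, Cyl.inY_map]) (by rw [Cyl.face_one_assoc])
  inv := Cyl.desc (Cyl.inX (𝟙 Y) (toPoint Y) ≫ Cyl.inY _ _)
    (Cyl.map (𝟙 X) (inclCone Y) (𝟙 Z) (by simp) (by simp))
    (Cyl.inZ (𝟙 Y) (toPoint Y) ≫ Cyl.inY _ _)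
    (by rw [Cyl.face_zero_assoc, Category.id_comp, Cyl.inY_map])
    (by rw [Cyl.face_one_assoc])
  hom_inv_id := Cyl.hom_ext (by simp)
    (by
      rw [Cyl.inY_desc_assoc]
      exact Cyl.hom_ext (by simp) (by simp) (by simp))
    (by simp)
  inv_hom_id := Cyl.hom_ext (by simp)
    (by
      rw [Cyl.inY_desc_assoc]
      exact Cyl.hom_ext (by simp) (by simp) (by simp))
    (by simp)

end Gluing

/-! ### Cylinders of cylinders and the contraction by the minimum -/

section CylinderOfCyl

/-- The universal property of `Cyl(f, g) ⊠ Δ[1]`. -/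
lemma exists_cylinder_cyl_desc {T : SimplicialObject D} (hX : cylinder (cylinder X) ⟶ T)
    (hY : cylinder Y ⟶ T) (hZ : cylinder Z ⟶ T)
    (h₀ : cylinderMap (cylinderFace 0 X) ≫ hX = cylinderMap f ≫ hY)
    (h₁ : cylinderMap (cylinderFace 1 X) ≫ hX = cylinderMap g ≫ hZ) :
    ∃ h : cylinder (Cyl f g) ⟶ T, cylinderMap (Cyl.inX f g) ≫ h = hX ∧
      cylinderMap (Cyl.inY f g) ≫ h = hY ∧ cylinderMap (Cyl.inZ f g) ≫ h = hZ := by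
  -- For a fixed degree and a fixed simplex `θ` of the outer cylinder this is the degreewise
  -- universal property of `Cyl`; uniqueness then shows that the pieces are simplicial.
  have aux : ∀ (n : SimplexCategoryᵒᵖ) (θ : n.unop ⟶ ⦋1⦌), ∃ h : (Cyl f g).obj n ⟶ T.obj n,
      (∀ τ, cylinderι X τ ≫ (Cyl.inX f g).app n ≫ h =
        cylinderι X τ ≫ cylinderι (cylinder X) θ ≫ hX.app n) ∧
      (Cyl.inY f g).app n ≫ h = cylinderι Y θ ≫ hY.app n ∧
      (Cyl.inZ f g).app n ≫ h = cylinderι Z θ ≫ hZ.app n := by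
    intro n θ
    refine Cyl.exists_appDesc _ _ _ ?_ ?_
    · have := congrArg (fun k => cylinderι X θ ≫ k.app n) h₀
      simpa [cylinderMap, cylinderFace] using this
    · have := congrArg (fun k => cylinderι X θ ≫ k.app n) h₁
      simpa [cylinderMap, cylinderFace] using this
  choose k kX kY kZ using aux
  refine ⟨{ app := fun n => cylinderDesc (k n), naturality := ?_ }, ?_, ?_, ?_⟩
  · intro n m α
    refine cylinder_hom_ext fun θ => ?_
    rw [cylinderι_map_assoc, cylinderι_desc, cylinderι_desc_assoc]
    refine Cyl.app_hom_ext (fun τ => ?_) ?_ ?_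
    · rw [reassoc_of% kX, ← hX.naturality, ← NatTrans.naturality_assoc, cylinderι_map_assoc, kX,
        cylinderι_map_assoc, cylinderι_map_assoc]
    · rw [reassoc_of% kY, ← hY.naturality, ← NatTrans.naturality_assoc, kY, cylinderι_map_assoc]
    · rw [reassoc_of% kZ, ← hZ.naturality, ← NatTrans.naturality_assoc, kZ, cylinderι_map_assoc]
  · ext n
    refine cylinder_hom_ext fun θ => cylinder_hom_ext fun τ => ?_
    simp [cylinderMap, kX]
  · ext n
    exact cylinder_hom_ext fun θ => by simp [cylinderMap, kY]
  · ext n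
    exact cylinder_hom_ext fun θ => by simp [cylinderMap, kZ]

/-- The minimum of two simplices of `Δ[1]`. -/
def simplexInf {n : SimplexCategory} (θ τ : n ⟶ ⦋1⦌) : n ⟶ ⦋1⦌ :=
  SimplexCategory.Hom.mk (θ.toOrderHom ⊓ τ.toOrderHom)

lemma comp_simplexInf {n m : SimplexCategory} (α : m ⟶ n) (θ τ : n ⟶ ⦋1⦌) :
    α ≫ simplexInf θ τ = simplexInf (α ≫ θ) (α ≫ τ) := rfl

/-- The face `d^0` skips the vertex 0, so `vertex n 0` is constant at 1 and is the unit of the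
minimum; `vertex n 1` is constant at 0 and absorbs everything. -/
lemma simplexInf_vertex_zero {n : SimplexCategory} (θ : n ⟶ ⦋1⦌) :
    simplexInf θ (vertex n 0) = θ := by
  ext x : 3
  exact inf_eq_left.2 (Fin.le_last _)

lemma vertex_zero_simplexInf {n : SimplexCategory} (θ : n ⟶ ⦋1⦌) :
    simplexInf (vertex n 0) θ = θ := by
  ext x : 3
  exact inf_eq_right.2 (Fin.le_last _)

lemma simplexInf_vertex_one {n : SimplexCategory} (θ : n ⟶ ⦋1⦌) :
    simplexInf θ (vertex n 1) = vertex n 1 := by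
  ext x : 3
  exact inf_eq_right.2 (Fin.zero_le _)

lemma vertex_one_simplexInf {n : SimplexCategory} (θ : n ⟶ ⦋1⦌) :
    simplexInf (vertex n 1) θ = vertex n 1 := by
  ext x : 3
  exact inf_eq_left.2 (Fin.zero_le _)

/-- The map `X ⊠ Δ[1] ⊠ Δ[1] ⟶ X ⊠ Δ[1]` induced by the minimum `Δ[1] × Δ[1] ⟶ Δ[1]`. -/
noncomputable def cylinderInf (X : SimplicialObject D) : cylinder (cylinder X) ⟶ cylinder X where
  app n := cylinderDesc fun θ => cylinderDesc fun τ => cylinderι X (simplexInf θ τ)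
  naturality n m α := cylinder_hom_ext fun θ => cylinder_hom_ext fun τ => by
    simp [comp_simplexInf]

-- In either cylinder variable the minimum is the identity at the `d^0` end and the collapse onto
-- the `d^1` end at the other. This is the homotopy behind the retraction in the octahedron.
@[simp]
lemma face_zero_cylinderInf (X : SimplicialObject D) :
    cylinderFace 0 (cylinder X) ≫ cylinderInf X = 𝟙 _ := by
  ext n
  exact cylinder_hom_ext fun θ => by simp [cylinderFace, cylinderInf, vertex_zero_simplexInf]

@[simp]
lemma face_one_cylinderInf (X : SimplicialObject D) :
    cylinderFace 1 (cylinder X) ≫ cylinderInf X = cylinderProj X ≫ cylinderFace 1 X := by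
  ext n
  exact cylinder_hom_ext fun θ => by
    simp [cylinderFace, cylinderInf, vertex_one_simplexInf, cylinderProj]

@[simp]
lemma map_face_zero_cylinderInf (X : SimplicialObject D) :
    cylinderMap (cylinderFace 0 X) ≫ cylinderInf X = 𝟙 _ := by
  ext n
  exact cylinder_hom_ext fun θ => by
    simp [cylinderFace, cylinderMap, cylinderInf, simplexInf_vertex_zero]

@[simp]
lemma map_face_one_cylinderInf (X : SimplicialObject D) :
    cylinderMap (cylinderFace 1 X) ≫ cylinderInf X = cylinderProj X ≫ cylinderFace 1 X := by
  ext n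
  exact cylinder_hom_ext fun θ => by
    simp [cylinderFace, cylinderMap, cylinderInf, simplexInf_vertex_one, cylinderProj]

end CylinderOfCyl

end

end SimplicialDescent

namespace SimplicialDescent

/-! ### Components of morphisms in localized functor categories -/

section Evaluation

variable {C : Type u} [Category.{v} C] {J : Type*} [Category J] {J' : Type*} [Category J']

lemma evalAt_map_Q (W : MorphismProperty C) {F G : J ⥤ C} (α : F ⟶ G) (j : J) :
    (evalAt J W j).map ((W.functorCategory J).Q.map α) = W.Q.map (α.app j) :=
  localizedMap_map_Q ((evaluation J C).obj j)
    (fun _ _ f (hf : W.functorCategory J f) => hf j) α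

/-- A morphism of localized functors is natural with respect to the morphisms of the source. -/
lemma evalAt_naturality (W : MorphismProperty C) {F G : J ⥤ C}
    (θ : (W.functorCategory J).Q.obj F ⟶ (W.functorCategory J).Q.obj G) {j j' : J} (φ : j ⟶ j') :
    W.Q.map (F.map φ) ≫ (evalAt J W j').map θ = (evalAt J W j).map θ ≫ W.Q.map (G.map φ) := by
  -- Before localization `F ↦ F.map φ` is natural in `F`. Its extension to the localization is
  -- natural also for `θ`, which need not come from a transformation of functors to `C`.
  let τ : (W.functorCategory J).Q ⋙ evalAt J W j ⟶ (W.functorCategory J).Q ⋙ evalAt J W j' :=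
    { app := fun F => W.Q.map (F.map φ)
      naturality := fun F G α => by
        refine (congrArg (fun k => k ≫ W.Q.map (G.map φ)) (evalAt_map_Q W α j)).trans (Eq.trans ?_
          (congrArg (fun k => W.Q.map (F.map φ) ≫ k) (evalAt_map_Q W α j')).symm)
        refine (W.Q.map_comp _ _).symm.trans (Eq.trans ?_ (W.Q.map_comp _ _))
        exact congrArg W.Q.map (α.naturality φ).symm }
  have h := (Localization.Construction.natTransExtension τ).naturality θ
  have h₁ := Localization.Construction.NatTransExtension.app_eq τ F
  have h₂ := Localization.Construction.NatTransExtension.app_eq τ G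
  exact ((congrArg (fun k => k ≫ _) h₁).symm.trans h.symm).trans (congrArg (fun k => _ ≫ k) h₂)

/-- The two functors agree on actual natural transformations, hence everywhere by uniqueness of
lifts from the localization. -/
lemma evalAt_precomp (W : MorphismProperty C) (K : J' ⥤ J) {F G : J ⥤ C}
    (θ : (W.functorCategory J).Q.obj F ⟶ (W.functorCategory J).Q.obj G) (j : J') :
    (evalAt J' W j).map ((precomp W K).map θ) = (evalAt J W (K.obj j)).map θ := by
  have h : precomp W K ⋙ evalAt J' W j = evalAt J W (K.obj j) := by
    refine Localization.Construction.uniq _ _ (CategoryTheory.Functor.ext (fun _ => rfl) fun F G α => ?_)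
    refine Eq.trans ?_ ((Category.id_comp _).trans (Category.comp_id _)).symm
    refine (congrArg (fun k => (evalAt J' W j).map k) (localizedMap_map_Q
      ((Functor.whiskeringLeft J' J C).obj K) (fun _ _ _ (hf : W.functorCategory J _) j => hf (K.obj j)) α)).trans ?_
    exact (evalAt_map_Q W _ j).trans (evalAt_map_Q W α (K.obj j)).symm
  exact (CategoryTheory.Functor.congr_hom h θ).trans ((Category.id_comp _).trans (Category.comp_id _))

end Evaluation

/-! ### A double mapping cylinder as a diagonal -/

section Diagonal

variable {D : Type u} [Category.{v} D] [HasFiniteCoproducts D] [HasTerminal D]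

/-- The bisimplicial object `(n, m) ↦ Cyl(F_m, G_m)_n`. -/
noncomputable abbrev biCyl {X Y Z : SimplicialObject D} (F : X ⟶ Y) (G : X ⟶ Z) :
    SimplicialObject (SimplicialObject D) :=
  Cyl ((SimplicialObject.const (SimplicialObject D)).map F)
    ((SimplicialObject.const (SimplicialObject D)).map G)

/-- The identification of `Y` with the diagonal of `Δ × Y`. -/
def toDiagonalConst (Y : SimplicialObject D) :
    Y ⟶ (diagonal D).obj ((SimplicialObject.const (SimplicialObject D)).obj Y) where
  app n := 𝟙 (Y.obj n)
  naturality n m α := by simp [diagonal]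

lemma toDiagonalConst_naturality {Y Y' : SimplicialObject D} (f : Y ⟶ Y') :
    toDiagonalConst Y ≫ (diagonal D).map ((SimplicialObject.const _).map f) =
      f ≫ toDiagonalConst Y' := by
  ext n
  exact (Category.id_comp _).trans (Category.comp_id _).symm

/-- The map from the cylinder of `X` to the diagonal of the cylinder of `Δ × X`. -/
noncomputable def toDiagonalCylinder (X : SimplicialObject D) :
    cylinder X ⟶
      (diagonal D).obj (cylinder ((SimplicialObject.const (SimplicialObject D)).obj X)) where
  app n := cylinderDesc fun θ =>
    (cylinderι ((SimplicialObject.const (SimplicialObject D)).obj X) θ).app n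
  naturality n m α := cylinder_hom_ext fun θ => by
    have h := congrArg (fun k => k.app n)
      (cylinderι_map ((SimplicialObject.const (SimplicialObject D)).obj X) α θ)
    have h' := (cylinderι ((SimplicialObject.const (SimplicialObject D)).obj X)
      (α.unop ≫ θ)).naturality α
    refine (cylinderι_map_assoc _ _ _ _).trans (Eq.trans ?_ (cylinderι_desc_assoc _ _ _).symm)
    refine (congrArg (fun k => X.map α ≫ k) (cylinderι_desc _ _)).trans (h'.trans ?_)
    exact (congrArg (fun k => k ≫ _) (h.trans (Category.id_comp _)).symm).trans
      (Category.assoc _ _ _)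

lemma cylinderFace_toDiagonalCylinder (i : Fin 2) (X : SimplicialObject D) :
    cylinderFace i X ≫ toDiagonalCylinder X =
      toDiagonalConst X ≫ (diagonal D).map (cylinderFace i _) := by
  ext n
  exact (cylinderι_desc _ _).trans (Category.id_comp _).symm

variable {X Y Z : SimplicialObject D} (F : X ⟶ Y) (G : X ⟶ Z)

/-- The identification of `Cyl(F, G)` with the diagonal of `biCyl F G`. -/
noncomputable def diagonalCyl : Cyl F G ⟶ (diagonal D).obj (biCyl F G) :=
  Cyl.desc (toDiagonalCylinder X ≫ (diagonal D).map (Cyl.inX _ _))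
    (toDiagonalConst Y ≫ (diagonal D).map (Cyl.inY _ _))
    (toDiagonalConst Z ≫ (diagonal D).map (Cyl.inZ _ _))
    (by
      rw [← Category.assoc, cylinderFace_toDiagonalCylinder, Category.assoc, ← Functor.map_comp,
        Cyl.face_zero, Functor.map_comp, ← Category.assoc, toDiagonalConst_naturality,
        Category.assoc])
    (by
      rw [← Category.assoc, cylinderFace_toDiagonalCylinder, Category.assoc, ← Functor.map_comp,
        Cyl.face_one, Functor.map_comp, ← Category.assoc, toDiagonalConst_naturality,
        Category.assoc])

lemma inX_diagonalCyl :
    Cyl.inX F G ≫ diagonalCyl F G = toDiagonalCylinder X ≫ (diagonal D).map (Cyl.inX _ _) :=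
  Cyl.inX_desc _ _ _ _ _

lemma inY_diagonalCyl :
    Cyl.inY F G ≫ diagonalCyl F G = toDiagonalConst Y ≫ (diagonal D).map (Cyl.inY _ _) :=
  Cyl.inY_desc _ _ _ _ _

lemma inZ_diagonalCyl :
    Cyl.inZ F G ≫ diagonalCyl F G = toDiagonalConst Z ≫ (diagonal D).map (Cyl.inZ _ _) :=
  Cyl.inZ_desc _ _ _ _ _

lemma diagonalCyl_naturality {X' Y' Z' : SimplicialObject D} {F : X ⟶ Y} {G : X ⟶ Z}
    {F' : X' ⟶ Y'} {G' : X' ⟶ Z'} (a : X ⟶ X') (b : Y ⟶ Y') (c : Z ⟶ Z') (hf : F ≫ b = a ≫ F')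
    (hg : G ≫ c = a ≫ G') :
    Cyl.map a b c hf hg ≫ diagonalCyl F' G' = diagonalCyl F G ≫ (diagonal D).map
      (Cyl.map ((SimplicialObject.const _).map a) ((SimplicialObject.const _).map b)
        ((SimplicialObject.const _).map c) (by rw [← Functor.map_comp, hf, Functor.map_comp])
        (by rw [← Functor.map_comp, hg, Functor.map_comp])) := by
  have hc : cylinderMap a ≫ toDiagonalCylinder X' = toDiagonalCylinder X ≫
      (diagonal D).map (cylinderMap ((SimplicialObject.const _).map a)) := by
    ext n
    refine cylinder_hom_ext fun θ => ?_
    refine (cylinderι_desc_assoc _ _ _).trans (Eq.trans ?_ (cylinderι_desc_assoc _ _ _).symm)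
    refine (Category.assoc _ _ _).trans ((congrArg (fun k => a.app n ≫ k)
      (cylinderι_desc _ _)).trans ?_)
    exact (congrArg (fun k => k.app n) (cylinderι_desc (X := (SimplicialObject.const _).obj X)
      (fun θ => ((SimplicialObject.const _).map a).app n ≫
        cylinderι ((SimplicialObject.const _).obj X') θ) θ)).symm
  refine Cyl.hom_ext ?_ ?_ ?_
  · rw [Cyl.inX_map_assoc, inX_diagonalCyl, ← Category.assoc, ← Category.assoc,
      inX_diagonalCyl, hc, Category.assoc, Category.assoc, ← Functor.map_comp, ← Functor.map_comp,
      Cyl.inX_map]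
  · rw [Cyl.inY_map_assoc, inY_diagonalCyl, ← Category.assoc, ← Category.assoc,
      inY_diagonalCyl, ← toDiagonalConst_naturality, Category.assoc, Category.assoc,
      ← Functor.map_comp, ← Functor.map_comp, Cyl.inY_map]
  · rw [Cyl.inZ_map_assoc, inZ_diagonalCyl, ← Category.assoc, ← Category.assoc,
      inZ_diagonalCyl, ← toDiagonalConst_naturality, Category.assoc, Category.assoc,
      ← Functor.map_comp, ← Functor.map_comp, Cyl.inZ_map]

instance evaluation_coprodComparison_isIso (n : SimplexCategoryᵒᵖ) (A B : SimplicialObject D) :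
    IsIso (coprodComparison ((evaluation SimplexCategoryᵒᵖ D).obj n :
      SimplicialObject D ⥤ D) A B) :=
  inferInstance

/-- In degree `n` this is the comparison for the functor of evaluation at `n`, which preserves
coproducts; `Cyl.app_mem` applies with the isomorphisms as the class. -/
instance diagonalCyl_isIso : IsIso (diagonalCyl F G) := by
  have : ∀ n, IsIso ((diagonalCyl F G).app n) := by
    intro n
    refine Cyl.app_mem (E := MorphismProperty.isomorphisms D)
      (f := (SimplicialObject.const (SimplicialObject D)).map F)
      (g := (SimplicialObject.const (SimplicialObject D)).map G) (fun _ => inferInstance)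
      (fun _ _ _ _ f g (_ : IsIso f) (_ : IsIso g) => (inferInstance : IsIso (coprod.map f g)))
      ((evaluation SimplexCategoryᵒᵖ D).obj n)
      (evaluation_coprodComparison_isIso n) n (𝟙 _) (𝟙 _) (𝟙 _)
      (inferInstance : IsIso (𝟙 _)) (inferInstance : IsIso (𝟙 _)) (inferInstance : IsIso (𝟙 _)) _
      ?_ ?_ ?_
    · intro θ
      refine (congrArg (fun k => cylinderι X θ ≫ k.app n) (inX_diagonalCyl F G)).trans ?_
      exact (cylinderι_desc_assoc _ _ _).trans (Category.id_comp _).symm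
    · exact congrArg (fun k => k.app n) (inY_diagonalCyl F G)
    · exact congrArg (fun k => k.app n) (inZ_diagonalCyl F G)
  exact NatIso.isIso_of_isIso_app _

end Diagonal

end SimplicialDescent

lemma SimplicialDescent.functor_map_comp₃ {C : Type u} [Category.{v} C] {C' : Type u'}
    [Category.{v'} C'] (F : C ⥤ C') {X Y Z T : C} (a : X ⟶ Y) (b : Y ⟶ Z) (c : Z ⟶ T) :
    F.map (a ≫ b ≫ c) = F.map a ≫ F.map b ≫ F.map c := by
  rw [F.map_comp, F.map_comp]

/-! ### The homotopy category, acyclic objects and the components of `μ` -/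

namespace SimplicialDescentStructure

open SimplicialDescent

variable {D : Type u} [Category.{v} D] [HasFiniteCoproducts D] [HasTerminal D]
  (S : SimplicialDescentStructure D)

/-- Saturation turns membership in `E` into invertibility in `Ho D`, from which two out of three is
inherited. -/
lemma E_eq_inverseImage : S.E = (MorphismProperty.isomorphisms _).inverseImage S.E.Q := by
  ext A B f
  exact S.mem_iff_isIso f

instance : S.E.HasTwoOutOfThreeProperty := by
  rw [E_eq_inverseImage]
  infer_instance

lemma isIso_map_Q {A B : D} {f : A ⟶ B} (hf : S.E f) : IsIso (S.E.Q.map f) :=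
  S.E.Q_inverts f hf

lemma mem_of_isIso {A B : D} (f : A ⟶ B) [IsIso f] : S.E f :=
  (S.mem_iff_isIso f).2 inferInstance

/-- Every morphism of `Ho D` to the final object of `D` is the trivial one. -/
lemma ho_comp_terminal {A B : D} (u : S.E.Q.obj A ⟶ S.E.Q.obj B) :
    u ≫ S.E.Q.map (terminal.from B) = S.E.Q.map (terminal.from A) := by
  -- The objects of `Ho D` are those of `D`, so the trivial map is defined on each of them. The
  -- morphisms compatible with it contain the image of `D` and are closed under composition and
  -- inverses, hence are all morphisms.
  let T : ∀ X : S.Ho, X ⟶ S.E.Q.obj (⊤_ D) := fun X => S.E.Q.map (terminal.from X.as.obj)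
  let P : MorphismProperty S.Ho := fun X Y u => u ≫ T Y = T X
  have : P.IsStableUnderComposition :=
    ⟨fun f g (hf : _ ≫ _ = _) (hg : _ ≫ _ = _) => by
      change (f ≫ g) ≫ _ = _
      rw [Category.assoc, hg, hf]⟩
  have h₁ : ∀ ⦃X Y : D⦄ (f : X ⟶ Y), P (S.E.Q.map f) := fun X Y f =>
    (S.E.Q.map_comp _ _).symm.trans (congrArg S.E.Q.map (Subsingleton.elim _ _))
  have h := Localization.Construction.morphismProperty_eq_top' P h₁
    (fun X Y e (he : e.hom ≫ T Y = T X) => (by rw [← he, Iso.inv_hom_id_assoc] :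
      e.inv ≫ T X = T Y))
  have : P u := by rw [h]; trivial
  exact this

/-- The trivial endomorphism of `∗` is the identity, so `ho_comp_terminal` makes every map to `∗`
trivial: `∗` stays final in `Ho D`. -/
lemma ho_terminal_hom_ext {A : D} (u v : S.E.Q.obj A ⟶ S.E.Q.obj (⊤_ D)) : u = v := by
  have h : S.E.Q.map (terminal.from (⊤_ D)) = 𝟙 _ := by
    rw [← S.E.Q.map_id]
    exact congrArg S.E.Q.map (Subsingleton.elim _ _)
  rw [← Category.comp_id u, ← Category.comp_id v, ← h, ho_comp_terminal, ho_comp_terminal]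

/-- An object is acyclic if the map to the final object is an equivalence. -/
def Acyclic (A : D) : Prop := S.E (terminal.from A)

variable {S} in
lemma Acyclic.hom_ext {A B : D} (hB : S.Acyclic B) (u v : S.E.Q.obj A ⟶ S.E.Q.obj B) : u = v := by
  have := S.isIso_map_Q hB
  rw [← cancel_mono (S.E.Q.map (terminal.from B))]
  exact S.ho_terminal_hom_ext _ _

variable {S} in
lemma Acyclic.of_isIso {A B : D} (hB : S.Acyclic B) (u : S.E.Q.obj A ⟶ S.E.Q.obj B) [IsIso u] :
    S.Acyclic A := by
  have := S.isIso_map_Q hB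
  refine S.saturated _ ?_
  rw [← S.ho_comp_terminal u]
  infer_instance

lemma acyclic_iff_of_mem {A B : D} {f : A ⟶ B} (hf : S.E f) : S.Acyclic A ↔ S.Acyclic B := by
  have := S.isIso_map_Q hf
  exact ⟨fun h => h.of_isIso (inv (S.E.Q.map f)), fun h => h.of_isIso (S.E.Q.map f)⟩

lemma mem_of_acyclic {A B : D} (hA : S.Acyclic A) (hB : S.Acyclic B) (f : A ⟶ B) : S.E f := by
  refine S.E.of_postcomp f (terminal.from B) hB ?_
  rw [Subsingleton.elim (f ≫ _) (terminal.from A)]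
  exact hA

/-- The simple of the point is `R(∗)`, and its map to `∗` can only be `λ`. -/
lemma acyclic_point : S.Acyclic (S.s.obj (point D)) := by
  have h : (terminal.from (S.s.obj (point D))) = S.lam.app (⊤_ D) := Subsingleton.elim _ _
  exact Eq.subst (motive := fun k : S.s.obj (point D) ⟶ ⊤_ D => S.E k) h.symm (S.lam_mem (⊤_ D))

lemma rho_app_lam_app (A : D) : S.rho.app A ≫ S.lam.app A = 𝟙 A :=
  congrArg (fun k => k.app A) S.rho_lam

lemma rho_mem (A : D) : S.E (S.rho.app A) := by
  refine S.E.of_postcomp _ (S.lam.app A) (S.lam_mem A) ?_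
  rw [S.rho_app_lam_app]
  exact S.id_mem A

/-- The component of `μ` at a bisimplicial object. -/
noncomputable def μApp (Z : SimplicialObject (SimplicialObject D)) :
    S.E.Q.obj (S.s.obj ((diagonal D).obj Z)) ≅
      S.E.Q.obj (S.s.obj ((simplicialExt S.s).obj Z)) :=
  (evalAt _ S.E Z).mapIso S.μ

lemma μApp_naturality {Z Z' : SimplicialObject (SimplicialObject D)} (φ : Z ⟶ Z') :
    S.E.Q.map (S.s.map ((diagonal D).map φ)) ≫ (S.μApp Z').hom =
      (S.μApp Z).hom ≫ S.E.Q.map (S.s.map ((simplicialExt S.s).map φ)) :=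
  evalAt_naturality S.E S.μ.hom φ

/-- The morphism `s(Δ × X) ⟶ R(sX)` which is the identity in each degree, followed by `λ`. -/
lemma mu_left (X : SimplicialObject D) :
    S.E.Q.map ((toDiagonalLeft S.s).app X) ≫ (S.μApp ((constLeft D).obj X)).hom ≫
      S.E.Q.map ((lamLeft S.lam).app X) = 𝟙 _ := by
  let ev := evalAt _ S.E X
  have h := congrArg (fun k => ev.map k) S.mu_lam_left
  have h₁ := evalAt_map_Q S.E (toDiagonalLeft S.s) X
  have h₂ := evalAt_map_Q S.E (lamLeft S.lam) X
  have h₃ := evalAt_precomp S.E (constLeft D) S.μ.hom X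
  have h₄ := functor_map_comp₃ ev ((S.E.functorCategory _).Q.map (toDiagonalLeft S.s))
    ((precomp S.E (constLeft D)).map S.μ.hom) ((S.E.functorCategory _).Q.map (lamLeft S.lam))
  refine Eq.trans ?_ (h₄.symm.trans (h.trans (ev.map_id _)))
  exact (congr (congrArg (fun a b => a ≫ b) h₁) (congr (congrArg (fun a b => a ≫ b) h₃) h₂)).symm

lemma mu_right (X : SimplicialObject D) :
    S.E.Q.map ((toDiagonalRight S.s).app X) ≫ (S.μApp ((constRight D).obj X)).hom ≫
      S.E.Q.map ((lamRight S.lam).app X) = 𝟙 _ := by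
  let ev := evalAt _ S.E X
  have h := congrArg (fun k => ev.map k) S.mu_lam_right
  have h₁ := evalAt_map_Q S.E (toDiagonalRight S.s) X
  have h₂ := evalAt_map_Q S.E (lamRight S.lam) X
  have h₃ := evalAt_precomp S.E (constRight D) S.μ.hom X
  have h₄ := functor_map_comp₃ ev ((S.E.functorCategory _).Q.map (toDiagonalRight S.s))
    ((precomp S.E (constRight D)).map S.μ.hom) ((S.E.functorCategory _).Q.map (lamRight S.lam))
  refine Eq.trans ?_ (h₄.symm.trans (h.trans (ev.map_id _)))
  exact (congr (congrArg (fun a b => a ≫ b) h₁) (congr (congrArg (fun a b => a ≫ b) h₃) h₂)).symm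

/-- If all rows of a map of bisimplicial objects become equivalences, so does its diagonal. -/
lemma diagonal_mem {Z Z' : SimplicialObject (SimplicialObject D)} (φ : Z ⟶ Z')
    (h : ∀ n, S.E (S.s.map (φ.app n))) : S.E (S.s.map ((diagonal D).map φ)) := by
  have h₁ : S.E (S.s.map ((simplicialExt S.s).map φ)) := S.s_mem _ h
  have := S.isIso_map_Q h₁
  refine S.saturated _ ?_
  have h₂ := S.μApp_naturality φ
  rw [← Iso.eq_comp_inv] at h₂
  rw [h₂]
  infer_instance

/-- If all columns of a map of bisimplicial objects become equivalences, so does its diagonal. -/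
lemma diagonal_mem' {Z Z' : SimplicialObject (SimplicialObject D)} (φ : Z ⟶ Z')
    (h : ∀ m, S.E (S.s.map ((simplicialExt ((evaluation SimplexCategoryᵒᵖ D).obj m)).map φ))) :
    S.E (S.s.map ((diagonal D).map φ)) := by
  -- Transposition exchanges rows and columns and does not change the diagonal, since horizontal and
  -- vertical operators commute.
  let fl : SimplicialObject (SimplicialObject D) ⥤ SimplicialObject (SimplicialObject D) :=
    flipFunctor _ _ _
  have e : ∀ Z : SimplicialObject (SimplicialObject D),
      ∃ i : (diagonal D).obj (fl.obj Z) ≅ (diagonal D).obj Z, ∀ n, i.hom.app n = 𝟙 _ := fun Z =>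
    ⟨NatIso.ofComponents (fun n => Iso.refl _) (fun {n m} α => by
      refine (Category.comp_id _).trans (Eq.trans ?_ (Category.id_comp _).symm)
      exact (Z.map α).naturality α), fun n => rfl⟩
  obtain ⟨i, hi⟩ := e Z
  obtain ⟨i', hi'⟩ := e Z'
  have hh : S.E (S.s.map ((diagonal D).map (fl.map φ))) := S.diagonal_mem (fl.map φ) h
  have w : (diagonal D).map (fl.map φ) ≫ i'.hom = i.hom ≫ (diagonal D).map φ := by
    ext n
    rw [NatTrans.comp_app, NatTrans.comp_app, hi, hi']
    exact (Category.comp_id _).trans (Category.id_comp _).symm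
  refine (S.E.arrow_mk_iso_iff (Arrow.isoMk (S.s.mapIso i) (S.s.mapIso i') ?_)).1 hh
  change S.s.map _ ≫ S.s.map _ = S.s.map _ ≫ S.s.map _
  rw [← S.s.map_comp, ← S.s.map_comp, w]

end SimplicialDescentStructure

/-! ### Commutation of the simple functor with double mapping cylinders -/

namespace SimplicialDescentStructure

open SimplicialDescent

variable {D : Type u} [Category.{v} D] [HasFiniteCoproducts D] [HasTerminal D]
  (S : SimplicialDescentStructure D)

lemma constCylComparison_mem {X Y Z : SimplicialObject D} (F : X ⟶ Y) (G : X ⟶ Z) :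
    S.E (S.s.map (constCylComparison S.s F G)) :=
  S.s_mem _ fun n => constCylComparison_app_mem S.s S.id_mem S.coprod_mem S.s_coprod F G n

/-- The commutation of the simple functor with double mapping cylinders. -/
noncomputable def simpleCylIso {X Y Z : SimplicialObject D} (F : X ⟶ Y) (G : X ⟶ Z) :
    S.E.Q.obj (S.s.obj (Cyl F G)) ≅ S.E.Q.obj (S.s.obj
      (Cyl ((SimplicialObject.const D).map (S.s.map F))
        ((SimplicialObject.const D).map (S.s.map G)))) :=
  S.E.Q.mapIso (S.s.mapIso (asIso (diagonalCyl F G))) ≪≫ S.μApp (biCyl F G) ≪≫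
    (Localization.Construction.wIso _ (S.constCylComparison_mem F G)).symm

lemma simpleCylIso_hom_comp {X Y Z : SimplicialObject D} (F : X ⟶ Y) (G : X ⟶ Z) :
    (S.simpleCylIso F G).hom ≫ S.E.Q.map (S.s.map (constCylComparison S.s F G)) =
      S.E.Q.map (S.s.map (diagonalCyl F G)) ≫ (S.μApp (biCyl F G)).hom := by
  rw [simpleCylIso, Iso.trans_hom, Iso.trans_hom, Iso.symm_hom, Category.assoc, Category.assoc]
  have h : (Localization.Construction.wIso _ (S.constCylComparison_mem F G)).inv ≫
      S.E.Q.map (S.s.map (constCylComparison S.s F G)) = 𝟙 _ :=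
    (Localization.Construction.wIso _ (S.constCylComparison_mem F G)).inv_hom_id
  rw [h, Category.comp_id]
  rfl

/-- Two maps to the target of `simpleCylIso` agree if they agree after comparison. -/
lemma eq_of_comp_constCylComparison {X Y Z : SimplicialObject D} (F : X ⟶ Y) (G : X ⟶ Z)
    {A : S.Ho} {p q : A ⟶ S.E.Q.obj (S.s.obj (Cyl ((SimplicialObject.const D).map (S.s.map F))
        ((SimplicialObject.const D).map (S.s.map G))))}
    (h : p ≫ S.E.Q.map (S.s.map (constCylComparison S.s F G)) =
      q ≫ S.E.Q.map (S.s.map (constCylComparison S.s F G))) : p = q := by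
  have := S.isIso_map_Q (S.constCylComparison_mem F G)
  exact (cancel_mono _).1 h

section

variable {X Y Z X' Y' Z' : SimplicialObject D} {F : X ⟶ Y} {G : X ⟶ Z} {F' : X' ⟶ Y'}
  {G' : X' ⟶ Z'} (a : X ⟶ X') (b : Y ⟶ Y') (c : Z ⟶ Z') (hf : F ≫ b = a ≫ F')
  (hg : G ≫ c = a ≫ G')

include hf in
lemma const_simple_sq :
    (SimplicialObject.const D).map (S.s.map F) ≫ (SimplicialObject.const D).map (S.s.map b) =
      (SimplicialObject.const D).map (S.s.map a) ≫ (SimplicialObject.const D).map (S.s.map F') := by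
  rw [← Functor.map_comp, ← Functor.map_comp, ← Functor.map_comp, ← Functor.map_comp, hf]

lemma simpleCylIso_naturality :
    S.E.Q.map (S.s.map (Cyl.map a b c hf hg)) ≫ (S.simpleCylIso F' G').hom =
      (S.simpleCylIso F G).hom ≫ S.E.Q.map (S.s.map
        (Cyl.map ((SimplicialObject.const D).map (S.s.map a))
          ((SimplicialObject.const D).map (S.s.map b)) ((SimplicialObject.const D).map (S.s.map c))
          (S.const_simple_sq a b hf) (S.const_simple_sq a c hg))) := by
  refine S.eq_of_comp_constCylComparison F' G' ?_
  have h₁ := S.simpleCylIso_hom_comp F' G'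
  have h₂ := S.simpleCylIso_hom_comp F G
  rw [Category.assoc, h₁, ← Category.assoc, ← S.E.Q.map_comp, ← S.s.map_comp,
    diagonalCyl_naturality, S.s.map_comp, S.E.Q.map_comp, Category.assoc, S.μApp_naturality,
    ← Category.assoc, ← h₂, Category.assoc, Category.assoc, ← S.E.Q.map_comp, ← S.s.map_comp,
    constCylComparison_naturality S.s a b c hf hg, S.s.map_comp, S.E.Q.map_comp]

end

/-- By `mu_left` the left side is a section of `lamLeft`; the right side is another one because `ρ`
is a section of `λ`. As `lamLeft` is invertible in `Ho D`, the two agree. -/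
lemma toDiagonalConst_mu (Y : SimplicialObject D) :
    S.E.Q.map (S.s.map (toDiagonalConst Y)) ≫
      (S.μApp ((SimplicialObject.const (SimplicialObject D)).obj Y)).hom =
      S.E.Q.map (S.rho.app (S.s.obj Y)) ≫ S.E.Q.map (S.s.map (constExt S.s Y)) := by
  have h := S.mu_left Y
  have e : (S.rho.app (S.s.obj Y) ≫ S.s.map (constExt S.s Y)) ≫ (lamLeft S.lam).app Y =
      𝟙 (S.s.obj Y) := by
    have h₁ : constExt S.s Y ≫ (Functor.constComp _ Y S.s).hom = 𝟙 _ := by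
      ext n
      exact Category.comp_id _
    have h₂ : S.s.map (constExt S.s Y) ≫ (lamLeft S.lam).app Y = S.lam.app (S.s.obj Y) := by
      refine (Category.assoc _ _ _).symm.trans ?_
      refine (congrArg (fun k => k ≫ S.lam.app (S.s.obj Y))
        ((S.s.map_comp _ _).symm.trans (congrArg S.s.map h₁))).trans ?_
      refine (congrArg (fun k => k ≫ S.lam.app (S.s.obj Y)) (S.s.map_id _)).trans
        (Category.id_comp _)
    exact (Category.assoc _ _ _).trans ((congrArg (fun k => S.rho.app (S.s.obj Y) ≫ k) h₂).trans
      (S.rho_app_lam_app _))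
  have hl : S.E ((lamLeft S.lam).app Y) := by
    refine S.E.comp_mem _ _ (S.s_mem _ fun n => S.id_mem _) (S.lam_mem _)
  have := S.isIso_map_Q hl
  refine (cancel_mono (S.E.Q.map ((lamLeft S.lam).app Y))).1 ?_
  rw [← S.E.Q.map_comp]
  refine ((Category.assoc _ _ _).trans h).trans ?_
  refine ((S.E.Q.map_id _).symm.trans (congrArg S.E.Q.map e.symm)).trans (S.E.Q.map_comp _ _)

/-- On the corner `Y` the isomorphism reduces to `toDiagonalConst_mu`, hence to `ρ`. This matches
the factor `ρ` in `coneIncl`. -/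
lemma inY_simpleCylIso {X Y Z : SimplicialObject D} (F : X ⟶ Y) (G : X ⟶ Z) :
    S.E.Q.map (S.s.map (Cyl.inY F G)) ≫ (S.simpleCylIso F G).hom =
      S.E.Q.map (S.rho.app (S.s.obj Y) ≫ S.s.map (Cyl.inY _ _)) := by
  refine S.eq_of_comp_constCylComparison F G ?_
  rw [Category.assoc, simpleCylIso_hom_comp, ← Category.assoc, ← S.E.Q.map_comp, ← S.s.map_comp,
    inY_diagonalCyl, S.s.map_comp, S.E.Q.map_comp, Category.assoc, S.μApp_naturality,
    ← Category.assoc, toDiagonalConst_mu, Category.assoc]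
  have h : constExt S.s Y ≫ (simplicialExt S.s).map
      (Cyl.inY ((SimplicialObject.const (SimplicialObject D)).map F)
        ((SimplicialObject.const (SimplicialObject D)).map G)) =
      Cyl.inY _ _ ≫ constCylComparison S.s F G := by
    ext n
    exact (Category.id_comp _).trans (constCylComparison_inY_app S.s F G n).symm
  rw [← S.E.Q.map_comp, ← S.s.map_comp, h, ← S.E.Q.map_comp, ← S.E.Q.map_comp, S.s.map_comp,
    Category.assoc]

/-! ### The comparison for constant simplicial objects -/

section Const

variable {A B C : D} (f : A ⟶ B) (g : A ⟶ C)

/-- Here `biCyl` does not depend on its second index, and the comparison for the functor `const`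
maps it to `constRight` of the cylinder. The right side is the map underlying `toDiagonalRight`,
written out so that `mu_right` can be applied. -/
lemma diagonalCyl_const :
    diagonalCyl ((SimplicialObject.const D).map f) ((SimplicialObject.const D).map g) ≫
      (diagonal D).map (constCylComparison (SimplicialObject.const D) f g) =
    { app n := 𝟙 ((Cyl ((SimplicialObject.const D).map f)
        ((SimplicialObject.const D).map g)).obj n)
      naturality _ _ _ := (Category.comp_id _).trans ((Category.id_comp _).trans
        (Category.comp_id _)).symm } := by
  refine NatTrans.ext (funext fun n => ?_)
  refine Cyl.app_hom_ext (f := (SimplicialObject.const D).map f)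
    (g := (SimplicialObject.const D).map g) (fun θ => ?_) ?_ ?_
  · refine Eq.trans ?_ ((congrArg (fun k => cylinderι _ θ ≫ k) (Category.comp_id _)).symm)
    have h₁ := congrArg (fun k => cylinderι ((SimplicialObject.const D).obj A) θ ≫ k.app n)
      (inX_diagonalCyl ((SimplicialObject.const D).map f) ((SimplicialObject.const D).map g))
    have h₂ := congrArg (fun k => k.app n)
      (constCylComparison_inX_app (SimplicialObject.const D) f g n θ)
    refine Eq.trans ?_ h₂
    refine ((congrArg (fun k => cylinderι ((SimplicialObject.const D).obj A) θ ≫ k)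
      (Category.assoc _ _ _)).symm.trans (Category.assoc _ _ _).symm).trans ?_
    refine (congrArg (fun k => k ≫ _) h₁).trans ?_
    refine (congrArg (fun k => k ≫ _) (cylinderι_desc_assoc _ _ _)).trans ?_
    exact Category.assoc _ _ _
  · refine Eq.trans ?_ (Category.comp_id _).symm
    have h₁ := congrArg (fun k => k.app n)
      (inY_diagonalCyl ((SimplicialObject.const D).map f) ((SimplicialObject.const D).map g))
    have h₂ := congrArg (fun k => k.app n)
      (constCylComparison_inY_app (SimplicialObject.const D) f g n)
    refine Eq.trans ?_ h₂
    refine (Category.assoc _ _ _).symm.trans ?_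
    refine (congrArg (fun k => k ≫ _) (h₁.trans (Category.id_comp _)))
  · refine Eq.trans ?_ (Category.comp_id _).symm
    have h₁ := congrArg (fun k => k.app n)
      (inZ_diagonalCyl ((SimplicialObject.const D).map f) ((SimplicialObject.const D).map g))
    have h₂ := congrArg (fun k => k.app n)
      (constCylComparison_inZ_app (SimplicialObject.const D) f g n)
    refine Eq.trans ?_ h₂
    refine (Category.assoc _ _ _).symm.trans ?_
    refine (congrArg (fun k => k ≫ _) (h₁.trans (Category.id_comp _)))

lemma lam_sq : S.s.map ((SimplicialObject.const D).map f) ≫ S.lam.app B = S.lam.app A ≫ f :=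
  S.lam.naturality f

lemma const_lam_sq :
    (SimplicialObject.const D).map (S.s.map ((SimplicialObject.const D).map f)) ≫
        (SimplicialObject.const D).map (S.lam.app B) =
      (SimplicialObject.const D).map (S.lam.app A) ≫ (SimplicialObject.const D).map f := by
  rw [← Functor.map_comp, ← Functor.map_comp]
  exact congrArg _ (S.lam_sq f)

/-- The map `(λ_{X_n})_n` from `n ↦ R(X_n)` to `X`. -/
def lamLevelwise (X : SimplicialObject D) :
    (simplicialExt S.s).obj ((constRight D).obj X) ⟶ X where
  app n := S.lam.app (X.obj n)
  naturality _ _ α := S.lam.naturality (X.map α)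

/-- This is naturality of `λ` along the inclusion of each summand. It rewrites the factor `s(λ)` of
`mu_right` as a map of cylinders. -/
lemma constCylComparison_lamLevelwise :
    constCylComparison S.s ((SimplicialObject.const D).map f) ((SimplicialObject.const D).map g) ≫
      (simplicialExt S.s).map (constCylComparison (SimplicialObject.const D) f g) ≫
        S.lamLevelwise _ =
    Cyl.map ((SimplicialObject.const D).map (S.lam.app A))
      ((SimplicialObject.const D).map (S.lam.app B)) ((SimplicialObject.const D).map (S.lam.app C))
      (S.const_lam_sq f) (S.const_lam_sq g) := by
  refine NatTrans.ext (funext fun n => ?_)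
  refine Cyl.app_hom_ext
    (f := (SimplicialObject.const D).map (S.s.map ((SimplicialObject.const D).map f)))
    (g := (SimplicialObject.const D).map (S.s.map ((SimplicialObject.const D).map g)))
    (fun θ => ?_) ?_ ?_
  · have h₁ := constCylComparison_inX_app S.s ((SimplicialObject.const D).map f)
      ((SimplicialObject.const D).map g) n θ
    have h₂ := constCylComparison_inX_app (SimplicialObject.const D) f g n θ
    have h₃ := Cyl.inX_map_app ((SimplicialObject.const D).map (S.lam.app A))
      ((SimplicialObject.const D).map (S.lam.app B)) ((SimplicialObject.const D).map (S.lam.app C))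
      (S.const_lam_sq f) (S.const_lam_sq g) θ
    refine Eq.trans ?_ h₃.symm
    refine ((congrArg (fun k => cylinderι _ θ ≫ k) (Category.assoc _ _ _)).symm.trans
      (Category.assoc _ _ _).symm).trans ((congrArg (fun k => k ≫ _) h₁).trans ?_)
    refine (Category.assoc _ _ _).symm.trans ?_
    refine (congrArg (fun k => k ≫ S.lam.app _)
      ((S.s.map_comp _ _).symm.trans (congrArg S.s.map ((Category.assoc _ _ _).trans h₂)))).trans ?_
    exact S.lam_sq _
  · have h₁ := constCylComparison_inY_app S.s ((SimplicialObject.const D).map f)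
      ((SimplicialObject.const D).map g) n
    have h₂ := constCylComparison_inY_app (SimplicialObject.const D) f g n
    have h₃ := Cyl.inY_map_app ((SimplicialObject.const D).map (S.lam.app A))
      ((SimplicialObject.const D).map (S.lam.app B)) ((SimplicialObject.const D).map (S.lam.app C))
      (S.const_lam_sq f) (S.const_lam_sq g) n
    refine Eq.trans ?_ h₃.symm
    refine (Category.assoc _ _ _).symm.trans ((congrArg (fun k => k ≫ _) h₁).trans ?_)
    refine (Category.assoc _ _ _).symm.trans ?_
    refine (congrArg (fun k => k ≫ _)
      ((S.s.map_comp _ _).symm.trans (congrArg S.s.map h₂))).trans ?_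
    exact S.lam_sq _
  · have h₁ := constCylComparison_inZ_app S.s ((SimplicialObject.const D).map f)
      ((SimplicialObject.const D).map g) n
    have h₂ := constCylComparison_inZ_app (SimplicialObject.const D) f g n
    have h₃ := Cyl.inZ_map_app ((SimplicialObject.const D).map (S.lam.app A))
      ((SimplicialObject.const D).map (S.lam.app B)) ((SimplicialObject.const D).map (S.lam.app C))
      (S.const_lam_sq f) (S.const_lam_sq g) n
    refine Eq.trans ?_ h₃.symm
    refine (Category.assoc _ _ _).symm.trans ((congrArg (fun k => k ≫ _) h₁).trans ?_)
    refine (Category.assoc _ _ _).symm.trans ?_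
    refine (congrArg (fun k => k ≫ _)
      ((S.s.map_comp _ _).symm.trans (congrArg S.s.map h₂))).trans ?_
    exact S.lam_sq _

/-- For constant simplicial objects the comparison `simpleCylIso` is inverse to the map induced
by `λ`. -/
lemma simpleCylIso_const :
    (S.simpleCylIso ((SimplicialObject.const D).map f) ((SimplicialObject.const D).map g)).hom ≫
      S.E.Q.map (S.s.map (Cyl.map ((SimplicialObject.const D).map (S.lam.app A))
        ((SimplicialObject.const D).map (S.lam.app B))
        ((SimplicialObject.const D).map (S.lam.app C)) (S.const_lam_sq f) (S.const_lam_sq g))) =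
    𝟙 _ := by
  rw [← constCylComparison_lamLevelwise, S.s.map_comp, S.E.Q.map_comp, ← Category.assoc,
    simpleCylIso_hom_comp]
  refine Eq.trans (congrArg (fun k => _ ≫ k) ((congrArg S.E.Q.map (S.s.map_comp _ _)).trans
    (S.E.Q.map_comp _ _))) ?_
  have h := S.μApp_naturality (constCylComparison (SimplicialObject.const D) f g)
  have h' := S.mu_right (Cyl ((SimplicialObject.const D).map f) ((SimplicialObject.const D).map g))
  refine Eq.trans ?_ h'
  refine (Category.assoc _ _ _).trans ((congrArg (fun k => S.E.Q.map (S.s.map (diagonalCyl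
    ((SimplicialObject.const D).map f) ((SimplicialObject.const D).map g))) ≫ k)
    (((Category.assoc _ _ _).symm.trans (congrArg (fun k => k ≫ _) h.symm)).trans
      (Category.assoc _ _ _))).trans ?_)
  refine (Category.assoc _ _ _).symm.trans ?_
  refine congrArg (fun k => k ≫ _) ?_
  refine (S.E.Q.map_comp _ _).symm.trans (congrArg S.E.Q.map ?_)
  exact (S.s.map_comp _ _).symm.trans (congrArg S.s.map (diagonalCyl_const f g))

end Const

/-! ### Homotopy invariance of the simple of a cylinder -/

section Invariance

variable {X Y Z X' Y' Z' : SimplicialObject D} {F : X ⟶ Y} {G : X ⟶ Z} {F' : X' ⟶ Y'}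
  {G' : X' ⟶ Z'} (a : X ⟶ X') (b : Y ⟶ Y') (c : Z ⟶ Z') (hf : F ≫ b = a ≫ F')
  (hg : G ≫ c = a ≫ G')

/-- The simple of a map of double mapping cylinders is an equivalence if the simples of the maps
on the three corners are. -/
lemma simple_cylMap_mem (ha : S.E (S.s.map a)) (hb : S.E (S.s.map b)) (hc : S.E (S.s.map c)) :
    S.E (S.s.map (Cyl.map a b c hf hg)) := by
  -- Past `simpleCylIso` the corners are constant at the simples, so the map is an equivalence in
  -- every degree.
  have h : S.E (S.s.map (Cyl.map ((SimplicialObject.const D).map (S.s.map a))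
          ((SimplicialObject.const D).map (S.s.map b)) ((SimplicialObject.const D).map (S.s.map c))
          (S.const_simple_sq a b hf) (S.const_simple_sq a c hg))) :=
    S.s_mem _ fun n => cylMap_app_mem S.coprod_mem S.id_mem _ _ _ _ _ n ha hb hc
  have := S.isIso_map_Q h
  refine S.saturated _ ?_
  have h₂ := S.simpleCylIso_naturality a b c hf hg
  rw [← Iso.eq_comp_inv] at h₂
  rw [h₂]
  infer_instance

/-- The simple of a map of double mapping cylinders is an equivalence if it is so for the constant
simplicial objects at each level. -/
lemma simple_cylMap_mem_of_levels
    (h : ∀ m, S.E (S.s.map (Cyl.map (f := (SimplicialObject.const D).map (F.app m))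
      (g := (SimplicialObject.const D).map (G.app m))
      (f' := (SimplicialObject.const D).map (F'.app m))
      (g' := (SimplicialObject.const D).map (G'.app m))
      ((SimplicialObject.const D).map (a.app m)) ((SimplicialObject.const D).map (b.app m))
      ((SimplicialObject.const D).map (c.app m))
      (by rw [← Functor.map_comp, ← Functor.map_comp, ← NatTrans.comp_app, hf, NatTrans.comp_app])
      (by rw [← Functor.map_comp, ← Functor.map_comp, ← NatTrans.comp_app, hg,
        NatTrans.comp_app])))) :
    S.E (S.s.map (Cyl.map a b c hf hg)) := by
  let φ : biCyl F G ⟶ biCyl F' G' := Cyl.map ((SimplicialObject.const _).map a)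
    ((SimplicialObject.const _).map b) ((SimplicialObject.const _).map c)
    (by rw [← Functor.map_comp, hf, Functor.map_comp])
    (by rw [← Functor.map_comp, hg, Functor.map_comp])
  have hφ : S.E (S.s.map ((diagonal D).map φ)) := by
    refine S.diagonal_mem' φ fun m => ?_
    -- Column `m` of `biCyl` is the double mapping cylinder of the constant objects at `F_m` and
    -- `G_m`, because evaluation at `m` preserves coproducts.
    let ev : SimplicialObject D ⥤ D := (evaluation SimplexCategoryᵒᵖ D).obj m
    have hm : ∀ {X Y Z : SimplicialObject D} (F : X ⟶ Y) (G : X ⟶ Z),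
        S.E (S.s.map (constCylComparison ev F G)) := fun F G =>
      S.s_mem _ fun n => by
        have : IsIso ((constCylComparison ev F G).app n) := constCylComparison_app_mem ev
          (E := MorphismProperty.isomorphisms D) (fun _ => inferInstance)
          (fun _ _ _ _ f g (_ : IsIso f) (_ : IsIso g) => (inferInstance : IsIso (coprod.map f g)))
          (evaluation_coprodComparison_isIso m) F G n
        exact S.mem_of_isIso _
    have sq := constCylComparison_naturality ev a b c hf hg
    have key := S.E.comp_mem _ _ (h m) (hm F' G')
    have key' := congrArg S.s.map sq
    rw [S.s.map_comp, S.s.map_comp] at key'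
    refine S.E.of_precomp _ _ (hm F G) ?_
    exact Eq.subst (motive := fun k => S.E k) key'.symm key
  have key := congrArg S.s.map (diagonalCyl_naturality a b c hf hg)
  rw [S.s.map_comp, S.s.map_comp] at key
  refine S.E.of_postcomp _ (S.s.map (diagonalCyl F' G')) (S.mem_of_isIso _) ?_
  rw [key]
  exact S.E.comp_mem _ _ (S.mem_of_isIso _) hφ

end Invariance

end SimplicialDescentStructure

namespace SimplicialDescentStructure

open SimplicialDescent

variable {D : Type u} [Category.{v} D] [HasFiniteCoproducts D] [HasTerminal D]
  (S : SimplicialDescentStructure D)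

/-! ### Cones of simplicial maps -/

section Cone

/-- The replacement of the simple of the point by the final object in a cone. -/
noncomputable def coneCorner {A B T : D} (f : A ⟶ B) (g : A ⟶ T) :
    Cyl ((SimplicialObject.const D).map f) ((SimplicialObject.const D).map g) ⟶
      simplicialCone ((SimplicialObject.const D).map f) :=
  Cyl.map (𝟙 _) (𝟙 _) (toPoint _) (by simp) (point_hom_ext _ _)

lemma coneCorner_mem {A B T : D} (f : A ⟶ B) (g : A ⟶ T) (hT : S.Acyclic T) :
    S.E (S.s.map (coneCorner f g)) :=
  S.s_mem _ fun n => cylMap_app_mem S.coprod_mem S.id_mem _ _ _ _ _ n (S.id_mem _) (S.id_mem _) hT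

variable {X Y : SimplicialObject D} (F : X ⟶ Y)

/-- The commutation of the simple functor with cones. -/
noncomputable def simpleConeIso :
    S.E.Q.obj (S.s.obj (simplicialCone F)) ≅ S.E.Q.obj (S.cone (S.s.map F)) :=
  S.simpleCylIso F (toPoint X) ≪≫ Localization.Construction.wIso _
    (S.coneCorner_mem (S.s.map F) (S.s.map (toPoint X)) S.acyclic_point)

lemma simpleConeIso_hom : (S.simpleConeIso F).hom = (S.simpleCylIso F (toPoint X)).hom ≫
    S.E.Q.map (S.s.map (coneCorner (S.s.map F) (S.s.map (toPoint X)))) := rfl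

lemma inY_simpleConeIso :
    S.E.Q.map (S.s.map (Cyl.inY F (toPoint X))) ≫ (S.simpleConeIso F).hom =
      S.E.Q.map (S.coneIncl (S.s.map F)) := by
  rw [simpleConeIso_hom, ← Category.assoc, inY_simpleCylIso, ← S.E.Q.map_comp, Category.assoc,
    ← S.s.map_comp]
  have h : Cyl.inY ((SimplicialObject.const D).map (S.s.map F))
      ((SimplicialObject.const D).map (S.s.map (toPoint X))) ≫
      coneCorner (S.s.map F) (S.s.map (toPoint X)) = Cyl.inY _ _ :=
    (Cyl.inY_map _ _ _ _ _).trans (Category.id_comp _)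
  rw [h]
  rfl

variable {F}

/-- Functoriality of the cone of morphisms of `D`. -/
noncomputable def coneMap {A B A' B' : D} {f : A ⟶ B} {f' : A' ⟶ B'} (a : A ⟶ A') (b : B ⟶ B')
    (h : f ≫ b = a ≫ f') : S.cone f ⟶ S.cone f' :=
  S.s.map (simplicialConeMap ((SimplicialObject.const D).map a) ((SimplicialObject.const D).map b)
    (by rw [← Functor.map_comp, h, Functor.map_comp]))

lemma simple_sq {X Y X' Y' : SimplicialObject D} {F : X ⟶ Y} {F' : X' ⟶ Y'} {a : X ⟶ X'}
    {b : Y ⟶ Y'} (h : F ≫ b = a ≫ F') :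
    S.s.map F ≫ S.s.map b = S.s.map a ≫ S.s.map F' := by
  rw [← S.s.map_comp, h, S.s.map_comp]

lemma simpleConeIso_naturality {X' Y' : SimplicialObject D} {F' : X' ⟶ Y'} (a : X ⟶ X')
    (b : Y ⟶ Y') (h : F ≫ b = a ≫ F') :
    S.E.Q.map (S.s.map (simplicialConeMap a b h)) ≫ (S.simpleConeIso F').hom =
      (S.simpleConeIso F).hom ≫
        S.E.Q.map (S.coneMap (S.s.map a) (S.s.map b) (S.simple_sq h)) := by
  rw [simpleConeIso_hom, simpleConeIso_hom, ← Category.assoc, simpleCylIso_naturality,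
    Category.assoc, Category.assoc, ← S.E.Q.map_comp, ← S.E.Q.map_comp, coneMap, ← S.s.map_comp,
    ← S.s.map_comp, coneCorner, coneCorner, Cyl.map_comp, Cyl.map_comp]
  congr 4
  · exact (Category.comp_id _).trans (Category.id_comp _).symm
  · exact (Category.comp_id _).trans (Category.id_comp _).symm
  · exact point_hom_ext _ _

variable (F)

/-- `simpleConeIso` transports the acyclicity criterion from morphisms of `D` to all simplicial
maps. -/
lemma simple_mem_iff_acyclic : S.E (S.s.map F) ↔ S.Acyclic (S.s.obj (simplicialCone F)) := by
  refine (S.mem_iff_cone _).trans ⟨fun h => ?_, fun h => ?_⟩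
  · exact Acyclic.of_isIso h (S.simpleConeIso F).hom
  · exact Acyclic.of_isIso h (S.simpleConeIso F).inv

lemma acyclic_simple_cone_id (X : SimplicialObject D) :
    S.Acyclic (S.s.obj (simplicialCone (𝟙 X))) :=
  (S.simple_mem_iff_acyclic _).1 (by rw [S.s.map_id]; exact S.id_mem _)

lemma simple_toPoint_mem {X : SimplicialObject D} (h : S.Acyclic (S.s.obj X)) :
    S.E (S.s.map (toPoint X)) := S.mem_of_acyclic h S.acyclic_point _

lemma simple_id_mem (X : SimplicialObject D) : S.E (S.s.map (𝟙 X)) := by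
  rw [S.s.map_id]
  exact S.id_mem _

end Cone

/-! ### The two ends of a double mapping cylinder -/

section Homotopy

variable {X Y Z : SimplicialObject D} (f : X ⟶ Y) (g : X ⟶ Z)

/-- By `coneInZIso` the cone of this inclusion is the cylinder with `Z` replaced by the cone `CZ`.
Since `CZ` has acyclic simple, the result is equivalent to `C(f)`, which is acyclic by hypothesis.
-/
lemma simple_inZ_mem (hf : S.E (S.s.map f)) : S.E (S.s.map (Cyl.inZ f g)) := by
  rw [simple_mem_iff_acyclic]
  have h₁ : S.Acyclic (S.s.obj (Cyl f (g ≫ inclCone Z))) := by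
    refine (S.acyclic_iff_of_mem (S.simple_cylMap_mem (𝟙 X) (𝟙 Y) (toPoint _) (by simp)
      (point_hom_ext _ _) (S.simple_id_mem _) (S.simple_id_mem _)
      (S.simple_toPoint_mem (S.acyclic_simple_cone_id Z)))).2
      ((S.simple_mem_iff_acyclic f).1 hf)
  exact (S.acyclic_iff_of_mem (S.mem_of_isIso (S.s.map (coneInZIso f g).hom))).1 h₁

/-- The projection of `Cyl(1, 1)` to `X`. -/
noncomputable def cylProj (X : SimplicialObject D) : Cyl (𝟙 X) (𝟙 X) ⟶ X :=
  Cyl.desc (cylinderProj X) (𝟙 X) (𝟙 X) (by simp) (by simp)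

lemma simple_cylProj_mem (X : SimplicialObject D) : S.E (S.s.map (cylProj X)) := by
  refine S.E.of_precomp _ _ (S.simple_inZ_mem (𝟙 X) (𝟙 X) (S.simple_id_mem X)) ?_
  rw [← S.s.map_comp, cylProj, Cyl.inZ_desc]
  exact S.simple_id_mem X

/-- No automorphism of Δ[1] exchanges its ends, so this end needs its own argument. Up to
equivalence the cone of the inclusion is `Cyl(X ⟶ ∗, g)`, which does not involve `f`. For `f = g =
1` it is acyclic because the inclusion is a section of the equivalence `cylProj`, and replacing `1`
by the equivalence `g` preserves acyclicity. -/
lemma simple_inY_mem (hg : S.E (S.s.map g)) : S.E (S.s.map (Cyl.inY f g)) := by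
  have cyl_acyclic : ∀ {Y Z : SimplicialObject D} (f : X ⟶ Y) (g : X ⟶ Z),
      S.Acyclic (S.s.obj (Cyl (f ≫ inclCone Y) g)) ↔ S.Acyclic (S.s.obj (Cyl (toPoint X) g)) :=
    fun {Y Z} f g => S.acyclic_iff_of_mem (S.simple_cylMap_mem (𝟙 X) (toPoint _) (𝟙 Z)
      (point_hom_ext _ _) (by simp) (S.simple_id_mem _)
      (S.simple_toPoint_mem (S.acyclic_simple_cone_id Y)) (S.simple_id_mem _))
  have cone_iff : ∀ {Y Z : SimplicialObject D} (f : X ⟶ Y) (g : X ⟶ Z),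
      S.E (S.s.map (Cyl.inY f g)) ↔ S.Acyclic (S.s.obj (Cyl (toPoint X) g)) := fun f g => by
    rw [simple_mem_iff_acyclic, ← cyl_acyclic f g]
    exact (S.acyclic_iff_of_mem (S.mem_of_isIso (S.s.map (coneInYIso f g).hom))).symm
  have h₁ : S.E (S.s.map (Cyl.inY (𝟙 X) (𝟙 X))) := by
    refine S.E.of_postcomp _ _ (S.simple_cylProj_mem X) ?_
    rw [← S.s.map_comp, cylProj, Cyl.inY_desc]
    exact S.simple_id_mem X
  rw [cone_iff] at h₁ ⊢
  exact (S.acyclic_iff_of_mem (S.simple_cylMap_mem (𝟙 X) (𝟙 _) g (by simp) (by simp)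
    (S.simple_id_mem _) (S.simple_id_mem _) hg)).1 h₁

/-- In the universal case `f = g = 1` both inclusions are sections of the equivalence `cylProj`,
hence equal in `Ho D`; a map of cylinders carries this to the general case. -/
lemma simple_cyl_condition :
    S.E.Q.map (S.s.map (f ≫ Cyl.inY f g)) = S.E.Q.map (S.s.map (g ≫ Cyl.inZ f g)) := by
  have := S.isIso_map_Q (S.simple_cylProj_mem X)
  have h : S.E.Q.map (S.s.map (Cyl.inY (𝟙 X) (𝟙 X))) =
      S.E.Q.map (S.s.map (Cyl.inZ (𝟙 X) (𝟙 X))) := by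
    rw [← cancel_mono (S.E.Q.map (S.s.map (cylProj X))), ← S.E.Q.map_comp, ← S.E.Q.map_comp,
      ← S.s.map_comp, ← S.s.map_comp, cylProj, Cyl.inY_desc, Cyl.inZ_desc]
  have e : (𝟙 X) ≫ f = (𝟙 X) ≫ f := rfl
  rw [← Cyl.inY_map (f := 𝟙 X) (g := 𝟙 X) (f' := f) (g' := g) (𝟙 X) f g rfl rfl,
    ← Cyl.inZ_map (f := 𝟙 X) (g := 𝟙 X) (f' := f) (g' := g) (𝟙 X) f g rfl rfl,
    S.s.map_comp, S.s.map_comp, S.E.Q.map_comp, S.E.Q.map_comp, h]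

end Homotopy

/-! ### Homotopy pushouts and left fractions -/

section HomotopyPushout

variable {A B C : D} (f : A ⟶ B) (g : A ⟶ C)

/-- The homotopy pushout of morphisms of `D`. -/
noncomputable abbrev cyl : D :=
  S.s.obj (Cyl ((SimplicialObject.const D).map f) ((SimplicialObject.const D).map g))

/-- The canonical map of the first object to the homotopy pushout. -/
noncomputable def cylInl : B ⟶ S.cyl f g := S.rho.app B ≫ S.s.map (Cyl.inY _ _)

/-- The canonical map of the second object to the homotopy pushout. -/
noncomputable def cylInr : C ⟶ S.cyl f g := S.rho.app C ≫ S.s.map (Cyl.inZ _ _)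

variable {f} in
lemma const_mem (hf : S.E f) : S.E (S.s.map ((SimplicialObject.const D).map f)) :=
  S.s_mem _ fun _ => hf

-- Equivalences are stable under homotopy pushout, on either side. This replaces the Ore condition.
variable {g} in
lemma cylInl_mem (hg : S.E g) : S.E (S.cylInl f g) :=
  S.E.comp_mem _ _ (S.rho_mem B) (S.simple_inY_mem _ _ (S.const_mem hg))

variable {f} in
lemma cylInr_mem (hf : S.E f) : S.E (S.cylInr f g) :=
  S.E.comp_mem _ _ (S.rho_mem C) (S.simple_inZ_mem _ _ (S.const_mem hf))

lemma rho_naturality {A B : D} (f : A ⟶ B) :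
    f ≫ S.rho.app B = S.rho.app A ≫ S.s.map ((SimplicialObject.const D).map f) :=
  S.rho.naturality f

lemma rho_naturality_assoc {A B T : D} (f : A ⟶ B)
    (h : S.s.obj ((SimplicialObject.const D).obj B) ⟶ T) :
    f ≫ S.rho.app B ≫ h = S.rho.app A ≫ S.s.map ((SimplicialObject.const D).map f) ≫ h :=
  (Category.assoc _ _ _).symm.trans ((congrArg (fun k => k ≫ h) (S.rho_naturality f)).trans
    (Category.assoc _ _ _))

lemma cyl_condition : S.E.Q.map (f ≫ S.cylInl f g) = S.E.Q.map (g ≫ S.cylInr f g) := by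
  rw [cylInl, cylInr, rho_naturality_assoc, rho_naturality_assoc, ← S.s.map_comp, ← S.s.map_comp,
    S.E.Q.map_comp, S.E.Q.map_comp, simple_cyl_condition]

variable {f g}

/-- The universal property of the homotopy pushout for strictly commutative squares. -/
noncomputable def cylDesc {T : D} (p : B ⟶ T) (q : C ⟶ T) (h : f ≫ p = g ≫ q) :
    S.cyl f g ⟶ T :=
  S.s.map (Cyl.desc (cylinderProj _ ≫ (SimplicialObject.const D).map (f ≫ p))
    ((SimplicialObject.const D).map p) ((SimplicialObject.const D).map q) (by simp)
    (by simp [h])) ≫ S.lam.app T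

lemma rho_simple_lam {A T : D} (p : A ⟶ T) :
    S.rho.app A ≫ S.s.map ((SimplicialObject.const D).map p) ≫ S.lam.app T = p := by
  rw [← rho_naturality_assoc]
  exact (congrArg (fun k => p ≫ k) (S.rho_app_lam_app T)).trans (Category.comp_id p)

lemma cylInl_desc {T : D} (p : B ⟶ T) (q : C ⟶ T) (h : f ≫ p = g ≫ q) :
    S.cylInl f g ≫ S.cylDesc p q h = p := by
  refine (Category.assoc _ _ _).trans (Eq.trans ?_ (S.rho_simple_lam p))
  refine congrArg (fun k => S.rho.app B ≫ k) ?_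
  refine (Category.assoc _ _ _).symm.trans (congrArg (fun k => k ≫ S.lam.app T) ?_)
  exact (S.s.map_comp _ _).symm.trans (congrArg S.s.map (Cyl.inY_desc _ _ _ _ _))

lemma cylInr_desc {T : D} (p : B ⟶ T) (q : C ⟶ T) (h : f ≫ p = g ≫ q) :
    S.cylInr f g ≫ S.cylDesc p q h = q := by
  refine (Category.assoc _ _ _).trans (Eq.trans ?_ (S.rho_simple_lam q))
  refine congrArg (fun k => S.rho.app C ≫ k) ?_
  refine (Category.assoc _ _ _).symm.trans (congrArg (fun k => k ≫ S.lam.app T) ?_)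
  exact (S.s.map_comp _ _).symm.trans (congrArg S.s.map (Cyl.inZ_desc _ _ _ _ _))

variable (f g)

/-- The map of homotopy pushouts induced by a morphism of the second object. -/
noncomputable def cylPostcomp {C' : D} (c : C ⟶ C') : S.cyl f g ⟶ S.cyl f (g ≫ c) :=
  S.s.map (Cyl.map (𝟙 _) (𝟙 _) ((SimplicialObject.const D).map c) (by simp) (by simp))

lemma cylInl_postcomp {C' : D} (c : C ⟶ C') :
    S.cylInl f g ≫ S.cylPostcomp f g c = S.cylInl f (g ≫ c) := by
  rw [cylInl, cylPostcomp, Category.assoc, ← S.s.map_comp, Cyl.inY_map, Category.id_comp]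
  rfl

lemma cylInr_postcomp {C' : D} (c : C ⟶ C') :
    S.cylInr f g ≫ S.cylPostcomp f g c = c ≫ S.cylInr f (g ≫ c) := by
  rw [cylInr, cylPostcomp, Category.assoc, ← S.s.map_comp, Cyl.inZ_map, S.s.map_comp, cylInr,
    rho_naturality_assoc]

end HomotopyPushout

/-- Every morphism of `Ho D` is a left fraction. -/
lemma exists_fraction {A B : D} (u : S.E.Q.obj A ⟶ S.E.Q.obj B) :
    ∃ (T : D) (x : A ⟶ T) (w : B ⟶ T), S.E w ∧ u ≫ S.E.Q.map w = S.E.Q.map x := by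
  let P : MorphismProperty S.Ho := fun X Y u =>
    ∃ (T : D) (x : X.as.obj ⟶ T) (w : Y.as.obj ⟶ T),
      S.E w ∧ (u : S.E.Q.obj X.as.obj ⟶ S.E.Q.obj Y.as.obj) ≫ S.E.Q.map w = S.E.Q.map x
  have : P.IsStableUnderComposition := by
    refine ⟨fun {X Y Z} u v hu hv => ?_⟩
    obtain ⟨T, x, w, hw, h⟩ := hu
    obtain ⟨T', x', w', hw', h'⟩ := hv
    -- The span of `w` and `x'` is completed by its homotopy pushout; commutativity in `Ho D` is
    -- enough to compose the fractions.
    refine ⟨S.cyl w x', x ≫ S.cylInl w x', w' ≫ S.cylInr w x',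
      S.E.comp_mem _ _ hw' (S.cylInr_mem x' hw), ?_⟩
    have c := S.cyl_condition w x'
    rw [S.E.Q.map_comp, S.E.Q.map_comp] at c
    have aux : ∀ {X Y Z T T' U : S.Ho} {u : X ⟶ Y} {v : Y ⟶ Z} {w : Y ⟶ T} {x : X ⟶ T}
        {w' : Z ⟶ T'} {x' : Y ⟶ T'} {l : T ⟶ U} {r : T' ⟶ U}, u ≫ w = x → v ≫ w' = x' →
        w ≫ l = x' ≫ r → (u ≫ v) ≫ w' ≫ r = x ≫ l := by
      intro X Y Z T T' U u v w x w' x' l r h h' c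
      rw [← h, Category.assoc, Category.assoc, c, ← h', Category.assoc]
    exact (congrArg (fun k => (u ≫ v) ≫ k) (S.E.Q.map_comp _ _)).trans
      ((aux h h' c).trans (S.E.Q.map_comp _ _).symm)
  have h := Localization.Construction.morphismProperty_eq_top' P
    (fun X Y f => ⟨Y, f, 𝟙 Y, S.id_mem Y, (S.E.Q.map_comp _ _).symm.trans
      (congrArg S.E.Q.map (Category.comp_id f))⟩)
    (fun X Y e he => by
      obtain ⟨T, x, w, hw, h⟩ := he
      have := S.isIso_map_Q hw
      -- By saturation the numerator of an invertible fraction is an equivalence, so it can serve as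
      -- denominator of the inverse.
      have hx : S.E x := by
        refine S.saturated _ ?_
        rw [← h]
        exact IsIso.comp_isIso' (inferInstance : IsIso e.hom) this
      refine ⟨T, w, x, hx, ?_⟩
      rw [← h]
      exact e.inv_hom_id_assoc _)
  have : P u := by rw [h]; trivial
  exact this

end SimplicialDescentStructure

/-! ### Equality of morphisms in the homotopy category -/

namespace SimplicialDescentStructure

open SimplicialDescent

variable {D : Type u} [Category.{v} D] [HasFiniteCoproducts D] [HasTerminal D]
  (S : SimplicialDescentStructure D)

/-- A left fraction `A ⟶ T' ⟵ T`. -/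
structure Fraction (A T : D) where
  /-- the middle object -/
  obj : D
  /-- the numerator -/
  num : A ⟶ obj
  /-- the denominator -/
  den : T ⟶ obj
  mem : S.E den

namespace Fraction

variable {S} {A T U : D}

/-- Strict morphisms of fractions. -/
def Rel (p q : S.Fraction A T) : Prop :=
  ∃ k : p.obj ⟶ q.obj, p.num ≫ k = q.num ∧ p.den ≫ k = q.den

/-- The fraction obtained by a homotopy pushout along `g`. -/
noncomputable def push (g : T ⟶ U) (p : S.Fraction A T) : S.Fraction A U where
  obj := S.cyl p.den g
  num := p.num ≫ S.cylInl p.den g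
  den := S.cylInr p.den g
  mem := S.cylInr_mem g p.mem

/-- The fraction obtained by precomposition of the denominator with an equivalence. -/
def pull {e : T ⟶ U} (he : S.E e) (p : S.Fraction A U) : S.Fraction A T where
  obj := p.obj
  num := p.num
  den := e ≫ p.den
  mem := S.E.comp_mem _ _ he p.mem

lemma Rel.push (g : T ⟶ U) {p q : S.Fraction A T} (h : Rel p q) : Rel (p.push g) (q.push g) := by
  obtain ⟨p', x, w, hw⟩ := p
  obtain ⟨q', y, z, hz⟩ := q
  obtain ⟨k, hx, hy⟩ := h
  dsimp only at k hx hy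
  subst hx hy
  refine ⟨S.s.map (Cyl.map (𝟙 _) ((SimplicialObject.const D).map k) (𝟙 _) (by simp) (by simp)),
    ?_, ?_⟩
  · dsimp [Fraction.push]
    rw [cylInl, Category.assoc, Category.assoc, ← S.s.map_comp, Cyl.inY_map, S.s.map_comp,
      ← rho_naturality_assoc, Category.assoc]
    rfl
  · dsimp [Fraction.push]
    rw [cylInr, Category.assoc, ← S.s.map_comp, Cyl.inZ_map, Category.id_comp]
    rfl

lemma Rel.pull {e : T ⟶ U} (he : S.E e) {p q : S.Fraction A U} (h : Rel p q) :
    Rel (p.pull he) (q.pull he) := by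
  obtain ⟨k, hx, hy⟩ := h
  exact ⟨k, hx, (Category.assoc _ _ _).trans (congrArg (fun k => e ≫ k) hy)⟩

lemma push_id_rel (p : S.Fraction A T) : Rel (p.push (𝟙 T)) p :=
  ⟨S.cylDesc (𝟙 _) p.den (by simp), by
    dsimp [Fraction.push]
    rw [Category.assoc, cylInl_desc, Category.comp_id], cylInr_desc _ _ _ _⟩

lemma push_comp_rel {V : D} (g : T ⟶ U) (g' : U ⟶ V) (p : S.Fraction A T) :
    Rel ((p.push g).push g') (p.push (g ≫ g')) :=
  ⟨S.cylDesc (S.cylPostcomp p.den g g') (S.cylInr p.den (g ≫ g')) (S.cylInr_postcomp _ _ _), by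
    dsimp [Fraction.push]
    rw [Category.assoc, Category.assoc, cylInl_desc, cylInl_postcomp], cylInr_desc _ _ _ _⟩

lemma push_pull_rel {e : T ⟶ U} (he : S.E e) (p : S.Fraction A U) :
    Rel ((p.pull he).push e) p :=
  ⟨S.cylDesc (𝟙 _) p.den (Category.comp_id _), (Category.assoc _ _ _).trans
    ((congrArg (fun k => p.num ≫ k) (S.cylInl_desc _ _ _)).trans (Category.comp_id _)),
    S.cylInr_desc _ _ _⟩

/-- After pushing and pulling, the denominator is `e ≫ cylInr`, whereas `cylInl` maps `p` to a
fraction with denominator `p.den ≫ cylInl`. These are only homotopic. The homotopy becomes a strict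
map out of a mapping cylinder, and the fraction `r` on it has strict morphisms to both. -/
lemma exists_pull_push_rel {e : T ⟶ U} (he : S.E e) (p : S.Fraction A T) :
    ∃ q r : S.Fraction A T, Rel p q ∧ Rel r q ∧ Rel r ((p.push e).pull he) := by
  let W := (SimplicialObject.const D).map p.den
  let G := (SimplicialObject.const D).map e
  have hκ : S.E (S.s.map (W ≫ Cyl.inY W G)) := by
    rw [S.s.map_comp]
    exact S.E.comp_mem _ _ (S.const_mem p.mem) (S.simple_inY_mem _ _ (S.const_mem he))
  -- `φ₀` is the constant homotopy and `φ₁` the tautological one; they agree on `Cyl W G` and differ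
  -- at the free end, where they give the two denominators.
  let φ₀ : Cyl (W ≫ Cyl.inY W G) (𝟙 _) ⟶ Cyl W G :=
    Cyl.desc (cylinderProj _ ≫ W ≫ Cyl.inY W G) (𝟙 _) (W ≫ Cyl.inY W G) (by simp) (by simp)
  let φ₁ : Cyl (W ≫ Cyl.inY W G) (𝟙 _) ⟶ Cyl W G :=
    Cyl.desc (Cyl.inX W G) (𝟙 _) (G ≫ Cyl.inZ W G) (by rw [Cyl.face_zero, Category.comp_id])
      (by rw [Cyl.face_one, Category.id_comp])
  refine ⟨⟨S.cyl p.den e, p.num ≫ S.cylInl p.den e, p.den ≫ S.cylInl p.den e,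
      S.E.comp_mem _ _ p.mem (S.cylInl_mem _ he)⟩,
    ⟨S.s.obj (Cyl (W ≫ Cyl.inY W G) (𝟙 _)),
      p.num ≫ S.rho.app p.obj ≫ S.s.map (Cyl.inY W G ≫ Cyl.inY (W ≫ Cyl.inY W G) (𝟙 _)),
      S.rho.app T ≫ S.s.map (Cyl.inZ (W ≫ Cyl.inY W G) (𝟙 _)),
      S.E.comp_mem _ _ (S.rho_mem T) (S.simple_inZ_mem _ _ hκ)⟩,
    ⟨S.cylInl p.den e, rfl, rfl⟩, ⟨S.s.map φ₀, ?_, ?_⟩, ⟨S.s.map φ₁, ?_, ?_⟩⟩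
  · change (p.num ≫ S.rho.app p.obj ≫ S.s.map _) ≫ S.s.map _ = p.num ≫ S.rho.app p.obj ≫ S.s.map _
    rw [Category.assoc, Category.assoc, ← S.s.map_comp, Category.assoc, Cyl.inY_desc,
      Category.comp_id]
  · change (S.rho.app T ≫ S.s.map _) ≫ S.s.map _ = p.den ≫ S.rho.app p.obj ≫ S.s.map _
    rw [Category.assoc, ← S.s.map_comp, Cyl.inZ_desc, S.s.map_comp, rho_naturality_assoc]
  · change (p.num ≫ S.rho.app p.obj ≫ S.s.map _) ≫ S.s.map _ =
      p.num ≫ S.rho.app p.obj ≫ S.s.map _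
    rw [Category.assoc, Category.assoc, ← S.s.map_comp, Category.assoc, Cyl.inY_desc,
      Category.comp_id]
  · change (S.rho.app T ≫ S.s.map _) ≫ S.s.map _ = e ≫ S.rho.app U ≫ S.s.map _
    rw [Category.assoc, ← S.s.map_comp, Cyl.inZ_desc, S.s.map_comp, rho_naturality_assoc]

end Fraction

/-- The functor of connected components of left fractions with source `A`. -/
noncomputable def fractionFunctor (A : D) : D ⥤ Type max u v where
  obj T := Quot (Fraction.Rel (S := S) (A := A) (T := T))
  map g := ↾(Quot.map (Fraction.push g) fun _ _ h => h.push g)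
  map_id T := by
    ext p
    obtain ⟨p⟩ := p
    exact Quot.sound p.push_id_rel
  map_comp g g' := by
    ext p
    obtain ⟨p⟩ := p
    exact (Quot.sound (p.push_comp_rel g g')).symm

/-- On connected components `pull` is inverse to `push` along an equivalence. Hence the functor of
components extends to `Ho D`. -/
lemma fractionFunctor_isIso (A : D) {T U : D} (e : T ⟶ U) (he : S.E e) :
    IsIso ((S.fractionFunctor A).map e) := by
  refine ⟨↾(Quot.map (Fraction.pull he) fun _ _ h => h.pull he), ?_, ?_⟩
  · ext p
    obtain ⟨p⟩ := p
    obtain ⟨q, r, h₁, h₂, h₃⟩ := p.exists_pull_push_rel he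
    exact (Quot.sound h₃).symm.trans ((Quot.sound h₂).trans (Quot.sound h₁).symm)
  · ext p
    obtain ⟨p⟩ := p
    exact Quot.sound (p.push_pull_rel he)

/-- Two morphisms with the same image in `Ho D` are connected by strict morphisms of fractions. -/
lemma eqvGen_of_map_eq {A T : D} {x y : A ⟶ T} (h : S.E.Q.map x = S.E.Q.map y) :
    Relation.EqvGen (Fraction.Rel (S := S))
      ⟨T, x, 𝟙 T, S.id_mem T⟩ ⟨T, y, 𝟙 T, S.id_mem T⟩ := by
  let H := Localization.Construction.lift (S.fractionFunctor A)
    fun _ _ e he => S.fractionFunctor_isIso A e he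
  have hH : ∀ {B C : D} (f : B ⟶ C), H.map (S.E.Q.map f) = (S.fractionFunctor A).map f :=
    fun f => (CategoryTheory.Functor.congr_hom (Localization.Construction.fac (S.fractionFunctor A)
      fun _ _ e he => S.fractionFunctor_isIso A e he) f).trans
        ((Category.id_comp _).trans (Category.comp_id _))
  have e : (S.fractionFunctor A).map x = (S.fractionFunctor A).map y :=
    (hH x).symm.trans ((congrArg H.map h).trans (hH y))
  -- As in the Yoneda lemma, the class of the fraction given by `x` is the image of the identity
  -- fraction of `A`, so it depends only on the image of `x` in `Ho D`.
  have key : ∀ x : A ⟶ T, (S.fractionFunctor A).map x (Quot.mk _ ⟨A, 𝟙 A, 𝟙 A, S.id_mem A⟩) =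
      Quot.mk _ ⟨T, x, 𝟙 T, S.id_mem T⟩ := by
    intro x
    refine Quot.sound ⟨S.cylDesc x (𝟙 T) (by simp), ?_, S.cylInr_desc _ _ _⟩
    dsimp [Fraction.push]
    rw [Category.id_comp, cylInl_desc]
  refine Quot.eqvGen_exact ?_
  rw [← key x, ← key y, e]

/-! ### Morphisms between standard triangles -/

section Fill

variable {A B A' B' A'' B'' : D} (f : A ⟶ B) (f' : A' ⟶ B') (f'' : A'' ⟶ B'')

/-- A morphism of triangles between the triangles of two morphisms of `D`, with given components on
the sources and targets, exists and is an isomorphism if `P` holds. -/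
def HasFill (P : Prop) (a : S.E.Q.obj A ⟶ S.E.Q.obj A') (b : S.E.Q.obj B ⟶ S.E.Q.obj B') : Prop :=
  ∃ c : S.E.Q.obj (S.cone f) ⟶ S.E.Q.obj (S.cone f'),
    S.E.Q.map (S.coneIncl f) ≫ c = b ≫ S.E.Q.map (S.coneIncl f') ∧
    S.coneProjHo f ≫ S.suspensionHo.map a = c ≫ S.coneProjHo f' ∧ (P → IsIso c)

variable {S f f' f''}

lemma HasFill.trans {P : Prop} {a : S.E.Q.obj A ⟶ S.E.Q.obj A'} {b : S.E.Q.obj B ⟶ S.E.Q.obj B'}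
    {a' : S.E.Q.obj A' ⟶ S.E.Q.obj A''} {b' : S.E.Q.obj B' ⟶ S.E.Q.obj B''}
    (h : S.HasFill f f' P a b) (h' : S.HasFill f' f'' P a' b') :
    S.HasFill f f'' P (a ≫ a') (b ≫ b') := by
  obtain ⟨c, h₁, h₂, h₃⟩ := h
  obtain ⟨c', h₁', h₂', h₃'⟩ := h'
  refine ⟨c ≫ c', ?_, ?_, fun hP => ?_⟩
  · rw [← Category.assoc, h₁, Category.assoc, h₁', Category.assoc]
  · rw [Functor.map_comp, ← Category.assoc, h₂, Category.assoc, h₂', Category.assoc]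
  · have := h₃ hP
    have := h₃' hP
    infer_instance

lemma HasFill.symm {P : Prop} {a : S.E.Q.obj A ⟶ S.E.Q.obj A'} {b : S.E.Q.obj B ⟶ S.E.Q.obj B'}
    [IsIso a] [IsIso b] (h : S.HasFill f f' True a b) : S.HasFill f' f P (inv a) (inv b) := by
  obtain ⟨c, h₁, h₂, h₃⟩ := h
  have := h₃ trivial
  refine ⟨inv c, ?_, ?_, fun _ => inferInstance⟩
  · rw [IsIso.comp_inv_eq, Category.assoc, h₁, IsIso.inv_hom_id_assoc]
  · rw [Functor.map_inv, IsIso.comp_inv_eq, Category.assoc, h₂, IsIso.inv_hom_id_assoc]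

lemma HasFill.mono {P P' : Prop} {a : S.E.Q.obj A ⟶ S.E.Q.obj A'}
    {b : S.E.Q.obj B ⟶ S.E.Q.obj B'} (h : S.HasFill f f' P a b) (hP : P' → P) :
    S.HasFill f f' P' a b :=
  let ⟨c, h₁, h₂, h₃⟩ := h
  ⟨c, h₁, h₂, fun h => h₃ (hP h)⟩

variable (S)

lemma coneIncl_map {a : A ⟶ A'} {b : B ⟶ B'} (h : f ≫ b = a ≫ f') :
    S.coneIncl f ≫ S.coneMap a b h = b ≫ S.coneIncl f' := by
  rw [coneIncl, coneMap, Category.assoc, ← S.s.map_comp, Cyl.inY_map, S.s.map_comp,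
    ← rho_naturality_assoc]
  rfl

lemma simplicialConeProj_map {X Y X' Y' : SimplicialObject D} {F : X ⟶ Y} {F' : X' ⟶ Y'}
    {a : X ⟶ X'} {b : Y ⟶ Y'} (h : F ≫ b = a ≫ F') :
    simplicialConeProj F ≫ (simplicialSuspensionFunctor D).map a =
      simplicialConeMap a b h ≫ simplicialConeProj F' := by
  change simplicialConeMap _ _ (point_hom_ext _ _) ≫ simplicialConeMap _ _ (point_hom_ext _ _) =
    _ ≫ simplicialConeMap _ _ (point_hom_ext _ _)
  rw [Cyl.map_comp, Cyl.map_comp]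
  congr 1
  · rw [Category.id_comp, Category.comp_id]
  · exact point_hom_ext _ _

lemma coneProj_map {a : A ⟶ A'} {b : B ⟶ B'} (h : f ≫ b = a ≫ f') :
    S.coneProj f ≫ S.suspension.map a = S.coneMap a b h ≫ S.coneProj f' := by
  refine (S.s.map_comp _ _).symm.trans (Eq.trans ?_ (S.s.map_comp _ _))
  refine congrArg S.s.map ?_
  exact simplicialConeProj_map _

lemma suspensionHo_map_Q (a : A ⟶ A') :
    S.suspensionHo.map (S.E.Q.map a) = S.E.Q.map (S.suspension.map a) :=
  localizedMap_map_Q S.suspension (fun _ _ f hf => S.suspension_mem f hf) a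

lemma coneMap_mem {a : A ⟶ A'} {b : B ⟶ B'} (h : f ≫ b = a ≫ f') (ha : S.E a) (hb : S.E b) :
    S.E (S.coneMap a b h) :=
  S.s_mem _ fun n => cylMap_app_mem S.coprod_mem S.id_mem _ _ _ _ _ n ha hb (S.id_mem _)

lemma coneProjHo_map {a : A ⟶ A'} {b : B ⟶ B'} (h : f ≫ b = a ≫ f') :
    S.coneProjHo f ≫ S.suspensionHo.map (S.E.Q.map a) =
      S.E.Q.map (S.coneMap a b h) ≫ S.coneProjHo f' := by
  rw [suspensionHo_map_Q]
  exact (S.E.Q.map_comp _ _).symm.trans ((congrArg S.E.Q.map (S.coneProj_map h)).trans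
    (S.E.Q.map_comp _ _))

lemma hasFill_map {P : Prop} {a : A ⟶ A'} {b : B ⟶ B'} (h : f ≫ b = a ≫ f')
    (hP : P → S.E a ∧ S.E b) : S.HasFill f f' P (S.E.Q.map a) (S.E.Q.map b) := by
  refine ⟨S.E.Q.map (S.coneMap a b h), ?_, S.coneProjHo_map h, fun p =>
    S.isIso_map_Q (S.coneMap_mem h (hP p).1 (hP p).2)⟩
  rw [← S.E.Q.map_comp, ← S.E.Q.map_comp, coneIncl_map]

/-- Cones of morphisms with the same image in `Ho D` are isomorphic. -/
lemma hasFill_of_map_eq (P : Prop) {x y : A ⟶ B} (h : S.E.Q.map x = S.E.Q.map y) :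
    S.HasFill x y P (𝟙 _) (𝟙 _) := by
  -- Along the zigzag the middle objects are related by an isomorphism `b` compatible with the
  -- denominators. Both final denominators are identities, and this compatibility then forces `b` to
  -- be the identity.
  have key : ∀ p q : S.Fraction A B, Relation.EqvGen Fraction.Rel p q →
      ∃ b : S.E.Q.obj p.obj ⟶ S.E.Q.obj q.obj, S.E.Q.map p.den ≫ b = S.E.Q.map q.den ∧
        IsIso b ∧ S.HasFill p.num q.num True (𝟙 _) b := by
    intro p q h
    induction h with
    | rel p q h =>
      obtain ⟨k, hk, hk'⟩ := h
      have hE : S.E k := S.E.of_precomp _ _ p.mem (by rw [hk']; exact q.mem)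
      refine ⟨S.E.Q.map k, by rw [← S.E.Q.map_comp, hk'], S.isIso_map_Q hE, ?_⟩
      rw [← S.E.Q.map_id]
      exact S.hasFill_map (by rw [hk, Category.id_comp]) fun _ => ⟨S.id_mem _, hE⟩
    | refl p =>
      refine ⟨𝟙 _, Category.comp_id _, inferInstance, 𝟙 _, ?_, ?_, fun _ => inferInstance⟩
      · rw [Category.comp_id, Category.id_comp]
      · exact (congrArg (fun k => _ ≫ k) (S.suspensionHo.map_id _)).trans
          ((Category.comp_id _).trans (Category.id_comp _).symm)
    | symm p q _ ih =>
      obtain ⟨b, hb, _, hf⟩ := ih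
      refine ⟨inv b, by rw [IsIso.comp_inv_eq, hb], inferInstance, ?_⟩
      simpa using hf.symm (P := True)
    | trans p q r _ _ ih ih' =>
      obtain ⟨b, hb, _, hf⟩ := ih
      obtain ⟨b', hb', _, hf'⟩ := ih'
      refine ⟨b ≫ b', by rw [← Category.assoc, hb, hb'], inferInstance, ?_⟩
      simpa using hf.trans hf'
  obtain ⟨b, hb, _, hf⟩ := key _ _ (S.eqvGen_of_map_eq h)
  have hb' : b = 𝟙 _ := by simpa using hb
  subst hb'
  exact hf.mono fun _ => trivial

variable {S}

/-- Every commutative square of `Ho D` extends to a morphism of triangles. -/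
lemma exists_fill (a : S.E.Q.obj A ⟶ S.E.Q.obj A') (b : S.E.Q.obj B ⟶ S.E.Q.obj B')
    (h : S.E.Q.map f ≫ b = a ≫ S.E.Q.map f') : S.HasFill f f' (IsIso a ∧ IsIso b) a b := by
  obtain ⟨T, x, w, hw, ha⟩ := S.exists_fraction a
  obtain ⟨U, y, z, hz, hb⟩ := S.exists_fraction b
  -- Here `a` is `x` followed by the inverse of `w`, and `b` is `y` followed by the inverse of `z`.
  -- The homotopy pushout of `w` and `f' ≫ z` cuts the square into pieces along `f`, `f ≫ y ≫ r`, `x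
  -- ≫ l`, `l`, `w ≫ l`, `f' ≫ z ≫ r`, `f'`. Each piece is a strict square, the inverse of one, or a
  -- change of representative.
  let l := S.cylInl w (f' ≫ z)
  let r := S.cylInr w (f' ≫ z)
  have hr : S.E r := S.cylInr_mem _ hw
  have hlr : S.E.Q.map (w ≫ l) = S.E.Q.map (f' ≫ z ≫ r) :=
    (S.cyl_condition w (f' ≫ z)).trans (congrArg S.E.Q.map (Category.assoc _ _ _))
  have hzr : S.E (z ≫ r) := S.E.comp_mem _ _ hz hr
  have := S.isIso_map_Q hw
  have := S.isIso_map_Q hz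
  have := S.isIso_map_Q hr
  have := S.isIso_map_Q hzr
  have e : S.E.Q.map (f ≫ y ≫ r) = S.E.Q.map (x ≫ l) := by
    rw [S.E.Q.map_comp, S.E.Q.map_comp, ← hb, Category.assoc, reassoc_of% h, S.E.Q.map_comp x,
      ← ha, Category.assoc, ← S.E.Q.map_comp w, hlr, S.E.Q.map_comp, S.E.Q.map_comp]
  have h₁ : S.HasFill f (f ≫ y ≫ r) (IsIso a ∧ IsIso b) (S.E.Q.map (𝟙 A)) (S.E.Q.map (y ≫ r)) := by
    refine S.hasFill_map (by simp) fun ⟨_, hib⟩ => ⟨S.id_mem _, S.E.comp_mem _ _ ?_ hr⟩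
    refine S.saturated _ ?_
    rw [← hb]
    infer_instance
  have h₂ := S.hasFill_of_map_eq (IsIso a ∧ IsIso b) e
  have h₃ : S.HasFill (x ≫ l) l (IsIso a ∧ IsIso b) (S.E.Q.map x) (S.E.Q.map (𝟙 _)) := by
    refine S.hasFill_map (by simp) fun ⟨hia, _⟩ => ⟨?_, S.id_mem _⟩
    refine S.saturated _ ?_
    rw [← ha]
    infer_instance
  have h₄ : S.HasFill l (w ≫ l) (IsIso a ∧ IsIso b) (inv (S.E.Q.map w))
      (inv (S.E.Q.map (𝟙 _))) :=
    (S.hasFill_map (P := True) (by simp) fun _ => ⟨hw, S.id_mem _⟩).symm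
  have h₅ := S.hasFill_of_map_eq (IsIso a ∧ IsIso b) hlr
  have h₆ : S.HasFill (f' ≫ z ≫ r) f' (IsIso a ∧ IsIso b) (inv (S.E.Q.map (𝟙 _)))
      (inv (S.E.Q.map (z ≫ r))) :=
    (S.hasFill_map (P := True) (by simp) fun _ => ⟨S.id_mem _, hzr⟩).symm
  have := ((((h₁.trans h₂).trans h₃).trans h₄).trans h₅).trans h₆
  have ea : a = S.E.Q.map x ≫ inv (S.E.Q.map w) := by rw [← ha, Category.assoc,
    IsIso.hom_inv_id, Category.comp_id]
  have eb : b = S.E.Q.map (y ≫ r) ≫ inv (S.E.Q.map (z ≫ r)) := by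
    rw [← IsIso.comp_inv_eq, IsIso.inv_inv, S.E.Q.map_comp, S.E.Q.map_comp, reassoc_of% hb]
  convert this using 1
  · rw [ea]; simp
  · rw [eb]; simp

end Fill

end SimplicialDescentStructure

namespace SimplicialDescent

section

variable {D : Type u} [Category.{v} D] [HasFiniteCoproducts D] [HasTerminal D]

@[simp]
lemma comp_toPoint {X Y : SimplicialObject D} (f : X ⟶ Y) : f ≫ toPoint Y = toPoint X :=
  point_hom_ext _ _

@[simp]
lemma comp_toPoint_assoc {X Y T : SimplicialObject D} (f : X ⟶ Y) (h : point D ⟶ T) :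
    f ≫ toPoint Y ≫ h = toPoint X ≫ h := by
  rw [← Category.assoc, comp_toPoint]

@[simp]
lemma toPoint_point : toPoint (point D) = 𝟙 (point D) := point_hom_ext _ _

end

end SimplicialDescent

namespace SimplicialDescentStructure

open SimplicialDescent

variable {D : Type u} [Category.{v} D] [HasFiniteCoproducts D] [HasTerminal D]
  (S : SimplicialDescentStructure D)

lemma _root_.SimplicialDescent.comp_comp_comp_eq {C : Type*} [Category C] {X Y Z T U : C}
    {a : X ⟶ Y} {b : Y ⟶ Z} {c : Z ⟶ T} {d : T ⟶ U} {m : Y ⟶ U} (h : b ≫ c ≫ d = m) :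
    ((a ≫ b) ≫ c) ≫ d = a ≫ m := by
  rw [Category.assoc, Category.assoc, h]

/-! ### Commutation of the simple functor with suspensions -/

section Suspension

lemma coneProj_mem {A B : D} (f : A ⟶ B) (hB : S.Acyclic B) : S.E (S.coneProj f) :=
  S.s_mem _ fun n => cylMap_app_mem S.coprod_mem S.id_mem _ _ _ (point_hom_ext _ _)
    (point_hom_ext _ _) n (S.id_mem _) hB (S.id_mem _)

/-- The commutation of the simple functor with suspensions. -/
noncomputable def simpleSuspensionIso (X : SimplicialObject D) :
    S.E.Q.obj (S.s.obj ((simplicialSuspensionFunctor D).obj X)) ≅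
      S.E.Q.obj (S.suspension.obj (S.s.obj X)) :=
  S.simpleConeIso (toPoint X) ≪≫ Localization.Construction.wIso _
    (S.coneProj_mem (S.s.map (toPoint X)) S.acyclic_point)

lemma simpleSuspensionIso_naturality {X X' : SimplicialObject D} (a : X ⟶ X') :
    S.E.Q.map (S.s.map ((simplicialSuspensionFunctor D).map a)) ≫ (S.simpleSuspensionIso X').hom =
      (S.simpleSuspensionIso X).hom ≫ S.E.Q.map (S.suspension.map (S.s.map a)) := by
  have h := S.simpleConeIso_naturality (F := toPoint X) (F' := toPoint X') a (𝟙 _)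
    (point_hom_ext _ _)
  have h' := S.coneProj_map (S.simple_sq (F := toPoint X) (F' := toPoint X') (a := a) (b := 𝟙 _)
    (point_hom_ext _ _))
  exact ((CommSq.mk h).vert_comp ((CommSq.mk h'.symm).map S.E.Q)).w

lemma simple_coneProj_comp {X Y : SimplicialObject D} (F : X ⟶ Y) :
    S.E.Q.map (S.s.map (simplicialConeProj F)) ≫ (S.simpleSuspensionIso X).hom =
      (S.simpleConeIso F).hom ≫ S.E.Q.map (S.coneProj (S.s.map F)) := by
  have h := S.simpleConeIso_naturality (F := F) (F' := toPoint X) (𝟙 X) (toPoint Y)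
    (point_hom_ext _ _)
  have h' := S.coneProj_map (S.simple_sq (F := F) (F' := toPoint X) (a := 𝟙 X) (b := toPoint Y)
    (point_hom_ext _ _))
  have e : S.suspension.map (S.s.map (𝟙 X)) = 𝟙 _ := by rw [S.s.map_id, S.suspension.map_id]
  rw [e, Category.comp_id] at h'
  refine ((CommSq.mk h).vert_comp ((CommSq.mk (h'.symm.trans (Category.comp_id _).symm)).map
    S.E.Q)).w.trans ?_
  rw [S.E.Q.map_id, Category.comp_id]

/-- The maps which follow `simpleCylIso` compose to the map of cylinders induced by `λ`, its
components at the final object being forced; `simpleCylIso_const` then applies. -/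
lemma simpleSuspensionIso_const (A : D) :
    (S.simpleSuspensionIso ((SimplicialObject.const D).obj A)).hom ≫
      S.E.Q.map (S.suspension.map (S.lam.app A)) = 𝟙 (S.E.Q.obj (S.suspension.obj A)) := by
  have h := S.simpleCylIso_const (terminal.from A) (terminal.from A)
  refine Eq.trans ?_ h
  refine comp_comp_comp_eq ((functor_map_comp₃ S.E.Q _ _ _).symm.trans (congrArg S.E.Q.map
    ((functor_map_comp₃ S.s _ _ _).symm.trans (congrArg S.s.map ?_))))
  change Cyl.map _ _ _ (by simp) (point_hom_ext _ _) ≫ Cyl.map _ _ _ (point_hom_ext _ _)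
    (point_hom_ext _ _) ≫ Cyl.map _ _ _ (point_hom_ext _ _) (point_hom_ext _ _) = _
  refine Eq.trans (congrArg (fun k => _ ≫ k) (Cyl.map_comp _ _ _ _ _ _ _ _ _ _)) ?_
  refine (Cyl.map_comp _ _ _ _ _ _ _ _ _ _).trans ?_
  congr 1
  · exact (Category.id_comp _).trans (Category.id_comp _)
  · exact point_hom_ext _ _
  · exact point_hom_ext _ _

/-- Both sides are sections of `Σλ`, which is invertible in `Ho D`. The abstract isomorphism built
from `μ` is thus explicit on constant objects, which keeps connecting maps under control. -/
lemma simpleSuspensionIso_const_hom (A : D) :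
    (S.simpleSuspensionIso ((SimplicialObject.const D).obj A)).hom =
      S.suspensionHo.map (S.E.Q.map (S.rho.app A)) := by
  have := S.isIso_map_Q (S.suspension_mem _ (S.lam_mem A))
  rw [suspensionHo_map_Q]
  refine (cancel_mono (S.E.Q.map (S.suspension.map (S.lam.app A)))).1 ?_
  refine (S.simpleSuspensionIso_const A).trans ?_
  refine Eq.trans ?_ (S.E.Q.map_comp _ _)
  refine Eq.trans ?_ (congrArg S.E.Q.map (S.suspension.map_comp _ _))
  refine Eq.trans ?_ (congrArg (fun k => S.E.Q.map (S.suspension.map k))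
    (S.rho_app_lam_app A).symm)
  rw [S.suspension.map_id, S.E.Q.map_id]

end Suspension

/-! ### Cofiber sequences of simplicial maps -/

section Cofiber

variable {S}

lemma IsCofiberSequence.of_iso {A B C A' B' C' : S.Ho} {u : A ⟶ B} {v : B ⟶ C}
    {w : C ⟶ S.suspensionHo.obj A} {u' : A' ⟶ B'} {v' : B' ⟶ C'}
    {w' : C' ⟶ S.suspensionHo.obj A'} (a : A ≅ A') (b : B ≅ B') (c : C ≅ C')
    (hu : u ≫ b.hom = a.hom ≫ u') (hv : v ≫ c.hom = b.hom ≫ v')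
    (hw : w ≫ S.suspensionHo.map a.hom = c.hom ≫ w') (h : S.IsCofiberSequence u v w) :
    S.IsCofiberSequence u' v' w' := by
  obtain ⟨A₀, B₀, f, a₀, b₀, c₀, h₁, h₂, h₃⟩ := h
  refine ⟨A₀, B₀, f, a.symm ≪≫ a₀, b.symm ≪≫ b₀, c.symm ≪≫ c₀, ?_, ?_, ?_⟩
  · simp only [Iso.trans_hom, Iso.symm_hom, Category.assoc]
    rw [← h₁, Iso.eq_inv_comp, ← reassoc_of% hu, Iso.hom_inv_id_assoc]
  · simp only [Iso.trans_hom, Iso.symm_hom, Category.assoc]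
    rw [← h₂, Iso.eq_inv_comp, ← reassoc_of% hv, Iso.hom_inv_id_assoc]
  · simp only [Iso.trans_hom, Iso.symm_hom, Category.assoc, Functor.map_comp]
    rw [← h₃, Iso.eq_inv_comp, ← reassoc_of% hw, ← Functor.map_comp_assoc, Iso.hom_inv_id,
      S.suspensionHo.map_id, Category.id_comp]

/-- The third object of a cofiber sequence is determined by the first morphism. -/
lemma IsCofiberSequence.exists_iso {A B C : S.Ho} {u : A ⟶ B} {v : B ⟶ C}
    {w : C ⟶ S.suspensionHo.obj A} (h : S.IsCofiberSequence u v w) {A₁ B₁ : D} (f : A₁ ⟶ B₁)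
    (a : A ≅ S.E.Q.obj A₁) (b : B ≅ S.E.Q.obj B₁) (hu : u ≫ b.hom = a.hom ≫ S.E.Q.map f) :
    ∃ c : C ≅ S.E.Q.obj (S.cone f), v ≫ c.hom = b.hom ≫ S.E.Q.map (S.coneIncl f) ∧
      w ≫ S.suspensionHo.map a.hom = c.hom ≫ S.coneProjHo f := by
  obtain ⟨A₀, B₀, f₀, a₀, b₀, c₀, h₁, h₂, h₃⟩ := h
  obtain ⟨c, hc₁, hc₂, hc⟩ := exists_fill (S := S) (f := f₀) (f' := f) (a₀.inv ≫ a.hom)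
    (b₀.inv ≫ b.hom) (by
      rw [Category.assoc, ← hu, Iso.eq_inv_comp, ← reassoc_of% h₁, Iso.hom_inv_id_assoc])
  have := hc ⟨inferInstance, inferInstance⟩
  refine ⟨c₀ ≪≫ asIso c, ?_, ?_⟩
  · rw [Iso.trans_hom, asIso_hom, reassoc_of% h₂, hc₁, Category.assoc, Iso.hom_inv_id_assoc]
  · rw [Iso.trans_hom, asIso_hom, Category.assoc, ← hc₂, ← reassoc_of% h₃,
      ← S.suspensionHo.map_comp, Iso.hom_inv_id_assoc]

variable (S)

/-- `simpleConeIso` carries this triangle to the standard one of `s F`. Triangles can therefore be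
produced from simplicial constructions and not only from morphisms of `D`. -/
lemma isCofiberSequence_simple {X Y : SimplicialObject D} (F : X ⟶ Y) :
    S.IsCofiberSequence (S.E.Q.map (S.s.map F)) (S.E.Q.map (S.s.map (Cyl.inY F (toPoint X))))
      (S.E.Q.map (S.s.map (simplicialConeProj F)) ≫ (S.simpleSuspensionIso X).hom :
        _ ⟶ S.suspensionHo.obj (S.E.Q.obj (S.s.obj X))) := by
  refine ⟨_, _, S.s.map F, Iso.refl _, Iso.refl _, S.simpleConeIso F, ?_, ?_, ?_⟩
  · exact (Category.comp_id _).trans (Category.id_comp _).symm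
  · exact (S.inY_simpleConeIso F).trans (Category.id_comp _).symm
  · refine (congrArg (fun k => _ ≫ k) (S.suspensionHo.map_id _)).trans ?_
    exact (Category.comp_id _).trans (S.simple_coneProj_comp F)

/-- The source `R(A)` is replaced by `A` along `ρ`. By `simpleSuspensionIso_const_hom` this cancels
the suspension comparison and leaves the plain `s(P)` as connecting map. -/
lemma isCofiberSequence_simple_const {A : D} {Y : SimplicialObject D}
    (F : (SimplicialObject.const D).obj A ⟶ Y) :
    S.IsCofiberSequence (S.E.Q.map (S.rho.app A ≫ S.s.map F))
      (S.E.Q.map (S.s.map (Cyl.inY F (toPoint _))))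
      (S.E.Q.map (S.s.map (simplicialConeProj F)) :
        _ ⟶ S.suspensionHo.obj (S.E.Q.obj A)) := by
  have := S.isIso_map_Q (S.rho_mem A)
  refine (S.isCofiberSequence_simple F).of_iso
    (Localization.Construction.wIso _ (S.rho_mem A)).symm (Iso.refl _) (Iso.refl _) ?_ ?_ ?_
  · have h : (Localization.Construction.wIso _ (S.rho_mem A)).inv ≫ S.E.Q.map (S.rho.app A) = 𝟙 _ :=
      (Localization.Construction.wIso _ (S.rho_mem A)).inv_hom_id
    refine (Category.comp_id _).trans (Eq.symm ?_)
    refine (congrArg (fun k => _ ≫ k) (S.E.Q.map_comp _ _)).trans ?_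
    exact (Category.assoc _ _ _).symm.trans ((congrArg (fun k => k ≫ _) h).trans
      (Category.id_comp _))
  · exact (Category.comp_id _).trans (Category.id_comp _).symm
  · have h : S.suspensionHo.map (S.E.Q.map (S.rho.app A)) ≫ S.suspensionHo.map
        (Localization.Construction.wIso _ (S.rho_mem A)).symm.hom = 𝟙 _ := by
      rw [← S.suspensionHo.map_comp]
      exact (congrArg S.suspensionHo.map
        (Localization.Construction.wIso _ (S.rho_mem A)).hom_inv_id).trans (S.suspensionHo.map_id _)
    rw [simpleSuspensionIso_const_hom]
    refine (Category.assoc _ _ _).trans ((congrArg (fun k => _ ≫ k) h).trans ?_)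
    exact (Category.comp_id _).trans (Category.id_comp _).symm

end Cofiber

/-! ### TR1 and the sign on the suspension -/

section TriangulatedAxioms

/-- The cone of an identity is acyclic, so `∗` can replace it, and maps to an acyclic object agree
in `Ho D`. -/
lemma exists_cofiberSequence_id (A : D) :
    ∃ w : S.E.Q.obj (⊤_ D) ⟶ S.suspensionHo.obj (S.E.Q.obj A),
      S.IsCofiberSequence (𝟙 (S.E.Q.obj A)) (S.E.Q.map (terminal.from A)) w := by
  have h : S.Acyclic (S.cone (𝟙 A)) := (S.mem_iff_cone _).1 (S.id_mem A)
  let c := Localization.Construction.wIso _ h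
  refine ⟨c.inv ≫ S.coneProjHo (𝟙 A), A, A, 𝟙 A, Iso.refl _, Iso.refl _, c.symm, ?_, ?_, ?_⟩
  · rw [S.E.Q.map_id]
    rfl
  · exact h.hom_ext _ _
  · exact (congrArg (fun k => _ ≫ k) (S.suspensionHo.map_id _)).trans (Category.comp_id _)

/-- The denominator of a left fraction is an isomorphism from `u` to its numerator, whose cone
supplies the triangle. -/
lemma exists_cofiberSequence {A B : S.Ho} (u : A ⟶ B) :
    ∃ (C : S.Ho) (v : B ⟶ C) (w : C ⟶ S.suspensionHo.obj A), S.IsCofiberSequence u v w := by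
  obtain ⟨T, x, w, hw, h⟩ := S.exists_fraction (A := A.as.obj) (B := B.as.obj) u
  have := S.isIso_map_Q hw
  let b : B ≅ S.E.Q.obj T := Localization.Construction.wIso w hw
  refine ⟨_, b.hom ≫ S.E.Q.map (S.coneIncl x), S.coneProjHo x, _, _, x, Iso.refl _, b, Iso.refl _,
    ?_, ?_, ?_⟩
  · exact h.trans (Category.id_comp _).symm
  · exact Category.comp_id _
  · exact (congrArg (fun k => _ ≫ k) (S.suspensionHo.map_id _)).trans ((Category.comp_id _).trans
      (Category.id_comp _).symm)

/-- The exchange of the two cones of the double cone. -/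
noncomputable def doubleConeSwap (X : SimplicialObject D) : doubleCone X ⟶ doubleCone X :=
  Cyl.desc (Cyl.inX (𝟙 X) (toPoint X) ≫ Cyl.inY _ _)
    (Cyl.map (𝟙 X) (inclCone X) (𝟙 _) (by simp) (point_hom_ext _ _))
    (Cyl.inZ (𝟙 X) (toPoint X) ≫ Cyl.inY _ _)
    (by rw [Cyl.face_zero_assoc, Category.id_comp, Cyl.inY_map]) (by rw [Cyl.face_one_assoc])

lemma doubleConeSwap_swap (X : SimplicialObject D) :
    doubleConeSwap X ≫ doubleConeSwap X = 𝟙 _ := by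
  refine Cyl.hom_ext ?_ (Cyl.hom_ext ?_ ?_ ?_) ?_ <;> simp [doubleConeSwap]

/-- Exchanging the cones turns `P₁` into `P₂`, so facts on `P₂` are deduced from those on `P₁`. -/
lemma doubleConeSwap_fst (X : SimplicialObject D) :
    doubleConeSwap X ≫ doubleConeFst X = doubleConeSnd X := by
  refine Cyl.hom_ext ?_ (Cyl.hom_ext ?_ ?_ ?_) ?_ <;>
    simp [doubleConeSwap, doubleConeFst, doubleConeSnd, simplicialConeProj]

lemma doubleConeSwap_snd (X : SimplicialObject D) :
    doubleConeSwap X ≫ doubleConeSnd X = doubleConeFst X := by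
  rw [← doubleConeSwap_fst, ← Category.assoc, doubleConeSwap_swap, Category.id_comp]

/-- Functoriality of the double cone. -/
noncomputable def doubleConeMap {X X' : SimplicialObject D} (a : X ⟶ X') :
    doubleCone X ⟶ doubleCone X' :=
  simplicialConeMap a (simplicialConeMap a a (by simp))
    (Cyl.inY_map a a (𝟙 _) (by simp) (point_hom_ext _ _))

lemma doubleConeFst_naturality {X X' : SimplicialObject D} (a : X ⟶ X') :
    doubleConeFst X ≫ (simplicialSuspensionFunctor D).map a =
      doubleConeMap a ≫ doubleConeFst X' :=
  simplicialConeProj_map (Cyl.inY_map a a (𝟙 _) (by simp) (point_hom_ext _ _))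

lemma doubleConeSwap_naturality {X X' : SimplicialObject D} (a : X ⟶ X') :
    doubleConeSwap X ≫ doubleConeMap a = doubleConeMap a ≫ doubleConeSwap X' := by
  refine Cyl.hom_ext ?_ (Cyl.hom_ext ?_ ?_ ?_) ?_ <;> simp [doubleConeSwap, doubleConeMap]

lemma doubleConeSnd_naturality {X X' : SimplicialObject D} (a : X ⟶ X') :
    doubleConeSnd X ≫ (simplicialSuspensionFunctor D).map a =
      doubleConeMap a ≫ doubleConeSnd X' := by
  have h := doubleConeFst_naturality a
  have h' := doubleConeSwap_naturality a
  rw [← doubleConeSwap_fst, ← doubleConeSwap_fst]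
  exact ((CommSq.mk h'.symm).vert_comp (CommSq.mk h.symm)).w.symm

/-- `P₁` only collapses the cone `CB`, whose simple is acyclic. -/
lemma doubleSuspensionFst_mem (B : D) : S.E (S.doubleSuspensionFst B) :=
  S.simple_cylMap_mem _ _ _ (point_hom_ext _ _) (point_hom_ext _ _) (S.simple_id_mem _)
    (S.simple_toPoint_mem (S.acyclic_simple_cone_id _)) (S.simple_id_mem _)

/-- The exchange of the two cones of the double suspension. -/
noncomputable def doubleSuspensionSwap (B : D) : S.doubleSuspension B ⟶ S.doubleSuspension B :=
  S.s.map (doubleConeSwap _)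

lemma doubleSuspensionSwap_fst (B : D) :
    S.doubleSuspensionSwap B ≫ S.doubleSuspensionFst B = S.doubleSuspensionSnd B :=
  (S.s.map_comp _ _).symm.trans (congrArg S.s.map (doubleConeSwap_fst _))

lemma doubleSuspensionSwap_snd (B : D) :
    S.doubleSuspensionSwap B ≫ S.doubleSuspensionSnd B = S.doubleSuspensionFst B :=
  (S.s.map_comp _ _).symm.trans (congrArg S.s.map (doubleConeSwap_snd _))

/-- Functoriality of the double suspension. -/
noncomputable def doubleSuspensionMap {B B' : D} (f : B ⟶ B') :
    S.doubleSuspension B ⟶ S.doubleSuspension B' :=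
  S.s.map (doubleConeMap ((SimplicialObject.const D).map f))

lemma doubleSuspensionFst_naturality {B B' : D} (f : B ⟶ B') :
    S.doubleSuspensionFst B ≫ S.suspension.map f =
      S.doubleSuspensionMap f ≫ S.doubleSuspensionFst B' :=
  (S.s.map_comp _ _).symm.trans ((congrArg S.s.map (doubleConeFst_naturality _)).trans
      (S.s.map_comp _ _))

lemma doubleSuspensionSnd_naturality {B B' : D} (f : B ⟶ B') :
    S.doubleSuspensionSnd B ≫ S.suspension.map f =
      S.doubleSuspensionMap f ≫ S.doubleSuspensionSnd B' :=
  (S.s.map_comp _ _).symm.trans ((congrArg S.s.map (doubleConeSnd_naturality _)).trans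
      (S.s.map_comp _ _))

/-- The sign `p₂ p₁⁻¹` of a suspension. -/
noncomputable def signApp (B : D) :
    S.E.Q.obj (S.suspension.obj B) ⟶ S.E.Q.obj (S.suspension.obj B) :=
  (Localization.Construction.wIso _ (S.doubleSuspensionFst_mem B)).inv ≫
    S.E.Q.map (S.doubleSuspensionSnd B)

lemma fst_signApp (B : D) :
    S.E.Q.map (S.doubleSuspensionFst B) ≫ S.signApp B = S.E.Q.map (S.doubleSuspensionSnd B) :=
  (Localization.Construction.wIso _ (S.doubleSuspensionFst_mem B)).hom_inv_id_assoc _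

/-- This is `fst_signApp` precomposed with the exchange of the cones; the two identities together
show that the sign is an involution. -/
lemma snd_signApp (B : D) :
    S.E.Q.map (S.doubleSuspensionSnd B) ≫ S.signApp B = S.E.Q.map (S.doubleSuspensionFst B) := by
  rw [← doubleSuspensionSwap_fst, S.E.Q.map_comp, Category.assoc, fst_signApp, ← S.E.Q.map_comp,
    doubleSuspensionSwap_snd]

lemma signApp_signApp (B : D) : S.signApp B ≫ S.signApp B = 𝟙 _ := by
  have := S.isIso_map_Q (S.doubleSuspensionFst_mem B)
  rw [← cancel_epi (S.E.Q.map (S.doubleSuspensionFst B)), reassoc_of% (S.fst_signApp B),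
    snd_signApp, Category.comp_id]

lemma signApp_naturality {B B' : D} (f : B ⟶ B') :
    S.E.Q.map (S.suspension.map f) ≫ S.signApp B' =
      S.signApp B ≫ S.E.Q.map (S.suspension.map f) := by
  have := S.isIso_map_Q (S.doubleSuspensionFst_mem B)
  rw [← cancel_epi (S.E.Q.map (S.doubleSuspensionFst B)), reassoc_of% (S.fst_signApp B),
    ← S.E.Q.map_comp_assoc, doubleSuspensionFst_naturality, S.E.Q.map_comp, Category.assoc,
    fst_signApp, ← S.E.Q.map_comp, ← S.E.Q.map_comp, doubleSuspensionSnd_naturality]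

/-- The sign of the suspension functor. -/
noncomputable def sign : S.suspensionHo ⟶ S.suspensionHo :=
  Localization.Construction.natTransExtension (W := S.E)
    { app := fun B => S.signApp B
      naturality := fun B B' f => by
        refine (congrArg (fun k => k ≫ S.signApp B') (S.suspensionHo_map_Q f)).trans
          ((S.signApp_naturality f).trans ?_)
        exact congrArg (fun k => S.signApp B ≫ k) (S.suspensionHo_map_Q f).symm }

lemma sign_app (B : D) : S.sign.app (S.E.Q.obj B) = S.signApp B :=
  Localization.Construction.NatTransExtension.app_eq _ B

lemma sign_sign : S.sign ≫ S.sign = 𝟙 S.suspensionHo := by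
  refine NatTrans.ext (funext fun X => ?_)
  have h := S.sign_app X.as.obj
  exact (congr (congrArg (fun a b => a ≫ b) h) h).trans (S.signApp_signApp X.as.obj)

end TriangulatedAxioms

/-! ### TR2: rotation of cofiber sequences -/

section Rotation

variable {A B : D} (f : A ⟶ B)

/-- The cone of `B ⟶ C(f)` is equivalent to the suspension of `A`. -/
noncomputable def coneInclConeToSuspension {X Y : SimplicialObject D} (F : X ⟶ Y) :
    simplicialCone (Cyl.inY F (toPoint X)) ⟶ simplicialSuspension X :=
  (coneInYIso F (toPoint X)).inv ≫
    Cyl.map (𝟙 X) (toPoint _) (𝟙 _) (point_hom_ext _ _) (point_hom_ext _ _)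

lemma simple_coneInclConeToSuspension_mem {X Y : SimplicialObject D} (F : X ⟶ Y) :
    S.E (S.s.map (coneInclConeToSuspension F)) := by
  rw [coneInclConeToSuspension, S.s.map_comp]
  exact S.E.comp_mem _ _ (S.mem_of_isIso _) (S.simple_cylMap_mem _ _ _ _ _ (S.simple_id_mem _)
    (S.simple_toPoint_mem (S.acyclic_simple_cone_id _)) (S.simple_id_mem _))

lemma inY_coneInclConeToSuspension {X Y : SimplicialObject D} (F : X ⟶ Y) :
    Cyl.inY (Cyl.inY F (toPoint X)) (toPoint Y) ≫ coneInclConeToSuspension F =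
      simplicialConeProj F := by
  simp only [coneInclConeToSuspension, coneInYIso, Cyl.inY_desc_assoc, Cyl.map_comp,
    simplicialConeProj]
  congr 1
  · exact Category.comp_id _
  · exact comp_toPoint _
  · exact Category.comp_id _

/-- The map from the cone of `B ⟶ C(f)` to the double cone of `B`. -/
noncomputable def coneInclConeToDoubleCone {X Y : SimplicialObject D} (F : X ⟶ Y) :
    simplicialCone (Cyl.inY F (toPoint X)) ⟶ doubleCone Y :=
  simplicialConeMap (𝟙 Y) (simplicialConeMap F (𝟙 Y) (by simp)) (by simp)

lemma coneInclConeToDoubleCone_fst {X Y : SimplicialObject D} (F : X ⟶ Y) :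
    coneInclConeToDoubleCone F ≫ doubleConeFst Y =
      simplicialConeProj (Cyl.inY F (toPoint X)) := by
  rw [coneInclConeToDoubleCone, doubleConeFst, simplicialConeProj, Cyl.map_comp,
    simplicialConeProj]
  congr 1
  · exact Category.comp_id _
  · exact point_hom_ext _ _
  · exact Category.comp_id _

/-- Both composites collapse the outer cone on `Y` and apply `F` to the cone on `X`. -/
lemma coneInclConeToDoubleCone_snd {X Y : SimplicialObject D} (F : X ⟶ Y) :
    coneInclConeToDoubleCone F ≫ doubleConeSnd Y =
      coneInclConeToSuspension F ≫ (simplicialSuspensionFunctor D).map F := by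
  change _ = coneInclConeToSuspension F ≫ simplicialConeMap F (𝟙 _) (point_hom_ext _ _)
  refine Cyl.hom_ext ?_ (Cyl.hom_ext ?_ ?_ ?_) ?_ <;>
    simp [coneInclConeToSuspension, coneInclConeToDoubleCone, doubleConeSnd, simplicialConeProj,
      coneInYIso]

/-- The triangle of `I : B ⟶ C(f)` is used, with the cone of `I` replaced by `ΣA` through the
collapse of the cone on `B`. One map `τ` to the double suspension gives the connecting map after
`p₁`, and the collapse followed by `Σf` after `p₂`; hence the two differ by the sign. -/
lemma isCofiberSequence_rotate :
    S.IsCofiberSequence (S.E.Q.map (S.coneIncl f)) (S.coneProjHo f)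
      (S.suspensionHo.map (S.E.Q.map f) ≫ S.sign.app (S.E.Q.obj B)) := by
  let F := (SimplicialObject.const D).map f
  let I := Cyl.inY F (toPoint _)
  let c : S.E.Q.obj (S.s.obj (simplicialCone I)) ≅ S.E.Q.obj (S.suspension.obj A) :=
    Localization.Construction.wIso _ (S.simple_coneInclConeToSuspension_mem F)
  refine (S.isCofiberSequence_simple_const I).of_iso (Iso.refl _) (Iso.refl _) c ?_ ?_ ?_
  · exact (Category.comp_id _).trans (Category.id_comp _).symm
  · refine Eq.trans ?_ (Category.id_comp _).symm
    refine (S.E.Q.map_comp _ _).symm.trans (congrArg S.E.Q.map ?_)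
    exact (S.s.map_comp _ _).symm.trans (congrArg S.s.map (inY_coneInclConeToSuspension F))
  · refine (congrArg (fun k => _ ≫ k) (S.suspensionHo.map_id _)).trans
      ((Category.comp_id _).trans ?_)
    obtain ⟨τ, h₁, h₂⟩ : ∃ τ : S.s.obj (simplicialCone I) ⟶ S.doubleSuspension B,
        τ ≫ S.doubleSuspensionFst B = S.s.map (simplicialConeProj I) ∧
        τ ≫ S.doubleSuspensionSnd B =
          S.s.map (coneInclConeToSuspension F) ≫ S.suspension.map f :=
      ⟨S.s.map (coneInclConeToDoubleCone F),
        (S.s.map_comp _ _).symm.trans (congrArg S.s.map (coneInclConeToDoubleCone_fst F)),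
        (S.s.map_comp _ _).symm.trans ((congrArg S.s.map (coneInclConeToDoubleCone_snd F)).trans
        (S.s.map_comp _ _))⟩
    rw [suspensionHo_map_Q, sign_app]
    have h₃ : S.E.Q.map (S.s.map (coneInclConeToSuspension F)) ≫
        S.E.Q.map (S.suspension.map f) ≫ S.signApp B = S.E.Q.map τ ≫
          S.E.Q.map (S.doubleSuspensionSnd B) ≫ S.signApp B := by
      rw [← S.E.Q.map_comp_assoc τ, h₂]
      exact (Category.assoc _ _ _).symm.trans (congrArg (fun k => k ≫ S.signApp B)
        (S.E.Q.map_comp _ _).symm)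
    refine Eq.trans ?_ h₃.symm
    rw [snd_signApp, ← S.E.Q.map_comp, h₁]
    rfl

lemma IsCofiberSequence.rotate {A B C : S.Ho} {u : A ⟶ B} {v : B ⟶ C}
    {w : C ⟶ S.suspensionHo.obj A} (h : S.IsCofiberSequence u v w) :
    S.IsCofiberSequence v w (S.suspensionHo.map u ≫ S.sign.app B) := by
  obtain ⟨A₀, B₀, f, a, b, c, h₁, h₂, h₃⟩ := h
  refine (S.isCofiberSequence_rotate f).of_iso b.symm c.symm (S.suspensionHo.mapIso a.symm)
    ?_ ?_ ?_
  · rw [Iso.symm_hom, Iso.symm_hom, Iso.eq_inv_comp, ← reassoc_of% h₂, Iso.hom_inv_id,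
      Category.comp_id]
  · rw [Iso.symm_hom, Functor.mapIso_hom, Iso.symm_hom, Iso.eq_inv_comp, ← reassoc_of% h₃,
      ← S.suspensionHo.map_comp, Iso.hom_inv_id, S.suspensionHo.map_id, Category.comp_id]
  · rw [Functor.mapIso_hom, Iso.symm_hom, Iso.symm_hom, Category.assoc, ← S.sign.naturality,
      ← S.suspensionHo.map_comp_assoc, ← S.suspensionHo.map_comp_assoc]
    congr 2
    rw [Iso.eq_inv_comp, ← reassoc_of% h₁, Iso.hom_inv_id, Category.comp_id]

end Rotation

end SimplicialDescentStructure

/-! ### Cones of coproducts with an identity -/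

namespace SimplicialDescent

section

variable {D : Type u} [Category.{v} D]

/-- The morphisms `i` and `j` exhibit their target as a coproduct. -/
structure IsCoprod {B N P : D} (i : B ⟶ P) (j : N ⟶ P) : Prop where
  exists_desc : ∀ ⦃Q : D⦄ (a : B ⟶ Q) (b : N ⟶ Q), ∃ h : P ⟶ Q, i ≫ h = a ∧ j ≫ h = b
  hom_ext : ∀ ⦃Q : D⦄ ⦃h h' : P ⟶ Q⦄, i ≫ h = i ≫ h' → j ≫ h = j ≫ h' → h = h'

variable [HasFiniteCoproducts D]

/-- The part of `Cyl(f, g)_n` which is complementary to `Y_n`. -/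
noncomputable def Cyl.complement {X Y Z : SimplicialObject D} (f : X ⟶ Y) (g : X ⟶ Z)
    (n : SimplexCategoryᵒᵖ) : (Z.obj n ⨿ ∐ fun _ : Cyl.Inner n => X.obj n) ⟶ (Cyl f g).obj n :=
  coprod.desc ((Cyl.inZ f g).app n) (Sigma.desc fun t => cylinderι X t.1 ≫ (Cyl.inX f g).app n)

lemma Cyl.isCoprod {X Y Z : SimplicialObject D} (f : X ⟶ Y) (g : X ⟶ Z)
    (n : SimplexCategoryᵒᵖ) : IsCoprod ((Cyl.inY f g).app n) (Cyl.complement f g n) where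
  exists_desc Q a b := by
    obtain ⟨h, ⟨h₁, h₂⟩, -⟩ := Cyl.isCopower f g n (coprod.desc a (coprod.inl ≫ b))
      fun t => Sigma.ι (fun _ : Cyl.Inner n => X.obj n) t ≫ coprod.inr ≫ b
    refine ⟨h, ?_, ?_⟩
    · rw [← coprod.inl_desc ((Cyl.inY f g).app n) ((Cyl.inZ f g).app n), Category.assoc, h₁,
        coprod.inl_desc]
    · refine coprod.hom_ext ?_ (Sigma.hom_ext _ _ fun t => ?_)
      · rw [Cyl.complement, coprod.inl_desc_assoc,
          ← coprod.inr_desc ((Cyl.inY f g).app n) ((Cyl.inZ f g).app n), Category.assoc, h₁,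
          coprod.inr_desc]
      · rw [Cyl.complement, coprod.inr_desc_assoc, ← h₂ t, ← Category.assoc]
        exact congrArg (fun k => k ≫ h) (Sigma.ι_desc _ _)
  hom_ext Q h h' h₁ h₂ := by
    refine (Cyl.isCopower f g n (coprod.desc ((Cyl.inY f g).app n) ((Cyl.inZ f g).app n) ≫ h)
      (fun t => (cylinderι X t.1 ≫ (Cyl.inX f g).app n) ≫ h)).unique ⟨rfl, fun _ => rfl⟩
        ⟨coprod.hom_ext ?_ ?_, fun t => ?_⟩
    · rw [coprod.inl_desc_assoc, coprod.inl_desc_assoc, h₁]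
    · have := congrArg (fun k => coprod.inl ≫ k) h₂
      rw [Cyl.complement, coprod.inl_desc_assoc, coprod.inl_desc_assoc] at this
      rw [coprod.inr_desc_assoc, coprod.inr_desc_assoc, this]
    · have := congrArg (fun k => Sigma.ι (fun _ : Cyl.Inner n => X.obj n) t ≫ coprod.inr ≫ k) h₂
      rw [Cyl.complement, coprod.inr_desc_assoc, coprod.inr_desc_assoc, ← Category.assoc,
        ← Category.assoc] at this
      have e := Sigma.ι_desc (fun t : Cyl.Inner n => cylinderι X t.1 ≫ (Cyl.inX f g).app n) t
      exact ((congrArg (fun k => k ≫ h) e).symm.trans this).trans (congrArg (fun k => k ≫ h') e)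
        |>.symm

/-- The complement of `Y_n` does not involve `Y`. So a map of cylinders which changes only that
corner is, in each degree, the coproduct of `b` with an identity. -/
lemma Cyl.complement_map {X Y Y' Z : SimplicialObject D} {f : X ⟶ Y} {f' : X ⟶ Y'} (g : X ⟶ Z)
    (b : Y ⟶ Y') (h : f ≫ b = 𝟙 X ≫ f') (n : SimplexCategoryᵒᵖ) :
    Cyl.complement f g n ≫ (Cyl.map (𝟙 X) b (𝟙 Z) h (by simp) : Cyl f g ⟶ Cyl f' g).app n =
      Cyl.complement f' g n := by
  refine coprod.hom_ext ?_ (Sigma.hom_ext _ _ fun t => ?_)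
  · rw [Cyl.complement, Cyl.complement, coprod.inl_desc_assoc, coprod.inl_desc, Cyl.inZ_map_app]
    exact Category.id_comp _
  · rw [Cyl.complement, Cyl.complement, coprod.inr_desc_assoc, coprod.inr_desc, ← Category.assoc]
    have e := Sigma.ι_desc (fun t : Cyl.Inner n => cylinderι X t.1 ≫ (Cyl.inX f g).app n) t
    have e' := Sigma.ι_desc (fun t : Cyl.Inner n => cylinderι X t.1 ≫ (Cyl.inX f' g).app n) t
    refine (congrArg (fun k => k ≫ _) e).trans (Eq.trans ?_ e'.symm)
    rw [Category.assoc, Cyl.inX_map_app]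
    exact Category.id_comp _

end

lemma cylinderι_cylinderMap_comp_app {D : Type u} [Category.{v} D] [HasFiniteCoproducts D]
    {X X' T : SimplicialObject D} (h : X ⟶ X') (k : cylinder X' ⟶ T) {n : SimplexCategoryᵒᵖ}
    (θ : n.unop ⟶ ⦋1⦌) : cylinderι X θ ≫ (cylinderMap h ≫ k).app n =
      h.app n ≫ cylinderι X' θ ≫ k.app n := by
  simp [cylinderMap]

section ConeCoprod

variable {D : Type u} [Category.{v} D] [HasFiniteCoproducts D] [HasTerminal D]
  {B C N P P' : D} {i : B ⟶ P} {j : N ⟶ P} {i' : C ⟶ P'} {j' : N ⟶ P'} {g : B ⟶ C} {α : P ⟶ P'}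
  (hi : i ≫ α = g ≫ i') (hj : j ≫ α = j')

/-- The cone of `g` with the cone of the identity of `N` attached at the base point. -/
noncomputable abbrev coneWedge (g : B ⟶ C) (N : D) : SimplicialObject D :=
  Cyl ((SimplicialObject.const D).map g)
    (toPoint _ ≫ Cyl.inZ (𝟙 ((SimplicialObject.const D).obj N)) (toPoint _))

/-- The comparison of a wedge of cones with the cone of `g ⊔ 1`. -/
noncomputable def coneWedgeMap :
    coneWedge g N ⟶ simplicialCone ((SimplicialObject.const D).map α) :=
  Cyl.desc (cylinderMap ((SimplicialObject.const D).map i) ≫ Cyl.inX _ _)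
    ((SimplicialObject.const D).map i' ≫ Cyl.inY _ _)
    (simplicialConeMap ((SimplicialObject.const D).map j) ((SimplicialObject.const D).map j')
      (by rw [← Functor.map_comp, hj, Category.id_comp]))
    (by rw [cylinderFace_map_assoc, Cyl.face_zero, ← Functor.map_comp_assoc, hi,
      Functor.map_comp_assoc])
    (by rw [cylinderFace_map_assoc, Cyl.face_one, Category.assoc, Cyl.inZ_map, comp_toPoint_assoc,
      Category.id_comp])

/-- The inclusion of the cone of `g` in the wedge. -/
noncomputable def coneToWedge (g : B ⟶ C) (N : D) :
    simplicialCone ((SimplicialObject.const D).map g) ⟶ coneWedge g N :=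
  Cyl.map (𝟙 _) (𝟙 _) (Cyl.inZ _ _) (by simp) (by simp)

lemma coneWedgeMap_comp :
    coneToWedge g N ≫ coneWedgeMap hi hj =
      simplicialConeMap ((SimplicialObject.const D).map i) ((SimplicialObject.const D).map i')
        (by rw [← Functor.map_comp, ← Functor.map_comp, hi]) := by
  refine Cyl.hom_ext ?_ ?_ ?_ <;> simp [coneWedgeMap, coneToWedge]

/-- The cone of `g ⊔ 1` is the cone of `g` and the cone of `1` glued at their common vertex; in each
degree the two sides are the same summands grouped differently. -/
lemma coneWedgeMap_isIso (h : IsCoprod i j) (h' : IsCoprod i' j') :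
    IsIso (coneWedgeMap hi hj) := by
  have : ∀ n, IsIso ((coneWedgeMap hi hj).app n) := by
    intro n
    let K := coneWedge g N
    let G := (SimplicialObject.const D).map g
    let tN := toPoint ((SimplicialObject.const D).obj N)
    let G' := toPoint ((SimplicialObject.const D).obj B) ≫ Cyl.inZ (𝟙 ((SimplicialObject.const D).obj N)) tN
    let iN := Cyl.inZ (X := (SimplicialObject.const D).obj B) G G'
    let iB := Cyl.inY (X := (SimplicialObject.const D).obj B) G G'
    let xB := Cyl.inX (X := (SimplicialObject.const D).obj B) G G'
    let xN := Cyl.inX (𝟙 ((SimplicialObject.const D).obj N)) tN ≫ iN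
    let yN := Cyl.inY (𝟙 ((SimplicialObject.const D).obj N)) tN ≫ iN
    let zN := Cyl.inZ (𝟙 ((SimplicialObject.const D).obj N)) tN ≫ iN
    -- The inverse sends the copy of `P` at `θ`, split into `B` and `N`, to the copies at `θ` in the
    -- two cones. The identities `e₁` to `e₄` give compatibility at the two constant simplices.
    choose k hk hk' using fun θ : n.unop ⟶ ⦋1⦌ => h.exists_desc
      (cylinderι ((SimplicialObject.const D).obj B) θ ≫ xB.app n)
      (cylinderι ((SimplicialObject.const D).obj N) θ ≫ xN.app n)
    obtain ⟨y, hy, hy'⟩ := h'.exists_desc (iB.app n) (yN.app n)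
    have e₁ : cylinderι ((SimplicialObject.const D).obj B) (vertex n.unop 0) ≫ xB.app n =
        g ≫ iB.app n := congrArg (fun k => k.app n) (Cyl.face_zero G G')
    have e₂ : cylinderι ((SimplicialObject.const D).obj N) (vertex n.unop 0) ≫ xN.app n =
        yN.app n := congrArg (fun k => k.app n) ((Cyl.face_zero_assoc (f := 𝟙 ((SimplicialObject.const D).obj N)) (g := tN) iN).trans (Category.id_comp _))
    have e₃ : cylinderι ((SimplicialObject.const D).obj B) (vertex n.unop 1) ≫ xB.app n =
        terminal.from B ≫ zN.app n := congrArg (fun k => k.app n) ((Cyl.face_one G G').trans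
          (Category.assoc _ _ _))
    have e₄ : cylinderι ((SimplicialObject.const D).obj N) (vertex n.unop 1) ≫ xN.app n =
        terminal.from N ≫ zN.app n := congrArg (fun k => k.app n) (Cyl.face_one_assoc (f := 𝟙 ((SimplicialObject.const D).obj N)) (g := tN) iN)
    obtain ⟨q, hqX, hqY, hqZ⟩ := Cyl.exists_appDesc (f := (SimplicialObject.const D).map α)
      (g := toPoint _) (n := n) k y (zN.app n)
      (by
        refine h.hom_ext ?_ ?_
        · rw [hk, e₁]
          refine Eq.trans ?_ (Category.assoc _ _ _)
          refine Eq.trans ?_ (congrArg (fun k => k ≫ y) hi.symm)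
          rw [Category.assoc, hy]
        · rw [hk', e₂]
          refine Eq.trans ?_ (Category.assoc _ _ _)
          refine Eq.trans ?_ (congrArg (fun k => k ≫ y) hj.symm)
          exact hy'.symm)
      (by
        refine h.hom_ext ?_ ?_
        · rw [hk, e₃]
          refine Eq.trans ?_ (Category.assoc _ _ _)
          exact congrArg (fun k => k ≫ zN.app n) (Subsingleton.elim (α := _ ⟶ ⊤_ D) _ _)
        · rw [hk', e₄]
          refine Eq.trans ?_ (Category.assoc _ _ _)
          exact congrArg (fun k => k ≫ zN.app n) (Subsingleton.elim (α := _ ⟶ ⊤_ D) _ _))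
    let A := (SimplicialObject.const D).map α
    let tP := toPoint ((SimplicialObject.const D).obj P)
    let J := simplicialConeMap (F := 𝟙 ((SimplicialObject.const D).obj N)) (F' := A)
      ((SimplicialObject.const D).map j) ((SimplicialObject.const D).map j')
        (by rw [← Functor.map_comp, hj, Category.id_comp])
    have M₁ : Cyl.inX G G' ≫ coneWedgeMap hi hj =
      cylinderMap ((SimplicialObject.const D).map i) ≫ Cyl.inX A tP := Cyl.inX_desc _ _ _ _ _
    have M₂ : iB ≫ coneWedgeMap hi hj = (SimplicialObject.const D).map i' ≫ Cyl.inY A tP :=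
      Cyl.inY_desc _ _ _ _ _
    have M₃ : iN ≫ coneWedgeMap hi hj = J := Cyl.inZ_desc _ _ _ _ _
    have M₄ : xN ≫ coneWedgeMap hi hj =
        cylinderMap ((SimplicialObject.const D).map j) ≫ Cyl.inX A tP :=
      (Category.assoc _ _ _).trans ((congrArg (fun k => Cyl.inX _ tN ≫ k) M₃).trans
        (Cyl.inX_map _ _ _ _ _))
    have M₅ : yN ≫ coneWedgeMap hi hj = (SimplicialObject.const D).map j' ≫ Cyl.inY A tP :=
      (Category.assoc _ _ _).trans ((congrArg (fun k => Cyl.inY _ tN ≫ k) M₃).trans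
        (Cyl.inY_map _ _ _ _ _))
    have M₆ : zN ≫ coneWedgeMap hi hj = Cyl.inZ A tP :=
      (Category.assoc _ _ _).trans ((congrArg (fun k => Cyl.inZ _ tN ≫ k) M₃).trans
        ((Cyl.inZ_map _ _ _ _ _).trans (Category.id_comp _)))
    have m₁ : ∀ θ, cylinderι ((SimplicialObject.const D).obj B) θ ≫ xB.app n ≫
        (coneWedgeMap hi hj).app n = i ≫ cylinderι ((SimplicialObject.const D).obj P) θ ≫
          (Cyl.inX A tP).app n := fun θ =>
      (congrArg (fun k => cylinderι ((SimplicialObject.const D).obj B) θ ≫ k.app n) M₁).trans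
        (cylinderι_cylinderMap_comp_app _ _ _)
    have m₂ : iB.app n ≫ (coneWedgeMap hi hj).app n = i' ≫ (Cyl.inY A tP).app n :=
      congrArg (fun k => k.app n) M₂
    have m₄ : ∀ θ, cylinderι ((SimplicialObject.const D).obj N) θ ≫ xN.app n ≫
        (coneWedgeMap hi hj).app n = j ≫ cylinderι ((SimplicialObject.const D).obj P) θ ≫
          (Cyl.inX A tP).app n := fun θ =>
      (congrArg (fun k => cylinderι ((SimplicialObject.const D).obj N) θ ≫ k.app n) M₄).trans
        (cylinderι_cylinderMap_comp_app _ _ _)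
    have m₅ : yN.app n ≫ (coneWedgeMap hi hj).app n = j' ≫ (Cyl.inY A tP).app n :=
      congrArg (fun k => k.app n) M₅
    have m₆ : zN.app n ≫ (coneWedgeMap hi hj).app n = (Cyl.inZ A tP).app n :=
      congrArg (fun k => k.app n) M₆
    -- The two composites are tested on one generator at a time: `e` is a summand of the wedge, `d`
    -- one of the cone, and `r` relates their sources.
    have back : ∀ {T U : D} {e : T ⟶ K.obj n} {r : T ⟶ U}
        {d : U ⟶ (simplicialCone ((SimplicialObject.const D).map α)).obj n} {d' : U ⟶ K.obj n},
        e ≫ (coneWedgeMap hi hj).app n = r ≫ d → d ≫ q = d' → r ≫ d' = e →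
        e ≫ (coneWedgeMap hi hj).app n ≫ q = e ≫ 𝟙 _ := by
      intro T U e r d d' h₁ h₂ h₃
      rw [← Category.assoc, h₁, Category.assoc, h₂, h₃, Category.comp_id]
    have forth : ∀ {T U : D} {e : T ⟶ K.obj n} {r : T ⟶ U}
        {d : U ⟶ (simplicialCone ((SimplicialObject.const D).map α)).obj n} {d' : U ⟶ K.obj n},
        e ≫ (coneWedgeMap hi hj).app n = r ≫ d → d ≫ q = d' → r ≫ d' = e →
        r ≫ d ≫ q ≫ (coneWedgeMap hi hj).app n = r ≫ d ≫ 𝟙 _ := by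
      intro T U e r d d' h₁ h₂ h₃
      rw [← Category.assoc d, h₂, ← Category.assoc, h₃, h₁, Category.comp_id]
    have as : ∀ {T U V W : D} {a : T ⟶ U} {b : U ⟶ V} {c : V ⟶ W} {d : T ⟶ W},
        a ≫ b ≫ c = d → (a ≫ b) ≫ c = d := fun h => (Category.assoc _ _ _).trans h
    refine ⟨q, ?_, ?_⟩
    · refine Cyl.app_hom_ext (fun θ => ?_) ?_ (Cyl.app_hom_ext (fun θ => ?_) ?_ ?_)
      · exact ((Category.assoc _ _ _).symm.trans (back (as (m₁ θ)) (as (hqX θ)) (hk θ))).trans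
          (Category.assoc _ _ _)
      · exact back m₂ hqY hy
      · exact (congrArg (fun k => cylinderι ((SimplicialObject.const D).obj N) θ ≫ k)
          (Category.assoc _ _ _).symm).trans (((Category.assoc _ _ _).symm.trans
          (back (as (m₄ θ)) (as (hqX θ)) (hk' θ))).trans ((Category.assoc _ _ _).trans
            (congrArg (fun k => cylinderι ((SimplicialObject.const D).obj N) θ ≫ k)
              (Category.assoc _ _ _))))
      · exact ((Category.assoc _ _ _).symm.trans (back m₅ hqY hy')).trans (Category.assoc _ _ _)
      · exact ((Category.assoc _ _ _).symm.trans (back (m₆.trans (Category.id_comp _).symm) hqZ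
          (Category.id_comp _))).trans (Category.assoc _ _ _)
    · refine Cyl.app_hom_ext (fun θ => h.hom_ext ?_ ?_) (h'.hom_ext ?_ ?_) ?_
      · exact (congrArg (fun k => i ≫ k) (Category.assoc _ _ _).symm).trans
          ((forth (as (m₁ θ)) (as (hqX θ)) (hk θ)).trans
            (congrArg (fun k => i ≫ k) (Category.assoc _ _ _)))
      · exact (congrArg (fun k => j ≫ k) (Category.assoc _ _ _).symm).trans
          ((forth (as (m₄ θ)) (as (hqX θ)) (hk' θ)).trans
            (congrArg (fun k => j ≫ k) (Category.assoc _ _ _)))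
      · exact forth m₂ hqY hy
      · exact forth m₅ hqY hy'
      · exact (Category.id_comp _).symm.trans ((forth (m₆.trans (Category.id_comp _).symm) hqZ
          (Category.id_comp _)).trans (Category.id_comp _))
  exact NatIso.isIso_of_isIso_app _

end ConeCoprod

end SimplicialDescent

namespace SimplicialDescentStructure

open SimplicialDescent

variable {D : Type u} [Category.{v} D] [HasFiniteCoproducts D] [HasTerminal D]
  (S : SimplicialDescentStructure D)

/-- Up to isomorphism the target is the cone of `g` with its vertex replaced by the cone of the
identity of `N`, whose simple is acyclic. -/
lemma simple_coneMap_mem_of_isCoprod {B C N P P' : D} {i : B ⟶ P} {j : N ⟶ P} {i' : C ⟶ P'}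
    {j' : N ⟶ P'} {g : B ⟶ C} {α : P ⟶ P'} (h : IsCoprod i j) (h' : IsCoprod i' j')
    (hi : i ≫ α = g ≫ i') (hj : j ≫ α = j') : S.E (S.coneMap i i' hi.symm) := by
  have e := coneWedgeMap_comp hi hj
  have := coneWedgeMap_isIso hi hj h h'
  have e' : S.coneMap i i' hi.symm = S.s.map (coneToWedge g N) ≫ S.s.map (coneWedgeMap hi hj) :=
    (congrArg S.s.map e).symm.trans (S.s.map_comp _ _)
  rw [e']
  refine S.E.comp_mem _ _ ?_ (S.mem_of_isIso _)
  exact S.simple_cylMap_mem _ _ _ _ _ (S.simple_id_mem _) (S.simple_id_mem _)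
    (S.mem_of_acyclic S.acyclic_point (S.acyclic_simple_cone_id _) _)

/-! ### TR4: the octahedron -/

section Octahedron

variable {X Y Z : SimplicialObject D} {F : X ⟶ Y} {G : Y ⟶ Z} {H : X ⟶ Z} (h : F ≫ G = H)

/-- The map `C(F) ⟶ C(GF)`. -/
noncomputable def octahedronFst : simplicialCone F ⟶ simplicialCone H :=
  simplicialConeMap (𝟙 X) G (by rw [h, Category.id_comp])

/-- The map `C(GF) ⟶ C(G)`. -/
noncomputable def octahedronSnd : simplicialCone H ⟶ simplicialCone G :=
  simplicialConeMap F (𝟙 Z) (by rw [h, Category.comp_id])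

/-- The map from `C(G)` to the cone of `C(F) ⟶ C(GF)`. -/
noncomputable def octahedronMap : simplicialCone G ⟶ simplicialCone (octahedronFst h) :=
  simplicialConeMap (Cyl.inY F (toPoint X)) (Cyl.inY H (toPoint X))
    (Cyl.inY_map (𝟙 X) G (𝟙 _) (by rw [h, Category.id_comp]) (point_hom_ext _ _)).symm

/-- One degree `m` at a time suffices. There `C(F) ⟶ C(GF)` is the coproduct of `G_m` with the
identity of a common complement, made of `∗` and copies of `X_m`. -/
lemma simple_octahedronMap_mem : S.E (S.s.map (octahedronMap h)) := by
  refine S.simple_cylMap_mem_of_levels (Cyl.inY F (toPoint X)) (Cyl.inY H (toPoint X)) (𝟙 _)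
    (Cyl.inY_map (𝟙 X) G (𝟙 _) (by rw [h, Category.id_comp]) (point_hom_ext _ _)).symm
    (point_hom_ext _ _) fun m => ?_
  exact S.simple_coneMap_mem_of_isCoprod (Cyl.isCoprod F (toPoint X) m)
    (Cyl.isCoprod H (toPoint X) m) (Cyl.inY_map_app _ _ _ _ _ m)
    (Cyl.complement_map (toPoint X) G (by rw [h, Category.id_comp]) m)

lemma inX_octahedronMap : Cyl.inX G (toPoint Y) ≫ octahedronMap h =
    cylinderMap (Cyl.inY F (toPoint X)) ≫ Cyl.inX (octahedronFst h) (toPoint _) :=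
  Cyl.inX_map _ _ _ (Cyl.inY_map (𝟙 X) G (𝟙 _) (by rw [h, Category.id_comp])
    (point_hom_ext _ _)).symm (point_hom_ext _ _)

lemma inY_octahedronMap : Cyl.inY G (toPoint Y) ≫ octahedronMap h =
    Cyl.inY H (toPoint X) ≫ Cyl.inY (octahedronFst h) (toPoint _) :=
  Cyl.inY_map _ _ _ (Cyl.inY_map (𝟙 X) G (𝟙 _) (by rw [h, Category.id_comp])
    (point_hom_ext _ _)).symm (point_hom_ext _ _)

lemma inZ_octahedronMap : Cyl.inZ G (toPoint Y) ≫ octahedronMap h =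
    Cyl.inZ (octahedronFst h) (toPoint _) :=
  (Cyl.inZ_map _ _ (𝟙 (point D)) (Cyl.inY_map (𝟙 X) G (𝟙 _) (by rw [h, Category.id_comp])
    (point_hom_ext _ _)).symm (point_hom_ext _ _)).trans (Category.id_comp _)

/-- There is a retraction of `C(G) ⟶ C(C(F) ⟶ C(GF))` which extends `C(GF) ⟶ C(G)`. -/
lemma exists_octahedron_retraction :
    ∃ δ : simplicialCone (octahedronFst h) ⟶ simplicialCone G,
      Cyl.inY (octahedronFst h) (toPoint _) ≫ δ = octahedronSnd h ∧
        octahedronMap h ≫ δ = 𝟙 _ := by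
  -- On the part coming from `X` the two cone coordinates are combined by their minimum. At the
  -- outer `d^0` end this gives the composite of `C(F) ⟶ C(GF)` and `C(GF) ⟶ C(G)`, and at the `d^1`
  -- end the constant map to the vertex of `C(G)`.
  obtain ⟨d, hX, hY, hZ⟩ := exists_cylinder_cyl_desc (f := F) (g := toPoint X)
    (T := simplicialCone G)
    (cylinderInf X ≫ cylinderMap F ≫ Cyl.inX G (toPoint Y)) (Cyl.inX G (toPoint Y))
    (cylinderProj (point D) ≫ Cyl.inZ G (toPoint Y))
    (by rw [← Category.assoc, map_face_zero_cylinderInf, Category.id_comp])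
    (by
      rw [← Category.assoc, map_face_one_cylinderInf, Category.assoc, cylinderFace_map_assoc,
        Cyl.face_one, comp_toPoint_assoc, comp_toPoint_assoc, cylinderMap_proj_assoc,
        comp_toPoint_assoc])
  refine ⟨Cyl.desc d (octahedronSnd h) (Cyl.inZ _ _) ?_ ?_, Cyl.inY_desc _ _ _ _ _, ?_⟩
  · refine Cyl.hom_ext ?_ ?_ ?_
    · rw [← cylinderFace_map_assoc, hX, ← Category.assoc, face_zero_cylinderInf]
      simp [octahedronFst, octahedronSnd]
    · rw [← cylinderFace_map_assoc, hY, Cyl.face_zero]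
      simp [octahedronFst, octahedronSnd]
    · rw [← cylinderFace_map_assoc, hZ]
      simp [octahedronFst, octahedronSnd]
  · refine Cyl.hom_ext ?_ ?_ ?_
    · rw [← cylinderFace_map_assoc, hX, ← Category.assoc, face_one_cylinderInf, Category.assoc,
        cylinderFace_map_assoc, Cyl.face_one]
      simp
    · rw [← cylinderFace_map_assoc, hY, Cyl.face_one]
      simp
    · rw [← cylinderFace_map_assoc, hZ]
      simp
  · refine Cyl.hom_ext ?_ ?_ ?_
    · rw [← Category.assoc, inX_octahedronMap, Category.assoc, Cyl.inX_desc, hY, Category.comp_id]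
    · rw [← Category.assoc, inY_octahedronMap, Category.assoc, Cyl.inY_desc, octahedronSnd]
      refine (Cyl.inY_map _ _ _ _ (point_hom_ext _ _)).trans ?_
      rw [Category.id_comp, Category.comp_id]
    · rw [← Category.assoc, inZ_octahedronMap, Cyl.inZ_desc, Category.comp_id]

/-- As a retraction of an equivalence, `δ` is one too, and it replaces the cone of `C(F) ⟶ C(GF)` by
`C(G)`. The connecting maps are compared after precomposition with `octahedronMap`, where naturality
of the projections `P` gives the result. -/
lemma isCofiberSequence_octahedron {A B C : D} (f : A ⟶ B) (g : B ⟶ C) :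
    S.IsCofiberSequence
      (S.E.Q.map (S.coneMap (f := f) (f' := f ≫ g) (𝟙 A) g (Category.id_comp _).symm))
      (S.E.Q.map (S.coneMap (f := f ≫ g) (f' := g) f (𝟙 C) (Category.comp_id _)))
      (S.coneProjHo g ≫ S.suspensionHo.map (S.E.Q.map (S.coneIncl f))) := by
  let F := (SimplicialObject.const D).map f
  let G := (SimplicialObject.const D).map g
  let H := (SimplicialObject.const D).map (f ≫ g)
  have h : F ≫ G = H := ((SimplicialObject.const D).map_comp f g).symm
  obtain ⟨δ, h₁, h₂⟩ := exists_octahedron_retraction h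
  have hγ := S.simple_octahedronMap_mem h
  have h₂' : S.s.map (octahedronMap h) ≫ S.s.map δ = 𝟙 _ := by
    rw [← S.s.map_comp, h₂, S.s.map_id]
  have hδ : S.E (S.s.map δ) := by
    refine S.E.of_precomp _ _ hγ ?_
    rw [h₂']
    exact S.id_mem _
  let c : S.E.Q.obj (S.s.obj (simplicialCone (octahedronFst h))) ≅ S.E.Q.obj (S.cone g) :=
    Localization.Construction.wIso _ hδ
  refine (S.isCofiberSequence_simple (octahedronFst h)).of_iso (Iso.refl _) (Iso.refl _) c
    ?_ ?_ ?_
  · exact (Category.comp_id _).trans (Category.id_comp _).symm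
  · refine Eq.trans ?_ (Category.id_comp _).symm
    exact (S.E.Q.map_comp _ _).symm.trans (congrArg S.E.Q.map ((S.s.map_comp _ _).symm.trans
      (congrArg S.s.map h₁)))
  · refine (congrArg (fun k => _ ≫ k) (S.suspensionHo.map_id _)).trans
      ((Category.comp_id _).trans ?_)
    have := S.isIso_map_Q hγ
    refine (cancel_epi (S.E.Q.map (S.s.map (octahedronMap h)))).1 ?_
    have e₁ : S.E.Q.map (S.s.map (octahedronMap h)) ≫ c.hom = 𝟙 _ :=
      (S.E.Q.map_comp _ _).symm.trans ((congrArg S.E.Q.map h₂').trans (S.E.Q.map_id _))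
    have e₂ : S.E.Q.map (S.s.map (simplicialConeProj G)) ≫ S.E.Q.map (S.s.map
        ((simplicialSuspensionFunctor D).map (Cyl.inY F (toPoint _)))) =
        S.E.Q.map (S.s.map (octahedronMap h)) ≫
          S.E.Q.map (S.s.map (simplicialConeProj (octahedronFst h))) :=
      (S.E.Q.map_comp _ _).symm.trans ((congrArg S.E.Q.map ((S.s.map_comp _ _).symm.trans
        ((congrArg S.s.map (simplicialConeProj_map (F := G) (F' := octahedronFst h)
          (a := Cyl.inY F (toPoint _)) (b := Cyl.inY H (toPoint _))
          (Cyl.inY_map (𝟙 _) G (𝟙 _) (by rw [h, Category.id_comp]) (point_hom_ext _ _)).symm)).trans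
        (S.s.map_comp _ _)))).trans (S.E.Q.map_comp _ _))
    have e₃ := S.simpleSuspensionIso_naturality (Cyl.inY F (toPoint _))
    have e₄ : (S.simpleSuspensionIso ((SimplicialObject.const D).obj B)).hom ≫
        S.E.Q.map (S.suspension.map (S.s.map (Cyl.inY F (toPoint _)))) =
        S.suspensionHo.map (S.E.Q.map (S.coneIncl f)) := by
      rw [simpleSuspensionIso_const_hom, suspensionHo_map_Q, suspensionHo_map_Q]
      refine (S.E.Q.map_comp _ _).symm.trans (congrArg S.E.Q.map ?_)
      exact (S.suspension.map_comp _ _).symm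
    have aux : ∀ {P Q R T U V : S.Ho} {o : P ⟶ Q} {c : Q ⟶ P} {pa : Q ⟶ R} {ψ : R ⟶ T}
        {pg : P ⟶ U} {si : U ⟶ R} {l : U ⟶ T} {ψ' : U ⟶ V} {r : V ⟶ T}, o ≫ c = 𝟙 P →
        pg ≫ si = o ≫ pa → si ≫ ψ = ψ' ≫ r → ψ' ≫ r = l → o ≫ pa ≫ ψ = o ≫ c ≫ pg ≫ l := by
      intro P Q R T U V o c pa ψ pg si l ψ' r h₁ h₂ h₃ h₄
      rw [← Category.assoc, ← h₂, Category.assoc, h₃, h₄, ← Category.assoc o, h₁,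
        Category.id_comp]
    exact aux e₁ e₂ e₃ e₄

/-- The octahedron axiom. -/
lemma octahedron {A B C C' A' B' : S.Ho} {u : A ⟶ B} {v : B ⟶ C}
    {i : B ⟶ C'} {p : C' ⟶ S.suspensionHo.obj A} {j : C ⟶ A'} {q : A' ⟶ S.suspensionHo.obj B}
    {k : C ⟶ B'} {r : B' ⟶ S.suspensionHo.obj A} (h₁ : S.IsCofiberSequence u i p)
    (h₂ : S.IsCofiberSequence v j q) (h₃ : S.IsCofiberSequence (u ≫ v) k r) :
    ∃ (α : C' ⟶ B') (β : B' ⟶ A'),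
      i ≫ α = v ≫ k ∧ α ≫ r = p ∧ k ≫ β = j ∧ β ≫ q = r ≫ S.suspensionHo.map u ∧
        S.IsCofiberSequence α β (q ≫ S.suspensionHo.map i) := by
  obtain ⟨T, x, w, hw, hx⟩ := S.exists_fraction (A := A.as.obj) (B := B.as.obj) u
  let b : B ≅ S.E.Q.obj T := Localization.Construction.wIso w hw
  -- The fraction for `v` is taken after moving `B` to `T`, so that `x` and `y` are composable in
  -- `D`.
  obtain ⟨U, y, z, hz, hy⟩ := S.exists_fraction (A := T) (B := C.as.obj) (b.inv ≫ v)
  let c : C ≅ S.E.Q.obj U := Localization.Construction.wIso z hz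
  let a : A ≅ S.E.Q.obj A.as.obj := Iso.refl _
  have hu : u ≫ b.hom = a.hom ≫ S.E.Q.map x := hx.trans (Category.id_comp _).symm
  have hv : v ≫ c.hom = b.hom ≫ S.E.Q.map y := by
    have : (b.inv ≫ v) ≫ c.hom = S.E.Q.map y := hy
    rw [← this, Category.assoc, Iso.hom_inv_id_assoc]
  have huv : (u ≫ v) ≫ c.hom = a.hom ≫ S.E.Q.map (x ≫ y) := by
    rw [Category.assoc, hv, reassoc_of% hu, S.E.Q.map_comp]
  obtain ⟨φ₁, hi, hp⟩ := h₁.exists_iso x a b hu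
  obtain ⟨φ₂, hj, hq⟩ := h₂.exists_iso y b c hv
  obtain ⟨φ₃, hk, hr⟩ := h₃.exists_iso (x ≫ y) a c huv
  let α₀ := S.E.Q.map (S.coneMap (f := x) (f' := x ≫ y) (𝟙 _) y (Category.id_comp _).symm)
  let β₀ := S.E.Q.map (S.coneMap (f := x ≫ y) (f' := y) x (𝟙 _) (Category.comp_id _))
  have r₁ : S.E.Q.map (S.coneIncl x) ≫ α₀ = S.E.Q.map y ≫ S.E.Q.map (S.coneIncl (x ≫ y)) := by
    rw [← S.E.Q.map_comp, ← S.E.Q.map_comp, coneIncl_map]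
  have r₂ : S.coneProjHo x = α₀ ≫ S.coneProjHo (x ≫ y) := by
    rw [← S.coneProjHo_map (f := x) (f' := x ≫ y) (a := 𝟙 _) (b := y) (Category.id_comp _).symm,
      S.E.Q.map_id]
    exact (Category.comp_id _).symm.trans (congrArg (fun k => _ ≫ k) (S.suspensionHo.map_id _).symm)
  have r₃ : S.E.Q.map (S.coneIncl (x ≫ y)) ≫ β₀ = S.E.Q.map (S.coneIncl y) := by
    rw [← S.E.Q.map_comp, coneIncl_map, Category.id_comp]
  have r₄ : S.coneProjHo (x ≫ y) ≫ S.suspensionHo.map (S.E.Q.map x) = β₀ ≫ S.coneProjHo y :=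
    S.coneProjHo_map (f := x ≫ y) (f' := y) (a := x) (b := 𝟙 _) (Category.comp_id _)
  refine ⟨φ₁.hom ≫ α₀ ≫ φ₃.inv, φ₃.hom ≫ β₀ ≫ φ₂.inv, ?_, ?_, ?_, ?_, ?_⟩
  · rw [reassoc_of% hi, reassoc_of% r₁, ← reassoc_of% hv, ← reassoc_of% hk, Iso.hom_inv_id,
      Category.comp_id]
  · rw [← cancel_mono (S.suspensionHo.map a.hom), hp, r₂, Category.assoc, Category.assoc,
      Category.assoc, hr, Iso.inv_hom_id_assoc]
  · rw [reassoc_of% hk, reassoc_of% r₃, ← reassoc_of% hj, Iso.hom_inv_id, Category.comp_id]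
  · rw [← cancel_mono (S.suspensionHo.map b.hom), Category.assoc, Category.assoc, Category.assoc,
      hq, Iso.inv_hom_id_assoc, ← r₄, ← reassoc_of% hr, Category.assoc, ← S.suspensionHo.map_comp,
      ← S.suspensionHo.map_comp, hu]
  · refine (S.isCofiberSequence_octahedron x y).of_iso φ₁.symm φ₃.symm φ₂.symm ?_ ?_ ?_
    · exact (Iso.inv_hom_id_assoc _ _).symm
    · exact (Iso.inv_hom_id_assoc _ _).symm
    · rw [Iso.symm_hom, Iso.symm_hom, Iso.eq_inv_comp, Category.assoc, ← reassoc_of% hq,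
        ← S.suspensionHo.map_comp, ← S.suspensionHo.map_comp, ← reassoc_of% hi, Iso.hom_inv_id,
        Category.comp_id]

end Octahedron

end SimplicialDescentStructure

/-! ### TR3: morphisms of cofiber sequences -/

namespace SimplicialDescentStructure

open SimplicialDescent

variable {D : Type u} [Category.{v} D] [HasFiniteCoproducts D] [HasTerminal D]
  {S : SimplicialDescentStructure D}

/-- A morphism between the first maps of two cofiber sequences extends to a morphism of
triangles. -/
lemma IsCofiberSequence.exists_fill {A B C A' B' C' : S.Ho} {u : A ⟶ B} {v : B ⟶ C}
    {w : C ⟶ S.suspensionHo.obj A} {u' : A' ⟶ B'} {v' : B' ⟶ C'}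
    {w' : C' ⟶ S.suspensionHo.obj A'} (h : S.IsCofiberSequence u v w)
    (h' : S.IsCofiberSequence u' v' w') (a : A ⟶ A') (b : B ⟶ B') (hab : u ≫ b = a ≫ u') :
    ∃ c : C ⟶ C', v ≫ c = b ≫ v' ∧ w ≫ S.suspensionHo.map a = c ≫ w' := by
  obtain ⟨A₀, B₀, f, a₀, b₀, c₀, hu, hv, hw⟩ := h
  obtain ⟨A₁, B₁, f', a₁, b₁, c₁, hu', hv', hw'⟩ := h'
  obtain ⟨c, hc, hc', -⟩ := SimplicialDescentStructure.exists_fill (f := f) (f' := f')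
    (a₀.inv ≫ a ≫ a₁.hom) (b₀.inv ≫ b ≫ b₁.hom) (by
      rw [Category.assoc, Category.assoc, ← hu', ← reassoc_of% hab, ← cancel_epi a₀.hom,
        ← reassoc_of% hu, Iso.hom_inv_id_assoc, Iso.hom_inv_id_assoc])
  refine ⟨c₀.hom ≫ c ≫ c₁.inv, ?_, ?_⟩
  · rw [reassoc_of% hv, reassoc_of% hc, Iso.hom_inv_id_assoc, ← reassoc_of% hv',
      Iso.hom_inv_id, Category.comp_id]
  · rw [← cancel_mono (S.suspensionHo.map a₁.hom), Category.assoc, Category.assoc,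
      Category.assoc, Category.assoc, hw', Iso.inv_hom_id_assoc, ← hc', ← reassoc_of% hw,
      ← S.suspensionHo.map_comp, ← S.suspensionHo.map_comp, Iso.hom_inv_id_assoc]

end SimplicialDescentStructure

/-! ### Descent functors and cofiber sequences -/

section

open SimplicialDescent

variable {D : Type u} [Category.{v} D] [HasFiniteCoproducts D] [HasTerminal D]
  {D' : Type u'} [Category.{v'} D'] [HasFiniteCoproducts D'] [HasTerminal D']

lemma constComp_naturality (ψ : D ⥤ D') {A B : D} (f : A ⟶ B) :
    (simplicialExt ψ).map ((SimplicialObject.const D).map f) ≫ (Functor.constComp _ B ψ).hom =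
      (Functor.constComp _ A ψ).hom ≫ (SimplicialObject.const D').map (ψ.map f) :=
  NatTrans.ext (funext fun _ => (Category.comp_id (ψ.map f)).trans (Category.id_comp _).symm)

lemma SimplicialDescent.Cyl.map_sq {X₁ Y₁ Z₁ X₂ Y₂ Z₂ X₃ Y₃ Z₃ X₄ Y₄ Z₄ : SimplicialObject D}
    {f₁ : X₁ ⟶ Y₁} {g₁ : X₁ ⟶ Z₁} {f₂ : X₂ ⟶ Y₂} {g₂ : X₂ ⟶ Z₂} {f₃ : X₃ ⟶ Y₃} {g₃ : X₃ ⟶ Z₃}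
    {f₄ : X₄ ⟶ Y₄} {g₄ : X₄ ⟶ Z₄} {a : X₁ ⟶ X₂} {b : Y₁ ⟶ Y₂} {c : Z₁ ⟶ Z₂} {a' : X₂ ⟶ X₄}
    {b' : Y₂ ⟶ Y₄} {c' : Z₂ ⟶ Z₄} {d : X₁ ⟶ X₃} {e : Y₁ ⟶ Y₃} {k : Z₁ ⟶ Z₃} {d' : X₃ ⟶ X₄}
    {e' : Y₃ ⟶ Y₄} {k' : Z₃ ⟶ Z₄} (h₁ : f₁ ≫ b = a ≫ f₂) (h₁' : g₁ ≫ c = a ≫ g₂)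
    (h₂ : f₂ ≫ b' = a' ≫ f₄) (h₂' : g₂ ≫ c' = a' ≫ g₄) (h₃ : f₁ ≫ e = d ≫ f₃)
    (h₃' : g₁ ≫ k = d ≫ g₃) (h₄ : f₃ ≫ e' = d' ≫ f₄) (h₄' : g₃ ≫ k' = d' ≫ g₄)
    (ha : a ≫ a' = d ≫ d') (hb : b ≫ b' = e ≫ e') (hc : c ≫ c' = k ≫ k') :
    Cyl.map a b c h₁ h₁' ≫ Cyl.map a' b' c' h₂ h₂' =
      Cyl.map d e k h₃ h₃' ≫ Cyl.map d' e' k' h₄ h₄' := by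
  rw [Cyl.map_comp, Cyl.map_comp]
  congr 1

/-- The map `Cyl(ψ(f × Δ), ψ(A × Δ) ⟶ ψ(∗)) ⟶ C(ψ(f) × Δ)` induced by `ψ(∗) ⟶ ∗`. -/
noncomputable def cylToCone (ψ : D ⥤ D') {A B : D} (f : A ⟶ B) :
    Cyl ((simplicialExt ψ).map ((SimplicialObject.const D).map f))
      ((simplicialExt ψ).map (toPoint ((SimplicialObject.const D).obj A))) ⟶
    simplicialCone ((SimplicialObject.const D').map (ψ.map f)) :=
  Cyl.map (Functor.constComp _ A ψ).hom (Functor.constComp _ B ψ).hom (toPoint _)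
    (constComp_naturality ψ f) (point_hom_ext _ _)

/-- The map `Cyl(ψF, ψX ⟶ ψ(∗)) ⟶ Cyl(ψX ⟶ ψ(∗), ψX ⟶ ψ(∗))` which collapses `ψY` to `ψ(∗)`. -/
noncomputable def cylExtProj (ψ : D ⥤ D') {X Y : SimplicialObject D} (F : X ⟶ Y) :
    Cyl ((simplicialExt ψ).map F) ((simplicialExt ψ).map (toPoint X)) ⟶
      Cyl ((simplicialExt ψ).map (toPoint X)) ((simplicialExt ψ).map (toPoint X)) :=
  Cyl.map ((simplicialExt ψ).map (𝟙 X)) ((simplicialExt ψ).map (toPoint Y))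
    ((simplicialExt ψ).map (𝟙 (point D)))
    (by rw [← Functor.map_comp, ← Functor.map_comp, point_hom_ext (F ≫ toPoint Y) (𝟙 X ≫ _)])
    (by rw [← Functor.map_comp, ← Functor.map_comp, point_hom_ext (toPoint X ≫ 𝟙 _) (𝟙 X ≫ _)])

lemma cylComparison_proj (ψ : D ⥤ D') {X Y : SimplicialObject D} (F : X ⟶ Y) :
    cylComparison ψ F (toPoint X) ≫ (simplicialExt ψ).map (simplicialConeProj F) =
      cylExtProj ψ F ≫ cylComparison ψ (toPoint X) (toPoint X) :=
  cylComparison_naturality ψ _ _ _ (point_hom_ext _ _) (point_hom_ext _ _)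

lemma cylExtProj_toSuspension (ψ : D ⥤ D') {A B : D} (f : A ⟶ B) :
    cylExtProj ψ ((SimplicialObject.const D).map f) ≫ cylToSuspension ψ A =
      cylToCone ψ f ≫ simplicialConeProj ((SimplicialObject.const D').map (ψ.map f)) := by
  exact Cyl.map_sq _ _ _ _ _ _ (point_hom_ext _ _) (point_hom_ext _ _) (NatTrans.ext (funext fun _ => congrArg (fun k => k ≫ 𝟙 _)
    (ψ.map_id A))) (point_hom_ext _ _) (point_hom_ext _ _)

lemma inY_cylToCone (ψ : D ⥤ D') {A B : D} (f : A ⟶ B) :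
    Cyl.inY _ _ ≫ cylToCone ψ f = (Functor.constComp _ B ψ).hom ≫ Cyl.inY _ _ :=
  Cyl.inY_map _ _ _ _ _

/-- The map `Cyl(ψX ⟶ ψ(∗), ψX ⟶ ψ(∗)) ⟶ Cyl(ψX' ⟶ ψ(∗), ψX' ⟶ ψ(∗))` induced by
`X ⟶ X'`. -/
noncomputable def cylExtMap (ψ : D ⥤ D') {X X' : SimplicialObject D} (a : X ⟶ X') :
    Cyl ((simplicialExt ψ).map (toPoint X)) ((simplicialExt ψ).map (toPoint X)) ⟶
      Cyl ((simplicialExt ψ).map (toPoint X')) ((simplicialExt ψ).map (toPoint X')) :=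
  Cyl.map ((simplicialExt ψ).map a) ((simplicialExt ψ).map (𝟙 (point D)))
    ((simplicialExt ψ).map (𝟙 (point D)))
    (by rw [← Functor.map_comp, ← Functor.map_comp, point_hom_ext (toPoint X ≫ 𝟙 _) (a ≫ _)])
    (by rw [← Functor.map_comp, ← Functor.map_comp, point_hom_ext (toPoint X ≫ 𝟙 _) (a ≫ _)])

lemma cylComparison_suspension (ψ : D ⥤ D') {X X' : SimplicialObject D} (a : X ⟶ X') :
    cylComparison ψ (toPoint X) (toPoint X) ≫
        (simplicialExt ψ).map ((simplicialSuspensionFunctor D).map a) =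
      cylExtMap ψ a ≫ cylComparison ψ (toPoint X') (toPoint X') :=
  cylComparison_naturality ψ _ _ _ (point_hom_ext _ _) (point_hom_ext _ _)

lemma cylExtMap_toSuspension (ψ : D ⥤ D') {A B : D} (f : A ⟶ B) :
    cylExtMap ψ ((SimplicialObject.const D).map f) ≫ cylToSuspension ψ B =
      cylToSuspension ψ A ≫ (simplicialSuspensionFunctor D').map
        ((SimplicialObject.const D').map (ψ.map f)) := by
  exact Cyl.map_sq _ _ _ _ _ _ (point_hom_ext _ _) (point_hom_ext _ _) (constComp_naturality ψ f) (point_hom_ext _ _)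
    (point_hom_ext _ _)

lemma SimplicialDescentStructure.Q_map_sq (S : SimplicialDescentStructure D)
    {P Q R T : SimplicialObject D} {f : P ⟶ Q} {g : Q ⟶ T} {h : P ⟶ R} {k : R ⟶ T}
    (e : f ≫ g = h ≫ k) : S.E.Q.map (S.s.map f) ≫ S.E.Q.map (S.s.map g) =
      S.E.Q.map (S.s.map h) ≫ S.E.Q.map (S.s.map k) := by
  rw [← S.E.Q.map_comp, ← S.E.Q.map_comp, ← S.s.map_comp, ← S.s.map_comp, e]

namespace DescentFunctor

variable {S : SimplicialDescentStructure D} {S' : SimplicialDescentStructure D'} {ψ : D ⥤ D'}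
  (F : DescentFunctor S S' ψ)

-- In each degree this compares finite coproducts, which `ψ` preserves up to equivalence.
include F in
lemma simple_cylComparison_mem {X Y Z : SimplicialObject D} (f : X ⟶ Y) (g : X ⟶ Z) :
    S'.E (S'.s.map (cylComparison ψ f g)) :=
  S'.s_mem _ fun n => cylComparison_app_mem ψ S'.id_mem S'.coprod_mem F.coprod_mem f g n

include F in
lemma simple_cylToCone_mem {A B : D} (f : A ⟶ B) : S'.E (S'.s.map (cylToCone ψ f)) :=
  S'.s_mem _ fun n => cylMap_app_mem S'.coprod_mem S'.id_mem _ _ _ _ _ n (S'.id_mem _)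
    (S'.id_mem _) F.terminal_mem

include F in
lemma simple_cylToSuspension_mem (A : D) : S'.E (S'.s.map (cylToSuspension ψ A)) :=
  S'.s_mem _ fun n => cylMap_app_mem S'.coprod_mem S'.id_mem _ _ _ _ _ n (S'.id_mem _)
    F.terminal_mem F.terminal_mem

/-- The isomorphism `ψ(sX) ≅ s'(ψX)` of `Ho D'`. -/
noncomputable def ΘApp (X : SimplicialObject D) :
    S'.E.Q.obj (ψ.obj (S.s.obj X)) ≅ S'.E.Q.obj (S'.s.obj ((simplicialExt ψ).obj X)) :=
  (evalAt _ S'.E X).mapIso F.Θ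

lemma ΘApp_naturality {X Y : SimplicialObject D} (f : X ⟶ Y) :
    S'.E.Q.map (ψ.map (S.s.map f)) ≫ (F.ΘApp Y).hom =
      (F.ΘApp X).hom ≫ S'.E.Q.map (S'.s.map ((simplicialExt ψ).map f)) :=
  evalAt_naturality S'.E F.Θ.hom f

/-- In `Ho D'` the maps `ρ` and `λ` become inverse to each other on both sides, so compatibility of
`Θ` with `λ` passes to `ρ`. -/
lemma ΘApp_rho (A : D) :
    S'.E.Q.map (ψ.map (S.rho.app A)) ≫ (F.ΘApp ((SimplicialObject.const D).obj A)).hom ≫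
      S'.E.Q.map (S'.s.map (Functor.constComp _ A ψ).hom) = S'.E.Q.map (S'.rho.app (ψ.obj A)) := by
  have h : (F.ΘApp ((SimplicialObject.const D).obj A)).hom ≫ S'.E.Q.map (S'.s.map
      (Functor.constComp _ A ψ).hom ≫ S'.lam.app (ψ.obj A)) =
      S'.E.Q.map (ψ.map (S.lam.app A)) := F.Θ_lam A
  have h' : S'.E.Q.map (ψ.map (S.rho.app A)) ≫ S'.E.Q.map (ψ.map (S.lam.app A)) = 𝟙 _ := by
    rw [← S'.E.Q.map_comp, ← ψ.map_comp, S.rho_app_lam_app]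
    exact (congrArg S'.E.Q.map (ψ.map_id A)).trans (S'.E.Q.map_id _)
  have h'' : S'.E.Q.map (S'.rho.app (ψ.obj A)) ≫ S'.E.Q.map (S'.lam.app (ψ.obj A)) = 𝟙 _ :=
    (S'.E.Q.map_comp _ _).symm.trans ((congrArg S'.E.Q.map (S'.rho_app_lam_app _)).trans
      (S'.E.Q.map_id _))
  have := S'.isIso_map_Q (S'.lam_mem (ψ.obj A))
  have aux : ∀ {P Q R T U : S'.Ho} {p : P ⟶ Q} {θ : Q ⟶ R} {c : R ⟶ T} {l : T ⟶ U} {r : P ⟶ T}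
      {m : Q ⟶ U} {n : P ⟶ U} {cl : R ⟶ U}, IsIso l → c ≫ l = cl → θ ≫ cl = m → p ≫ m = n →
      r ≫ l = n → p ≫ θ ≫ c = r := by
    intro P Q R T U p θ c l r m n cl hl h₁ h₂ h₃ h₄
    rw [← cancel_mono l, Category.assoc, Category.assoc, h₁, h₂, h₃, h₄]
  exact aux this (S'.E.Q.map_comp _ _).symm h h' h''

/-- The isomorphism `ψ(c(f)) ≅ c(ψ(f))` of `Ho D'`. -/
noncomputable def coneIso {A B : D} (f : A ⟶ B) :
    S'.E.Q.obj (ψ.obj (S.cone f)) ≅ S'.E.Q.obj (S'.cone (ψ.map f)) :=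
  F.ΘApp _ ≪≫ (Localization.Construction.wIso _ (F.simple_cylComparison_mem _ _)).symm ≪≫
    Localization.Construction.wIso _ (F.simple_cylToCone_mem f)

/-- The isomorphism `ψ(ΣA) ≅ Σ'(ψA)` of `Ho D'`. -/
noncomputable def suspensionIso (A : D) :
    S'.E.Q.obj (ψ.obj (S.suspension.obj A)) ≅ S'.E.Q.obj (S'.suspension.obj (ψ.obj A)) :=
  F.ΘApp (simplicialSuspension ((SimplicialObject.const D).obj A)) ≪≫
    (Localization.Construction.wIso _ (F.simple_cylComparison_mem _ _)).symm ≪≫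
    Localization.Construction.wIso _ (F.simple_cylToSuspension_mem A)

/-- Naturality of the inverse of a morphism which becomes invertible. -/
lemma square_inv {C : Type*} [Category C] {P Q R P' Q' R' T T' : C} {θ : P ≅ Q} {κ : R ≅ Q}
    {π : R ≅ T} {θ' : P' ≅ Q'} {κ' : R' ≅ Q'} {π' : R' ≅ T'} {p : P ⟶ P'} {q : Q ⟶ Q'}
    {r : R ⟶ R'} {t : T ⟶ T'} (h₁ : p ≫ θ'.hom = θ.hom ≫ q) (h₂ : κ.hom ≫ q = r ≫ κ'.hom)
    (h₃ : r ≫ π'.hom = π.hom ≫ t) :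
    p ≫ (θ' ≪≫ κ'.symm ≪≫ π').hom = (θ ≪≫ κ.symm ≪≫ π).hom ≫ t := by
  rw [← Iso.eq_inv_comp] at h₂
  simp only [Iso.trans_hom, Iso.symm_hom, Category.assoc, reassoc_of% h₁, h₂, Iso.hom_inv_id_assoc,
    ← h₃]

/-- Both vertical isomorphisms consist of `Θ`, an inverted comparison of cylinders and a change of
vertex. Each step is compatible with the collapse of the target corner, and `square_inv` pastes the
three squares. -/
lemma coneIso_proj {A B : D} (f : A ⟶ B) :
    S'.E.Q.map (ψ.map (S.coneProj f)) ≫ (F.suspensionIso A).hom =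
      (F.coneIso f).hom ≫ S'.E.Q.map (S'.coneProj (ψ.map f)) :=
  square_inv (F.ΘApp_naturality _)
    ((S'.Q_map_sq (cylComparison_proj ψ ((SimplicialObject.const D).map f))))
    (S'.Q_map_sq (cylExtProj_toSuspension ψ f))

lemma suspensionIso_naturality {A B : D} (f : A ⟶ B) :
    S'.E.Q.map (ψ.map (S.suspension.map f)) ≫ (F.suspensionIso B).hom =
      (F.suspensionIso A).hom ≫ S'.E.Q.map (S'.suspension.map (ψ.map f)) :=
  square_inv (F.ΘApp_naturality _)
    ((S'.Q_map_sq (cylComparison_suspension ψ ((SimplicialObject.const D).map f))))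
    (S'.Q_map_sq (cylExtMap_toSuspension ψ f))

/-- On the corner of the target all comparisons of cylinders are identities, which leaves `Θ` at a
constant object, that is, `ΘApp_rho`. -/
lemma coneIncl_coneIso {A B : D} (f : A ⟶ B) :
    S'.E.Q.map (ψ.map (S.coneIncl f)) ≫ (F.coneIso f).hom =
      S'.E.Q.map (S'.coneIncl (ψ.map f)) := by
  have e₁ : S'.E.Q.map (ψ.map (S.coneIncl f)) = S'.E.Q.map (ψ.map (S.rho.app B)) ≫
      S'.E.Q.map (ψ.map (S.s.map (Cyl.inY _ _))) :=
    (congrArg S'.E.Q.map (ψ.map_comp _ _)).trans (S'.E.Q.map_comp _ _)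
  have e₂ : S'.E.Q.map (S'.coneIncl (ψ.map f)) = S'.E.Q.map (S'.rho.app (ψ.obj B)) ≫
      S'.E.Q.map (S'.s.map (Cyl.inY _ _)) := S'.E.Q.map_comp _ _
  have e₃ : S'.E.Q.map (S'.s.map (Cyl.inY ((simplicialExt ψ).map
      ((SimplicialObject.const D).map f)) ((simplicialExt ψ).map (toPoint _)))) ≫
      S'.E.Q.map (S'.s.map (cylComparison ψ _ _)) =
      S'.E.Q.map (S'.s.map ((simplicialExt ψ).map (Cyl.inY _ _))) :=
    (S'.E.Q.map_comp _ _).symm.trans (congrArg S'.E.Q.map ((S'.s.map_comp _ _).symm.trans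
      (congrArg S'.s.map (inY_cylComparison ψ _ _))))
  have e₄ := S'.Q_map_sq (inY_cylToCone ψ f)
  have aux : ∀ {P Q R T U V W : S'.Ho} {ρ : P ⟶ Q} {i : Q ⟶ R} {θ' : R ≅ V} {κ : W ≅ V}
      {π : W ≅ U} {θ : Q ≅ T} {j : T ⟶ V} {k : T ⟶ W} {X : S'.Ho} {c : T ⟶ X} {l : X ⟶ U}
      {ρ' : P ⟶ X}, i ≫ θ'.hom = θ.hom ≫ j → k ≫ κ.hom = j → k ≫ π.hom = c ≫ l →
      ρ ≫ θ.hom ≫ c = ρ' → (ρ ≫ i) ≫ (θ' ≪≫ κ.symm ≪≫ π).hom = ρ' ≫ l := by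
    intro P Q R T U V W ρ i θ' κ π θ j k X c l ρ' h₁ h₂ h₃ h₄
    simp only [Iso.trans_hom, Iso.symm_hom, Category.assoc, reassoc_of% h₁, ← h₂,
      Iso.hom_inv_id_assoc, h₃, ← h₄]
  exact (congrArg (fun k => k ≫ _) e₁).trans ((aux (F.ΘApp_naturality _) e₃ e₄
    (F.ΘApp_rho B)).trans e₂.symm)

/-- The functor on homotopy categories sends the image of `f` to the image of `ψ(f)`. -/
lemma mapHo_map_Q {A B : D} (f : A ⟶ B) : F.mapHo.map (S.E.Q.map f) = S'.E.Q.map (ψ.map f) :=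
  localizedMap_map_Q ψ F.map_mem f

/-- The canonical natural transformation `ψΣ ⟶ Σ'ψ` of functors on `Ho D`. -/
noncomputable def suspensionNatTrans :
    S.suspensionHo ⋙ F.mapHo ⟶ F.mapHo ⋙ S'.suspensionHo :=
  Localization.Construction.natTransExtension (W := S.E)
    { app := fun A => (F.suspensionIso A).hom
      naturality := fun A B f => by
        have h₁ : F.mapHo.map (S.suspensionHo.map (S.E.Q.map f)) =
            S'.E.Q.map (ψ.map (S.suspension.map f)) :=
          (congrArg F.mapHo.map (S.suspensionHo_map_Q f)).trans (F.mapHo_map_Q _)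
        have h₂ : S'.suspensionHo.map (F.mapHo.map (S.E.Q.map f)) =
            S'.E.Q.map (S'.suspension.map (ψ.map f)) :=
          (congrArg S'.suspensionHo.map (F.mapHo_map_Q f)).trans (S'.suspensionHo_map_Q _)
        exact (congrArg (fun k => k ≫ (F.suspensionIso B).hom) h₁).trans
          ((F.suspensionIso_naturality f).trans
            (congrArg (fun k => (F.suspensionIso A).hom ≫ k) h₂).symm) }

lemma suspensionNatTrans_app (A : D) :
    F.suspensionNatTrans.app (S.E.Q.obj A) = (F.suspensionIso A).hom :=
  Localization.Construction.NatTransExtension.app_eq _ A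

/-- The canonical natural isomorphism `ψΣ ≅ Σ'ψ` of functors on `Ho D`. -/
noncomputable def suspensionNatIso : S.suspensionHo ⋙ F.mapHo ≅ F.mapHo ⋙ S'.suspensionHo :=
  have : ∀ A, IsIso (F.suspensionNatTrans.app A) := fun A => by
    have h := F.suspensionNatTrans_app A.as.obj
    have e : IsIso (F.suspensionIso A.as.obj).hom := inferInstance
    exact h ▸ e
  have := NatIso.isIso_of_isIso_app F.suspensionNatTrans
  asIso F.suspensionNatTrans

lemma suspensionNatIso_app (A : D) :
    F.suspensionNatIso.hom.app (S.E.Q.obj A) = (F.suspensionIso A).hom :=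
  F.suspensionNatTrans_app A

lemma isCanonical_suspensionNatIso : F.IsCanonical F.suspensionNatIso := fun A => by
  refine ⟨F.simple_cylComparison_mem _ _, F.simple_cylToSuspension_mem A, ?_⟩
  have aux : ∀ {P Q R T : S'.Ho} (θ : P ≅ Q) (κ : R ≅ Q) (π : R ≅ T) {e : P ⟶ T},
      e = (θ ≪≫ κ.symm ≪≫ π).hom → κ.hom ≫ θ.inv ≫ e = π.hom := by
    rintro P Q R T θ κ π _ rfl
    simp
  exact aux (F.ΘApp _) (Localization.Construction.wIso _ (F.simple_cylComparison_mem _ _))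
    (Localization.Construction.wIso _ (F.simple_cylToSuspension_mem A))
    (F.suspensionNatIso_app A)

/-- A descent functor preserves cofiber sequences. -/
lemma map_isCofiberSequence {A B C : S.Ho} {u : A ⟶ B} {v : B ⟶ C}
    {w : C ⟶ S.suspensionHo.obj A} (h : S.IsCofiberSequence u v w) :
    S'.IsCofiberSequence (F.mapHo.map u) (F.mapHo.map v)
      (F.mapHo.map w ≫ F.suspensionNatIso.hom.app A) := by
  obtain ⟨A₀, B₀, f, a, b, c, hu, hv, hw⟩ := h
  -- The model for the image triangle is the standard triangle of `ψ.map f`, reached through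
  -- `coneIso`.
  refine ⟨ψ.obj A₀, ψ.obj B₀, ψ.map f, F.mapHo.mapIso a, F.mapHo.mapIso b,
    F.mapHo.mapIso c ≪≫ F.coneIso f, ?_, ?_, ?_⟩
  · exact ((F.mapHo.map_comp _ _).symm.trans ((congrArg F.mapHo.map hu).trans
      (F.mapHo.map_comp _ _))).trans (congrArg (fun k => F.mapHo.map a.hom ≫ k) (F.mapHo_map_Q f))
  · have e₁ : F.mapHo.map v ≫ F.mapHo.map c.hom =
        F.mapHo.map b.hom ≫ S'.E.Q.map (ψ.map (S.coneIncl f)) :=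
      ((F.mapHo.map_comp _ _).symm.trans ((congrArg F.mapHo.map hv).trans
        (F.mapHo.map_comp _ _))).trans
        (congrArg (fun k => F.mapHo.map b.hom ≫ k) (F.mapHo_map_Q _))
    exact (Category.assoc _ _ _).symm.trans ((congrArg (fun k => k ≫ (F.coneIso f).hom) e₁).trans
      ((Category.assoc _ _ _).trans (congrArg (fun k => F.mapHo.map b.hom ≫ k)
        (F.coneIncl_coneIso f))))
  · have e₁ : F.mapHo.map w ≫ F.mapHo.map (S.suspensionHo.map a.hom) =
        F.mapHo.map c.hom ≫ S'.E.Q.map (ψ.map (S.coneProj f)) :=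
      ((F.mapHo.map_comp _ _).symm.trans ((congrArg F.mapHo.map hw).trans
        (F.mapHo.map_comp _ _))).trans
        (congrArg (fun k => F.mapHo.map c.hom ≫ k) (F.mapHo_map_Q _))
    have e₂ := (F.suspensionNatIso.hom.naturality a.hom).symm
    have e₃ := F.coneIso_proj f
    have aux : ∀ {P Q R T U V W : S'.Ho} {w : P ⟶ Q} {η : Q ⟶ R} {a' : R ⟶ T} {a : Q ⟶ U}
        {η' η'' : U ⟶ T} {c : P ⟶ V} {p : V ⟶ U} {k : V ⟶ W} {q : W ⟶ T}, η ≫ a' = a ≫ η' →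
        η' = η'' → w ≫ a = c ≫ p → p ≫ η'' = k ≫ q → (w ≫ η) ≫ a' = (c ≫ k) ≫ q := by
      rintro P Q R T U V W w η a' a η' _ c p k q h₁ rfl h₂ h₃
      rw [Category.assoc, h₁, ← Category.assoc, h₂, Category.assoc, h₃, Category.assoc]
    exact aux e₂ (F.suspensionNatIso_app A₀) e₁ e₃

end DescentFunctor
end

/-! ### The theorem assembled -/

theorem mainTheorem2 {D : Type u} [Category.{v} D] [HasFiniteCoproducts D] [HasTerminal D]
    (S : SimplicialDescentStructure D) :
    -- TR1 i)
    (∀ A : D, ∃ w : S.E.Q.obj (⊤_ D) ⟶ S.suspensionHo.obj (S.E.Q.obj A),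
      S.IsCofiberSequence (𝟙 (S.E.Q.obj A)) (S.E.Q.map (terminal.from A)) w) ∧
    -- TR1 ii)
    (∀ (A B C A' B' C' : S.Ho) (u : A ⟶ B) (v : B ⟶ C) (w : C ⟶ S.suspensionHo.obj A)
      (u' : A' ⟶ B') (v' : B' ⟶ C') (w' : C' ⟶ S.suspensionHo.obj A')
      (a : A ≅ A') (b : B ≅ B') (c : C ≅ C'),
      u ≫ b.hom = a.hom ≫ u' → v ≫ c.hom = b.hom ≫ v' →
      w ≫ S.suspensionHo.map a.hom = c.hom ≫ w' →
      S.IsCofiberSequence u v w → S.IsCofiberSequence u' v' w') ∧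
    -- TR1 iii)
    (∀ (A B : S.Ho) (u : A ⟶ B), ∃ (C : S.Ho) (v : B ⟶ C) (w : C ⟶ S.suspensionHo.obj A),
      S.IsCofiberSequence u v w) ∧
    -- the map `p₁` is an equivalence, so that the minus sign `m_B = p₂ p₁⁻¹` makes sense in
    -- `Ho D`; it is natural, its square is the identity, and non-stable TR2 holds with this sign
    ((∀ B : D, S.E (S.doubleSuspensionFst B)) ∧
      ∃ m : S.suspensionHo ⟶ S.suspensionHo,
        (∀ B : D, S.E.Q.map (S.doubleSuspensionFst B) ≫ m.app (S.E.Q.obj B) =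
          S.E.Q.map (S.doubleSuspensionSnd B)) ∧
        m ≫ m = 𝟙 S.suspensionHo ∧
        ∀ (A B C : S.Ho) (u : A ⟶ B) (v : B ⟶ C) (w : C ⟶ S.suspensionHo.obj A),
          S.IsCofiberSequence u v w →
          S.IsCofiberSequence v w (S.suspensionHo.map u ≫ m.app B)) ∧
    -- TR3
    (∀ (A B C A' B' C' : S.Ho) (u : A ⟶ B) (v : B ⟶ C) (w : C ⟶ S.suspensionHo.obj A)
      (u' : A' ⟶ B') (v' : B' ⟶ C') (w' : C' ⟶ S.suspensionHo.obj A')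
      (a : A ⟶ A') (b : B ⟶ B'),
      S.IsCofiberSequence u v w → S.IsCofiberSequence u' v' w' → u ≫ b = a ≫ u' →
      ∃ c : C ⟶ C', v ≫ c = b ≫ v' ∧ w ≫ S.suspensionHo.map a = c ≫ w') ∧
    -- TR4 (octahedron)
    (∀ (A B C C' A' B' : S.Ho) (u : A ⟶ B) (v : B ⟶ C)
      (i : B ⟶ C') (p : C' ⟶ S.suspensionHo.obj A)
      (j : C ⟶ A') (q : A' ⟶ S.suspensionHo.obj B)
      (k : C ⟶ B') (r : B' ⟶ S.suspensionHo.obj A),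
      S.IsCofiberSequence u i p → S.IsCofiberSequence v j q →
      S.IsCofiberSequence (u ≫ v) k r →
      ∃ (α : C' ⟶ B') (β : B' ⟶ A'),
        i ≫ α = v ≫ k ∧ α ≫ r = p ∧ k ≫ β = j ∧ β ≫ q = r ≫ S.suspensionHo.map u ∧
        S.IsCofiberSequence α β (q ≫ S.suspensionHo.map i)) ∧
    -- descent functors preserve cofiber sequences
    (∀ (D' : Type u') [Category.{v'} D'] [HasFiniteCoproducts D'] [HasTerminal D']
      (S' : SimplicialDescentStructure D') (ψ : D ⥤ D') (F : DescentFunctor S S' ψ),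
      ∃ η : S.suspensionHo ⋙ F.mapHo ≅ F.mapHo ⋙ S'.suspensionHo,
        F.IsCanonical η ∧
        ∀ (A B C : S.Ho) (u : A ⟶ B) (v : B ⟶ C) (w : C ⟶ S.suspensionHo.obj A),
          S.IsCofiberSequence u v w →
          S'.IsCofiberSequence (F.mapHo.map u) (F.mapHo.map v)
            (F.mapHo.map w ≫ η.hom.app A)) := by
  refine ⟨S.exists_cofiberSequence_id, ?_, ?_, ⟨S.doubleSuspensionFst_mem, S.sign, ?_,
    S.sign_sign, ?_⟩, ?_, ?_, ?_⟩
  · intro A B C A' B' C' u v w u' v' w' a b c hu hv hw h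
    exact h.of_iso a b c hu hv hw
  · intro A B u
    exact S.exists_cofiberSequence u
  · intro B
    exact (congrArg (fun k => _ ≫ k) (S.sign_app B)).trans (S.fst_signApp B)
  · intro A B C u v w h
    exact h.rotate
  · intro A B C A' B' C' u v w u' v' w' a b h h' hab
    exact h.exists_fill h' a b hab
  · intro A B C C' A' B' u v i p j q k r h₁ h₂ h₃
    exact S.octahedron h₁ h₂ h₃
  · intro D' _ _ _ S' ψ F
    exact ⟨F.suspensionNatIso, F.isCanonical_suspensionNatIso,
      fun A B C u v w h => F.map_isCofiberSequence h⟩
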